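/- Setting. Fix a central energy $E\in[0,\hbar\Omega)$, a chemical potential $\mu$, and put $m_F=\lfloor(\mu-E)/\hbar\Omega\rfloor$. Let $a_{\beta m}$ ($\beta$ in a finite set of channels, $m\in\mathbb Z$) be incoming annihilation operators in a unital C*-algebra with $\{a_{\beta m},a_{\beta'm'}\}=0$ and $\{a_{\beta m},a^\dagger_{\beta'm'}\}=\delta_{\beta\beta'}\delta_{mm'}$, let $\mathcal U=(\mathcal U^{\alpha\beta})$ be a unitary matrix (the static scatterer), let $J_k$ be the Bessel function of the first kind of order $k$, and for a drive amplitude $A$ let $$b_{\alpha n}=\sum_{\beta,m}\mathcal U^{\alpha\beta}J_{n-m}(A)\,a_{\beta m}$$ be the outgoing operators. Fix a lead $\alpha$ and a state $\langle\cdot\rangle$ whose effective occupation seen in the lead $\alpha$ is a sharp Fermi step: $$\sum_\beta|\mathcal U^{\alpha\beta}|^2\langle a^\dagger_{\beta m}a_{\beta m}\rangle=\begin{cases}1,&m\le m_F,\\0,&m>m_F\end{cases}\qquad(m\in\mathbb Z).$$ Put $N_\nu=b^\dagger_{\alpha n}b_{\alpha n}$ with $n=m_F+\nu$, $\kappa_A=(A/2)^{1/3}$,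 $\nu_A(s)=\lfloor A+s\kappa_A\rfloor$, and $$K_{\mathrm{Ai}}(s,t)=\int_0^\infty \mathrm{Ai}(s+u)\,\mathrm{Ai}(t+u)\,du .$$ Claim. The commuting occupations $N_\nu$, with values in $\{0,1\}$, have a joint law in the state $\langle\cdot\rangle$. Let $\Xi_A=\sum_\nu N_\nu\,\delta_{(\nu-A)/\kappa_A}$ be the corresponding random measure on $\mathbb R$. As $A\to\infty$: 1. For every $k$, the rescaled $k$-point correlation functions of $\Xi_A$ (given by $\kappa_A^k\langle N_{\nu_A(s_1)}\cdots N_{\nu_A(s_k)}\rangle$ if the sites $\nu_A(s_i)$ are pairwise distinct, and by $0$ otherwise) converge, locally uniformly in $(s_1,\dots,s_k)\in\mathbb R^k$, to the correlation functions $\det[K_{\mathrm{Ai}}(s_i,s_j)]_{i,j=1}^k$ of the Airy determinantal point process $\Xi_{\mathrm{Ai}}$. 2. $\Xi_A$ converges weakly (in law, for the vague topology), as a point process on $\mathbb R$, to $\Xi_{\mathrm{Ai}}$. 3. For every $s$, $\kappa_A\langle N_{\nu_A(s)}\rangle\to K_{\mathrm{Ai}}(s,s)$; and for all $s\ne t$,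 $$\kappa_A^2\big(\langle N_{\nu_A(s)}N_{\nu_A(t)}\rangle-\langle N_{\nu_A(s)}\rangle\langle N_{\nu_A(t)}\rangle\big)\to-|K_{\mathrm{Ai}}(s,t)|^2 .$$ 4. For every $s$, $\langle N_{\nu_A(s)}\rangle\sim\kappa_A^{-1}K_{\mathrm{Ai}}(s,s)\to0$. -/

import Mathlib

open MeasureTheory Filter Topology Set
open scoped ComplexOrder CompactlySupported ENNReal

noncomputable section

namespace SidebandEdge

/-! ### Special functions -/

/-- The Bessel function `J_n(x)` of the first kind of integer order, by Bessel's integral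
`J_n(x) = (2π)⁻¹ ∫_{-π}^{π} cos (n θ - x sin θ) dθ`; equivalently, the `n`-th Fourier
coefficient of `θ ↦ exp (i x sin θ)`. -/
def besselJ (n : ℤ) (x : ℝ) : ℝ :=
  (2 * Real.pi)⁻¹ * ∫ θ in (-Real.pi)..Real.pi, Real.cos (n * θ - x * Real.sin θ)

/-- The Airy function, `Ai(x) = (2π)⁻¹ ∫ exp (i (z³/3 + x z)) dz`, the integral being taken
along the horizontal line `Im z = 1`, where it converges absolutely. -/
def airyAi (x : ℝ) : ℝ :=
  (2 * Real.pi)⁻¹ *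
    (∫ t : ℝ, Complex.exp (Complex.I *
      (((t : ℂ) + Complex.I) ^ 3 / 3 + (x : ℂ) * ((t : ℂ) + Complex.I)))).re

/-- The Airy kernel `K_Ai(s,t) = ∫₀^∞ Ai(s+u) Ai(t+u) du`. -/
def airyKernel (s t : ℝ) : ℝ :=
  ∫ u in Ioi (0 : ℝ), airyAi (s + u) * airyAi (t + u)

/-! ### Free fermions and Floquet scattering at a fixed central energy -/

section Fermions

variable {𝒜 : Type*} [CStarAlgebra 𝒜] {ι : Type*}

/-- Canonical anticommutation relations for the incoming annihilation operators `a β m`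
(channel `β`, sideband `m`). -/
structure IsCAR [DecidableEq ι] (a : ι → ℤ → 𝒜) : Prop where
  anticomm : ∀ β m β' m', a β m * a β' m' + a β' m' * a β m = 0
  anticomm_star : ∀ β m β' m',
    a β m * star (a β' m') + star (a β' m') * a β m = if β = β' ∧ m = m' then 1 else 0

/-- A state on a unital C⋆-algebra: a normalized positive functional. -/
structure IsState (ω : 𝒜 →L[ℂ] ℂ) : Prop where
  map_one : ω 1 = 1
  nonneg : ∀ x, 0 ≤ ω (star x * x)

/-- The Fermi cutoff `m_F(E) = ⌊(μ - E) / ħΩ⌋` (`hΩ` stands for the drive quantum `ħΩ`). -/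
def fermiCutoff (hΩ μ E : ℝ) : ℤ := ⌊(μ - E) / hΩ⌋

/-- The Floquet scattering matrix `S^{αβ}_{nm} = U^{αβ} J_{n-m}(A)` of a static scatterer `U`
under the spatially uniform phase drive `exp (i A sin Ωt)`. -/
def floquetS (U : Matrix ι ι ℂ) (A : ℝ) (α β : ι) (n m : ℤ) : ℂ :=
  U α β * (besselJ (n - m) A : ℂ)

variable [Fintype ι]

/-- The outgoing annihilation operators `b_{αn} = ∑_{β,m} S^{αβ}_{nm} a_{βm}`. The coefficients
are square summable in `m`, so under the anticommutation relations the series converges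
unconditionally in norm. -/
def outgoing (a : ι → ℤ → 𝒜) (U : Matrix ι ι ℂ) (A : ℝ) (α : ι) (n : ℤ) : 𝒜 :=
  ∑ β, ∑' m : ℤ, floquetS U A α β n m • a β m

/-- The effective occupation `∑_β |U^{αβ}|² ⟨a†_{βm} a_{βm}⟩` of the sideband `m`, as seen in
the outgoing lead `α`. -/
def effectiveOccupation (ω : 𝒜 →L[ℂ] ℂ) (a : ι → ℤ → 𝒜) (U : Matrix ι ι ℂ) (α : ι) (m : ℤ) : ℂ :=
  ∑ β, ((‖U α β‖ ^ 2 : ℝ) : ℂ) * ω (star (a β m) * a β m)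

/-- The number operator `N_ν = b†_n b_n` of the outgoing sideband `n = m_F + ν` in lead `α`. -/
def number (a : ι → ℤ → 𝒜) (U : Matrix ι ι ℂ) (α : ι) (mF : ℤ) (A : ℝ) (ν : ℤ) : 𝒜 :=
  star (outgoing a U A α (mF + ν)) * outgoing a U A α (mF + ν)

end Fermions

/-! ### Occupation statistics -/

section Occupation

variable {𝒜 : Type*} [CStarAlgebra 𝒜]

/-- The expectation `⟨N_{ν 0} N_{ν 1} ⋯ N_{ν (k-1)}⟩` in the state `ω`. -/
def expectProd (ω : 𝒜 →L[ℂ] ℂ) (N : ℤ → 𝒜) {k : ℕ} (ν : Fin k → ℤ) : ℂ :=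
  ω (List.ofFn fun i => N (ν i)).prod

open Classical in
/-- The `k`-point correlation function of the occupied sites with respect to counting measure
on `ℤ`: the expected product of occupations at `k` pairwise distinct sites, and `0` when
two of the sites coincide. -/
def siteCorrelation (ω : 𝒜 →L[ℂ] ℂ) (N : ℤ → 𝒜) {k : ℕ} (ν : Fin k → ℤ) : ℂ :=
  if Function.Injective ν then expectProd ω N ν else 0

/-- The connected two-point function `⟨N_ν N_l⟩ - ⟨N_ν⟩ ⟨N_l⟩`. -/
def connected (ω : 𝒜 →L[ℂ] ℂ) (N : ℤ → 𝒜) (ν l : ℤ) : ℂ :=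
  ω (N ν * N l) - ω (N ν) * ω (N l)

/-- `P` is the joint law, in the state `ω`, of the commuting occupations `N_ν`, which take the
values `0` and `1`; a joint outcome is recorded as the random set `S ⊆ ℤ` of occupied sites. -/
def IsOccupationLaw (ω : 𝒜 →L[ℂ] ℂ) (N : ℤ → 𝒜) (P : ProbabilityMeasure (Set ℤ)) : Prop :=
  ∀ (k : ℕ) (ν : Fin k → ℤ),
    expectProd ω N ν = (((P : Measure (Set ℤ)).real {S | ∀ i, ν i ∈ S} : ℝ) : ℂ)

end Occupation

/-! ### Edge scaling -/

/-- The edge scale `κ_A = (A/2)^{1/3}`. -/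
def kappa (A : ℝ) : ℝ := (A / 2) ^ (1 / 3 : ℝ)

/-- The rescaled site `ν_A(s) = ⌊A + s κ_A⌋`. -/
def edgeIndex (A s : ℝ) : ℤ := ⌊A + s * kappa A⌋

/-! ### Point processes on the line -/

/-- Locally finite subsets of `ℝ`, the realizations of a simple point process. -/
structure PointConfig where
  carrier : Set ℝ
  locallyFinite : ∀ K : Set ℝ, IsCompact K → (carrier ∩ K).Finite

namespace PointConfig

/-- The locally finite measure `∑_{x ∈ X} δ_x`. -/
def toMeasure (X : PointConfig) : Measure ℝ :=
  Measure.sum fun x : X.carrier => Measure.dirac (x : ℝ)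

/-- The vague topology: the coarsest one for which `X ↦ ∫ f d(∑_{x ∈ X} δ_x)` is continuous for
each continuous compactly supported `f`. -/
instance : TopologicalSpace PointConfig :=
  TopologicalSpace.induced (fun X (f : C_c(ℝ, ℝ)) => ∫ x, f x ∂X.toMeasure) inferInstance

instance : MeasurableSpace PointConfig := borel PointConfig

instance : BorelSpace PointConfig := ⟨rfl⟩

end PointConfig

/-- `Q` is the law of the determinantal point process on `ℝ` with kernel `K` (with respect to
Lebesgue measure): for every `k`, the density of its `k`-th factorial moment measure, i.e. its
`k`-point correlation function, is `det (K (x_i, x_j))`. -/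
def IsDeterminantal (K : ℝ → ℝ → ℝ) (Q : ProbabilityMeasure PointConfig) : Prop :=
  ∀ (k : ℕ) (g : (Fin k → ℝ) → ℝ≥0∞), Measurable g →
    ∫⁻ X : PointConfig, ∑' x : Fin k ↪ X.carrier, g (fun i => (x i : ℝ)) ∂(Q : Measure PointConfig)
      = ∫⁻ x : Fin k → ℝ,
          g x * ENNReal.ofReal (Matrix.of fun i j : Fin k => K (x i) (x j)).det

/-- The points `(ν - A)/κ_A`, `ν ∈ S`, are locally finite. -/
theorem edge_locallyFinite (A : ℝ) (S : Set ℤ) (K : Set ℝ) (hK : IsCompact K) :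
    (((fun ν : ℤ => ((ν : ℝ) - A) / kappa A) '' S) ∩ K).Finite := by
  by_cases hk : kappa A = 0
  · refine (Set.finite_singleton (0 : ℝ)).subset ?_
    rintro _ ⟨⟨ν, -, rfl⟩, -⟩
    simp [hk]
  · obtain ⟨R, hR⟩ := hK.isBounded.exists_norm_le
    have hfin : (Set.Icc ⌊A - R * |kappa A|⌋ ⌈A + R * |kappa A|⌉ : Set ℤ).Finite :=
      Set.finite_Icc _ _
    refine (hfin.image fun ν : ℤ => ((ν : ℝ) - A) / kappa A).subset ?_
    rintro _ ⟨⟨ν, -, rfl⟩, hνK⟩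
    refine ⟨ν, ?_, rfl⟩
    have h := hR _ hνK
    rw [Real.norm_eq_abs, abs_div, div_le_iff₀ (abs_pos.mpr hk), abs_le] at h
    refine ⟨?_, ?_⟩
    · have : ((⌊A - R * |kappa A|⌋ : ℤ) : ℝ) ≤ ν := (Int.floor_le _).trans (by linarith [h.1])
      exact_mod_cast this
    · have : (ν : ℝ) ≤ ((⌈A + R * |kappa A|⌉ : ℤ) : ℝ) :=
        le_trans (by linarith [h.2]) (Int.le_ceil _)
      exact_mod_cast this

/-- A realization of the rescaled occupation measure `Ξ_A = ∑_ν N_ν δ_{(ν - A)/κ_A}`, as the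
configuration of its atoms, when `S` is the set of sites with `N_ν = 1`. -/
def edgeConfig (A : ℝ) (S : Set ℤ) : PointConfig where
  carrier := (fun ν : ℤ => ((ν : ℝ) - A) / kappa A) '' S
  locallyFinite := edge_locallyFinite A S

open Classical in
/-- The measure of the configuration `edgeConfig A S` is indeed `∑_ν N_ν δ_{(ν - A)/κ_A}`. -/
theorem edgeConfig_toMeasure (A : ℝ) (hA : 0 < A) (S : Set ℤ) :
    (edgeConfig A S).toMeasure =
      Measure.sum fun ν : ℤ =>
        (if ν ∈ S then (1 : ℝ≥0∞) else 0) • Measure.dirac (((ν : ℝ) - A) / kappa A) := by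
  have hk : 0 < kappa A := Real.rpow_pos_of_pos (by linarith) _
  have hinj : Function.Injective (fun ν : ℤ => ((ν : ℝ) - A) / kappa A) := by
    intro x y hxy
    have h := (div_left_inj' hk.ne').mp hxy
    exact_mod_cast sub_left_injective h
  ext B hB
  rw [PointConfig.toMeasure, Measure.sum_apply _ hB, Measure.sum_apply _ hB]
  have h1 := tsum_image (fun x : ℝ => Measure.dirac x B) (s := S) hinj.injOn
  refine h1.trans ?_
  rw [tsum_subtype S (fun ν : ℤ => Measure.dirac (((ν : ℝ) - A) / kappa A) B)]
  refine tsum_congr fun ν => ?_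
  by_cases hν : ν ∈ S <;> simp [hν]

end SidebandEdge

end

/-! A uniform drive reduces the lead to a single fermion chain: the outgoing operators are Bessel
superpositions of the static mixtures c_m = ∑_β U^{αβ} a_{βm}, which again satisfy the CAR
(`IsCAR.leadMode`, `outgoing_eq_smear`). The sharp step is an extremal condition: an average of
occupations in [0,1] equals 1 or 0 only if every contributing channel is full or empty, and the
Cauchy–Schwarz argument `IsState.mul_null` then gives ω(c_m x) = 0 or ω(x c_m) = 0 for all x. No
quasi-freeness is assumed: these relations and the CAR already force Wick's theorem (`wick_det`), so
the correlations are determinants of the kernel ∑_{j≥0} J_{ν+j}(A) J_{l+j}(A)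
(`siteCorrelation_eq_det`).

At the edge, Bessel's integral is moved to height 1/κ_A, where its rescaled integrand has a Gaussian
majorant (`norm_edgeWave_le`) and converges to the Airy integrand, because A = 2κ_A³ turns the cubic
Taylor term of the sine into z³/3. The kernel is then a Riemann sum of mesh 1/κ_A for the Airy
kernel (`tendsto_kappa_mul_edgeKernel`). These limits are taken along a general filter with moving
positions, so that local uniformity needs no further estimate.

The joint law comes from Gelfand duality and the Riesz theorem (`exists_isOccupationLaw`). Countably
many Laplace coordinates induce the vague topology, which reduces weak convergence to Laplace
functionals (`tendsto_of_laplace`); the Bonferroni inequalities reduce these to factorial moments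
(`tendsto_of_moment`). The moments converge by domination, and the limiting ones grow at most
geometrically because the Airy kernel is positive semidefinite (`moment_airy_le`). The dilution
statement also needs K_Ai(s,s) > 0, which holds because Ai has no half-line of zeros. -/

noncomputable section

namespace SidebandEdge

/-! ### Smeared fermion operators -/

section CAR

variable {𝒜 : Type*} [CStarAlgebra 𝒜]

/-- A solution of the canonical anticommutation relations with one mode per integer. -/
structure IsModeCAR (c : ℤ → 𝒜) : Prop where
  anticomm : ∀ m n, c m * c n + c n * c m = 0
  anticomm_star : ∀ m n, c m * star (c n) + star (c n) * c m = if m = n then 1 else 0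

/-- The operator `∑_m f_m c_m`. -/
def smear (c : ℤ → 𝒜) (f : ℤ → ℝ) : 𝒜 := ∑' m, (f m : ℂ) • c m

/-- The CAR make c†c a projection, so r = ‖c‖² satisfies r = r². -/
theorem IsModeCAR.norm_le_one {c : ℤ → 𝒜} (hc : IsModeCAR c) (m : ℤ) : ‖c m‖ ≤ 1 := by
  have h0 : c m * c m = 0 := by
    have h := hc.anticomm m m
    rw [← two_smul ℂ] at h
    exact (smul_eq_zero.mp h).resolve_left two_ne_zero
  have h1 : c m * star (c m) = 1 - star (c m) * c m := by
    rw [eq_sub_iff_add_eq]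
    simpa using hc.anticomm_star m m
  have hidem : (star (c m) * c m) * (star (c m) * c m) = star (c m) * c m := by
    rw [mul_assoc, ← mul_assoc (c m) (star (c m)), h1, sub_mul, one_mul, mul_assoc (star (c m)), h0]
    simp
  have hsa : star (star (c m) * c m) = star (c m) * c m := by simp
  have h2 : ‖star (c m) * c m‖ = ‖star (c m) * c m‖ * ‖star (c m) * c m‖ := by
    rw [← CStarRing.norm_star_mul_self (x := star (c m) * c m), hsa, hidem]
  rw [CStarRing.norm_star_mul_self] at h2
  by_contra h
  have h3 : 1 < ‖c m‖ := not_le.mp h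
  have h4 : 1 < ‖c m‖ * ‖c m‖ := by nlinarith
  nlinarith

variable {c : ℤ → 𝒜}

theorem IsModeCAR.summable_smear (hc : IsModeCAR c) {f : ℤ → ℝ} (hf : Summable f) :
    Summable fun m => (f m : ℂ) • c m := by
  refine Summable.of_norm_bounded hf.norm fun m => ?_
  rw [norm_smul, Complex.norm_real]
  exact mul_le_of_le_one_right (norm_nonneg _) (hc.norm_le_one m)

theorem IsModeCAR.hasSum_smear (hc : IsModeCAR c) {f : ℤ → ℝ} (hf : Summable f) :
    HasSum (fun m => (f m : ℂ) • c m) (smear c f) := (hc.summable_smear hf).hasSum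

theorem IsModeCAR.hasSum_star_smear (hc : IsModeCAR c) {f : ℤ → ℝ} (hf : Summable f) :
    HasSum (fun m => (f m : ℂ) • star (c m)) (star (smear c f)) := by
  convert! (hc.hasSum_smear hf).star using 2 with m
  simp

theorem IsModeCAR.smear_add (hc : IsModeCAR c) {f g : ℤ → ℝ} (hf : Summable f) (hg : Summable g) :
    smear c (f + g) = smear c f + smear c g := by
  refine ((hc.hasSum_smear hf).add (hc.hasSum_smear hg)).unique ?_ |>.symm
  convert! hc.hasSum_smear (hf.add hg) using 2 with m
  rw [Complex.ofReal_add, add_smul]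

/-- A sum with a fixed anticommutator against every term. -/
theorem hasSum_anticommutator {x : ℤ → 𝒜} {X : 𝒜} {f : ℤ → ℝ}
    (hX : HasSum (fun m => (f m : ℂ) • x m) X) (y : 𝒜) :
    HasSum (fun m => (f m : ℂ) • (x m * y + y * x m)) (X * y + y * X) := by
  convert! (hX.mul_right y).add (hX.mul_left y) using 2 with m
  rw [smul_add, smul_mul_assoc, mul_smul_comm]

theorem IsModeCAR.smear_anticomm (hc : IsModeCAR c) {f g : ℤ → ℝ} (hf : Summable f)
    (hg : Summable g) : smear c f * smear c g + smear c g * smear c f = 0 := by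
  refine (hasSum_anticommutator (hc.hasSum_smear hf) _).unique ?_
  convert! hasSum_zero (α := 𝒜) (β := ℤ) using 2 with m
  have : c m * smear c g + smear c g * c m = 0 := by
    rw [add_comm]
    refine (hasSum_anticommutator (hc.hasSum_smear hg) (c m)).unique ?_
    convert! hasSum_zero (α := 𝒜) (β := ℤ) using 2 with n
    rw [hc.anticomm, smul_zero]
  rw [this, smul_zero]

/-- Expanding one smeared operator at a time leaves only the diagonal scalars f_m g_m. -/
theorem IsModeCAR.smear_anticomm_star (hc : IsModeCAR c) {f g : ℤ → ℝ} (hf : Summable f)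
    (hg : Summable g) {r : ℝ} (hr : HasSum (fun m => f m * g m) r) :
    smear c f * star (smear c g) + star (smear c g) * smear c f = algebraMap ℂ 𝒜 r := by
  refine (hasSum_anticommutator (hc.hasSum_smear hf) _).unique ?_
  have key : ∀ m, c m * star (smear c g) + star (smear c g) * c m = (g m : ℂ) • (1 : 𝒜) := by
    intro m
    rw [add_comm]
    refine (hasSum_anticommutator (hc.hasSum_star_smear hg) (c m)).unique ?_
    convert! hasSum_ite_eq m ((g m : ℂ) • (1 : 𝒜)) using 2 with n
    rw [add_comm, hc.anticomm_star]
    by_cases h : n = m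
    · subst h; simp
    · simp [h, Ne.symm h]
  simp_rw [key, smul_smul]
  have h1 : HasSum (fun m => ((f m * g m : ℝ) : ℂ)) (r : ℂ) := by exact_mod_cast hr
  have := h1.smul_const (1 : 𝒜)
  rw [Algebra.algebraMap_eq_smul_one]
  simpa using this

end CAR

/-! ### Null vectors of a state -/

section Null

variable {𝒜 : Type*} [CStarAlgebra 𝒜] {ω : 𝒜 →L[ℂ] ℂ}

/-- A real affine function bounded below on ℝ has slope zero; the order on ℂ also forces the
imaginary part to vanish for every t. -/
theorem eq_zero_of_forall_real_mul_nonneg {r v : ℂ} (h : ∀ t : ℝ, 0 ≤ r + t * v) : v = 0 := by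
  have hre : ∀ t : ℝ, 0 ≤ r.re + t * v.re := fun t => by
    have := (Complex.le_def.mp (h t)).1; simpa using this
  have him : ∀ t : ℝ, 0 = r.im + t * v.im := fun t => by
    have := (Complex.le_def.mp (h t)).2; simpa using this
  apply Complex.ext
  · by_contra hv
    have hv' : v.re ≠ 0 := hv
    have := hre (-(r.re + 1) / v.re)
    rw [div_mul_cancel₀ _ hv'] at this
    linarith
  · have h0 := him 0
    have h1 := him 1
    simp only [zero_mul, add_zero, one_mul] at h0 h1
    simp only [Complex.zero_im]
    linarith

/-- Cauchy–Schwarz in degenerate form: positivity at x† + t z y has no quadratic term in t, so the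
linear term vanishes; z = 1 and z = i separate its two halves. -/
theorem IsState.mul_null (hω : IsState ω) {y : 𝒜} (hy : ω (star y * y) = 0) (x : 𝒜) :
    ω (x * y) = 0 ∧ ω (star y * x) = 0 := by
  have main : ∀ x : 𝒜, ω (x * y) = 0 ∧ ω (star y * star x) = 0 := by
    intro x
    have key : ∀ z : ℂ, z * ω (x * y) + star z * ω (star y * star x) = 0 := by
      intro z
      refine eq_zero_of_forall_real_mul_nonneg (r := ω (x * star x)) fun t => ?_
      have := hω.nonneg (star x + ((t : ℂ) * z) • y)
      have h2 : star (star x + ((t : ℂ) * z) • y) * (star x + ((t : ℂ) * z) • y) =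
          x * star x + ((t : ℂ) * z) • (x * y) + ((t : ℂ) * star z) • (star y * star x)
            + (((t : ℂ) * star z) * ((t : ℂ) * z)) • (star y * y) := by
        simp only [star_add, star_smul, star_star, add_mul, mul_add, smul_mul_assoc,
          mul_smul_comm, star_mul', RCLike.star_def, Complex.conj_ofReal]
        module
      rw [h2] at this
      simp only [map_add, map_smul, hy, smul_eq_mul, mul_zero, add_zero] at this
      convert this using 1
      ring
    have h1 := key 1
    have hI := key Complex.I
    simp only [one_mul, star_one, RCLike.star_def, Complex.conj_I] at h1 hI
    have h3 : 2 * Complex.I * ω (x * y) = 0 := by linear_combination hI + Complex.I * h1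
    have h4 : 2 * Complex.I * ω (star y * star x) = 0 := by
      linear_combination Complex.I * h1 - hI
    exact ⟨by simpa using h3, by simpa using h4⟩
  exact ⟨(main x).1, by simpa using (main (star x)).2⟩

end Null

/-! ### Reordering anticommuting products -/

section Wick

variable {𝒜 : Type*} [Ring 𝒜]

/-- The product `B_{k-1} ⋯ B_1 B_0`. -/
def revProd : {k : ℕ} → (Fin k → 𝒜) → 𝒜
  | 0, _ => 1
  | _ + 1, B => revProd (fun i => B i.succ) * B 0

theorem revProd_anticomm {k : ℕ} (B : Fin k → 𝒜) (h : 𝒜) (hB : ∀ i, h * B i = -(B i * h)) :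
    h * revProd B = (-1) ^ k * (revProd B * h) := by
  induction k with
  | zero => simp [revProd]
  | succ k ih =>
    have := ih (fun i => B i.succ) fun i => hB i.succ
    simp only [revProd]
    rw [← mul_assoc, this, mul_assoc, mul_assoc (revProd _) h, hB 0, pow_succ]
    simp [mul_assoc]

variable [StarRing 𝒜]

/-- The combinatorial core of Wick's theorem. The star reverses the product to B_0† ⋯ B_k†, so h
passes i factors, each with a sign, before it contracts with the i-th into the central element K i.
-/
theorem star_revProd_anticomm {k : ℕ} (B : Fin (k + 1) → 𝒜) (h : 𝒜) (K : Fin (k + 1) → 𝒜)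
    (hK : ∀ i x, K i * x = x * K i) (hB : ∀ i, h * star (B i) = K i - star (B i) * h) :
    h * star (revProd B) =
      ∑ i : Fin (k + 1), (-1) ^ (i : ℕ) * (K i * star (revProd fun j => B (i.succAbove j)))
        + (-1) ^ (k + 1) * (star (revProd B) * h) := by
  induction k with
  | zero => simp [revProd, hB, sub_eq_add_neg]
  | succ k ih =>
    have := ih (fun i => B i.succ) (fun i => K i.succ) (fun i => hK i.succ) fun i => hB i.succ
    rw [revProd, star_mul, ← mul_assoc, hB 0, sub_mul, mul_assoc, this,
      Fin.sum_univ_succ (n := k + 1)]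
    have e0 : ∀ j : Fin (k + 1), (0 : Fin (k + 2)).succAbove j = j.succ := fun j => by simp
    simp only [Fin.val_zero, pow_zero, one_mul, e0, Fin.val_succ]
    rw [mul_add, Finset.mul_sum, sub_eq_add_neg, neg_add, ← Finset.sum_neg_distrib, ← add_assoc]
    congr 2
    · refine Finset.sum_congr rfl fun i _ => ?_
      have : star (revProd fun j => B (i.succ.succAbove j)) =
          star (B 0) * star (revProd fun j => B (i.succAbove j).succ) := by
        rw [revProd, star_mul]; simp
      rw [this, pow_succ]
      have hcomm : star (B 0) * (-1 : 𝒜) ^ (i : ℕ) = (-1) ^ (i : ℕ) * star (B 0) :=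
        ((Commute.neg_one_right _).pow_right _).eq
      rw [← mul_assoc (star (B 0)), hcomm, mul_assoc, ← mul_assoc (star (B 0)), ← hK]
      simp [mul_assoc]
    · have hcomm : star (B 0) * (-1 : 𝒜) ^ (k + 1) = (-1) ^ (k + 1) * star (B 0) :=
        ((Commute.neg_one_right _).pow_right _).eq
      rw [← mul_assoc (star (B 0)), hcomm, pow_succ _ (k + 1)]
      simp [mul_assoc]

/-- Normal ordering costs no sign: B_0 crosses k creators and then k annihilators, and the two
factors (-1)^k cancel. No contraction appears because the modes are distinct. -/
theorem ofFn_prod_eq_normal {k : ℕ} (B : Fin k → 𝒜)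
    (hB : ∀ i j, B i * B j + B j * B i = 0)
    (hBs : ∀ i j, i ≠ j → B i * star (B j) + star (B j) * B i = 0) :
    (List.ofFn fun i => star (B i) * B i).prod = star (revProd B) * revProd B := by
  induction k with
  | zero => simp [revProd]
  | succ k ih =>
    have h1 := ih (fun i => B i.succ) (fun i j => hB _ _)
      fun i j hij => hBs _ _ fun h => hij (Fin.succ_injective _ h)
    rw [List.ofFn_succ, List.prod_cons, h1]
    have ha : B 0 * revProd (fun i => B i.succ) =
        (-1) ^ k * (revProd (fun i => B i.succ) * B 0) :=
      revProd_anticomm _ _ fun i => eq_neg_of_add_eq_zero_left (hB _ _)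
    have hs : B 0 * star (revProd fun i => B i.succ) =
        (-1) ^ k * (star (revProd fun i => B i.succ) * B 0) := by
      cases k with
      | zero => simp [revProd]
      | succ k =>
        rw [star_revProd_anticomm _ _ (fun _ => 0) (by simp)]
        · simp
        · intro i
          rw [zero_sub]
          exact eq_neg_of_add_eq_zero_left (hBs _ _ (Fin.succ_ne_zero i).symm)
    rw [revProd, star_mul, mul_assoc, mul_assoc, ← mul_assoc (B 0), hs, mul_assoc, mul_assoc, ha]
    rcases Nat.even_or_odd k with he | he <;> simp [he.neg_one_pow]

end Wick

/-! ### Correlations as determinants -/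

section Determinant

variable {𝒜 : Type*} [CStarAlgebra 𝒜] {ω : 𝒜 →L[ℂ] ℂ} {c : ℤ → 𝒜}

/-- A Wick determinant: the filled modes are those in `F`. -/
theorem wick_det (hc : IsModeCAR c) (hω1 : ω 1 = 1) (F : Set ℤ)
    (hocc : ∀ m ∈ F, ∀ x, ω (c m * x) = 0) (hemp : ∀ m ∉ F, ∀ x, ω (x * c m) = 0)
    {k : ℕ} (f g : Fin k → ℤ → ℝ) (hf : ∀ i, Summable (f i)) (hg : ∀ i, Summable (g i))
    (K : Fin k → Fin k → ℝ)
    (hK : ∀ i j, HasSum (F.indicator fun m => f j m * g i m) (K i j)) :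
    ω (star (revProd fun i => smear c (g i)) * revProd fun i => smear c (f i)) =
      (Matrix.of fun i j => (K i j : ℂ)).det := by
  induction k with
  | zero => simp [revProd, hω1]
  | succ k ih =>
    have hf1 : Summable (F.indicator (f 0)) := (hf 0).indicator F
    have hf2 : Summable (Fᶜ.indicator (f 0)) := (hf 0).indicator Fᶜ
    -- In the rightmost factor the empty modes are annihilated by the state, so only the filled part
    -- h contributes.
    set h := smear c (F.indicator (f 0)) with hh
    have hsplit : smear c (f 0) = h + smear c (Fᶜ.indicator (f 0)) := by
      rw [hh, ← hc.smear_add hf1 hf2, Set.indicator_self_add_compl]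
    have hzero_right : ∀ x, ω (x * smear c (Fᶜ.indicator (f 0))) = 0 := fun x => by
      refine (((hc.hasSum_smear hf2).mul_left x).mapL ω).unique ?_
      convert! hasSum_zero (α := ℂ) (β := ℤ) using 2 with m
      by_cases hm : m ∈ F
      · simp [hm]
      · rw [mul_smul_comm, map_smul, hemp m hm, smul_zero]
    have hzero_left : ∀ x, ω (h * x) = 0 := fun x => by
      refine (((hc.hasSum_smear hf1).mul_right x).mapL ω).unique ?_
      convert! hasSum_zero (α := ℂ) (β := ℤ) using 2 with m
      by_cases hm : m ∈ F
      · rw [smul_mul_assoc, map_smul, hocc m hm, smul_zero]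
      · simp [hm]
    set B := revProd (fun i : Fin k => smear c (f i.succ)) with hB
    set G := star (revProd fun i => smear c (g i)) with hG
    have hcomm1 : h * B = (-1) ^ k * (B * h) :=
      revProd_anticomm _ _ fun i => eq_neg_of_add_eq_zero_left (hc.smear_anticomm hf1 (hf _))
    have hcomm2 := star_revProd_anticomm (fun i => smear c (g i)) h
      (fun i => algebraMap ℂ 𝒜 (K i 0)) (fun i x => Algebra.commutes _ _) fun i => by
        rw [eq_sub_iff_add_eq]
        refine hc.smear_anticomm_star hf1 (hg i) ?_
        convert! hK i 0 using 2 with m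
        by_cases hm : m ∈ F <;> simp [hm]
    have h1 : ω (G * revProd fun i => smear c (f i)) = ω (G * (B * h)) := by
      rw [revProd, hsplit, ← hB, mul_add, mul_add, map_add,
        ← mul_assoc G B (smear c (Fᶜ.indicator _)), hzero_right,
        add_zero]
    -- Filled modes vanish on the left, so ω(h G B) = 0. Carrying h to the far right through G and B
    -- yields all contractions with G and a total sign (-1)^(2k+1) on the wanted term: the Laplace
    -- expansion along column 0.
    have h2 : 0 = ∑ i : Fin (k + 1), (-1) ^ (i : ℕ) * ((K i 0 : ℂ) *
        ω (star (revProd fun j => smear c (g (i.succAbove j))) * B)) - ω (G * (B * h)) := by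
      have hz := hzero_left (G * B)
      rw [← mul_assoc, hcomm2, add_mul, map_add, Finset.sum_mul, map_sum] at hz
      rw [← hz, sub_eq_add_neg]
      congr 1
      · refine Finset.sum_congr rfl fun i _ => ?_
        have : ∀ x : 𝒜, (-1 : 𝒜) ^ (i : ℕ) * (algebraMap ℂ 𝒜 (K i 0) * x) * B =
            ((-1 : ℂ) ^ (i : ℕ) * (K i 0 : ℂ)) • (x * B) := fun x => by
          rw [Algebra.algebraMap_eq_smul_one, smul_mul_assoc, one_mul, mul_smul_comm,
            smul_mul_assoc, mul_assoc]
          rcases Nat.even_or_odd (i : ℕ) with he | he <;> simp [he.neg_one_pow]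
        rw [this, map_smul, smul_eq_mul, mul_assoc]
      · rw [← hG, mul_assoc, mul_assoc, hcomm1]
        rcases Nat.even_or_odd k with he | he
        · simp [he.neg_one_pow, he.add_one.neg_one_pow]
        · simp [he.neg_one_pow, he.add_one.neg_one_pow]
    rw [h1, ← sub_eq_zero.mp h2.symm, Matrix.det_succ_column_zero]
    refine Finset.sum_congr rfl fun i _ => ?_
    rw [hB, ih (fun j => f j.succ) (fun j => g (i.succAbove j)) (fun _ => hf _) (fun _ => hg _)
      (fun a b => K (i.succAbove a) b.succ) fun a b => hK _ _]
    simp [mul_assoc, Matrix.submatrix, Matrix.of_apply]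

end Determinant

/-! ### Bessel functions as Fourier coefficients -/

section Bessel

/-- The entire `2π`-periodic function `exp (i (n z - x sin z))`. -/
def besselWave (n : ℤ) (x : ℝ) (z : ℂ) : ℂ := Complex.exp (Complex.I * (n * z - x * Complex.sin z))

theorem differentiable_besselWave (n : ℤ) (x : ℝ) : Differentiable ℂ (besselWave n x) := by
  unfold besselWave; fun_prop

@[fun_prop]
theorem continuous_besselWave (n : ℤ) (x : ℝ) : Continuous (besselWave n x) :=
  (differentiable_besselWave n x).continuous

theorem besselWave_add_two_pi (n : ℤ) (x : ℝ) (z : ℂ) :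
    besselWave n x (z + 2 * Real.pi) = besselWave n x z := by
  unfold besselWave
  rw [Complex.sin_add_two_pi]
  have : Complex.I * (n * (z + 2 * Real.pi) - x * Complex.sin z) =
      Complex.I * (n * z - x * Complex.sin z) + n * (2 * Real.pi * Complex.I) := by ring
  rw [this, Complex.exp_add, Complex.exp_int_mul_two_pi_mul_I, mul_one]

theorem besselWave_ofReal (n : ℤ) (x θ : ℝ) : besselWave n x θ =
    Complex.exp (((n * θ - x * Real.sin θ : ℝ) : ℂ) * Complex.I) := by
  unfold besselWave
  push_cast
  rw [mul_comm]

/-- The sine part of the exponential is odd and integrates to zero. -/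
theorem integral_besselWave (n : ℤ) (x : ℝ) :
    (2 * Real.pi : ℂ)⁻¹ * ∫ θ in (-Real.pi)..Real.pi, besselWave n x θ = besselJ n x := by
  have hint : IntervalIntegrable (fun θ : ℝ => besselWave n x θ) volume (-Real.pi) Real.pi :=
    (by fun_prop : Continuous fun θ : ℝ => besselWave n x θ).intervalIntegrable _ _
  have hre := Complex.reCLM.intervalIntegral_comp_comm hint
  have him := Complex.imCLM.intervalIntegral_comp_comm hint
  simp only [Complex.reCLM_apply, Complex.imCLM_apply, besselWave_ofReal,
    Complex.exp_ofReal_mul_I_re, Complex.exp_ofReal_mul_I_im] at hre him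
  have hodd : ∫ θ in (-Real.pi)..Real.pi, Real.sin (n * θ - x * Real.sin θ) = 0 := by
    have h := intervalIntegral.integral_comp_neg (a := -Real.pi) (b := Real.pi)
      fun θ => Real.sin (n * θ - x * Real.sin θ)
    have h2 : ∀ θ : ℝ, Real.sin (n * (-θ) - x * Real.sin (-θ)) =
        -Real.sin (n * θ - x * Real.sin θ) := fun θ => by
      rw [← Real.sin_neg, Real.sin_neg θ]; ring_nf
    simp only [h2, intervalIntegral.integral_neg, neg_neg] at h
    linarith
  have : ∫ θ in (-Real.pi)..Real.pi, besselWave n x θ =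
      ((∫ θ in (-Real.pi)..Real.pi, Real.cos (n * θ - x * Real.sin θ) : ℝ) : ℂ) := by
    apply Complex.ext
    · rw [Complex.ofReal_re, hre]; simp only [besselWave_ofReal]
    · rw [Complex.ofReal_im, ← hodd, him]; simp only [besselWave_ofReal]
  rw [this, besselJ]
  push_cast
  rfl

/-- Cauchy's theorem on a rectangle one period wide: the vertical sides cancel by periodicity. -/
theorem integral_besselWave_shift (n : ℤ) (x y : ℝ) :
    ∫ θ in (-Real.pi)..Real.pi, besselWave n x (θ + y * Complex.I) =
      ∫ θ in (-Real.pi)..Real.pi, besselWave n x θ := by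
  have h := Complex.integral_boundary_rect_eq_zero_of_differentiableOn (besselWave n x)
    (-Real.pi : ℝ) (Real.pi + y * Complex.I) (differentiable_besselWave n x).differentiableOn
  have hside : ∀ t : ℝ, besselWave n x ((Real.pi : ℂ) + t * Complex.I) =
      besselWave n x (((-Real.pi : ℝ) : ℂ) + t * Complex.I) := fun t => by
    rw [← besselWave_add_two_pi n x (((-Real.pi : ℝ) : ℂ) + t * Complex.I)]
    congr 1; push_cast; ring
  simp only [Complex.ofReal_re, Complex.ofReal_im, Complex.add_re, Complex.mul_re, Complex.I_re,
    mul_zero, Complex.I_im, mul_one, sub_self, add_zero, Complex.add_im, Complex.mul_im, zero_add,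
    Complex.ofReal_zero, zero_mul, hside] at h
  rw [add_sub_cancel_right] at h
  exact (sub_eq_zero.mp h).symm

theorem besselJ_eq_integral_shift (n : ℤ) (x y : ℝ) :
    (besselJ n x : ℂ) = (2 * Real.pi : ℂ)⁻¹ *
      ∫ θ in (-Real.pi)..Real.pi, besselWave n x (θ + y * Complex.I) := by
  rw [integral_besselWave_shift, integral_besselWave]

theorem norm_besselWave (n : ℤ) (x θ y : ℝ) : ‖besselWave n x (θ + y * Complex.I)‖ =
    Real.exp (-(n * y) + x * (Real.cos θ * Real.sinh y)) := by
  rw [besselWave, Complex.norm_exp, Complex.sin_add_mul_I]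
  congr 1
  simp only [← Complex.ofReal_sin, ← Complex.ofReal_cos, ← Complex.ofReal_sinh,
    ← Complex.ofReal_cosh]
  simp [-Complex.ofReal_sin, -Complex.ofReal_cos, -Complex.ofReal_sinh, -Complex.ofReal_cosh]
  ring

/-- The height y is left free: y = ±1 gives exponential decay in n in either direction, and y = 0
gives |J_n| ≤ 1. -/
theorem abs_besselJ_le (n : ℤ) (x y : ℝ) :
    |besselJ n x| ≤ Real.exp (-(n * y) + |x * Real.sinh y|) := by
  have hpi := Real.pi_pos
  rw [← Real.norm_eq_abs, ← Complex.norm_real, besselJ_eq_integral_shift n x y, norm_mul]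
  have h1 : ‖∫ θ in (-Real.pi)..Real.pi, besselWave n x (θ + y * Complex.I)‖ ≤
      Real.exp (-(n * y) + |x * Real.sinh y|) * |Real.pi - -Real.pi| := by
    refine intervalIntegral.norm_integral_le_of_norm_le_const fun θ _ => ?_
    rw [norm_besselWave]
    gcongr
    calc x * (Real.cos θ * Real.sinh y) = Real.cos θ * (x * Real.sinh y) := by ring
      _ ≤ |Real.cos θ * (x * Real.sinh y)| := le_abs_self _
      _ = |Real.cos θ| * |x * Real.sinh y| := abs_mul _ _
      _ ≤ 1 * |x * Real.sinh y| := by gcongr; exact Real.abs_cos_le_one θ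
      _ = _ := one_mul _
  have h2 : |Real.pi - -Real.pi| = 2 * Real.pi := by rw [abs_of_nonneg] <;> linarith
  have h3 : ‖(2 * Real.pi : ℂ)⁻¹‖ = (2 * Real.pi)⁻¹ := by
    rw [norm_inv]; simp [abs_of_pos hpi]
  rw [h2] at h1
  rw [h3]
  rw [inv_mul_le_iff₀ (by positivity), mul_comm (2 * Real.pi)]
  exact h1

theorem summable_besselJ (x : ℝ) : Summable fun n : ℤ => besselJ n x := by
  have hs : Summable fun n : ℕ => Real.exp |x * Real.sinh 1| * Real.exp (-(n : ℝ)) := by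
    refine Summable.mul_left _ ?_
    simpa using Real.summable_exp_nat_mul_iff.mpr (by norm_num : (-1 : ℝ) < 0)
  refine Summable.of_nat_of_neg (Summable.of_norm_bounded hs fun n => ?_)
    (Summable.of_norm_bounded hs fun n => ?_)
  · rw [← Real.exp_add, Real.norm_eq_abs]
    refine (abs_besselJ_le n x 1).trans (Real.exp_le_exp.mpr (le_of_eq ?_))
    push_cast; ring
  · rw [← Real.exp_add, Real.norm_eq_abs]
    refine (abs_besselJ_le (-n : ℤ) x (-1)).trans (Real.exp_le_exp.mpr (le_of_eq ?_))
    rw [Real.sinh_neg, mul_neg x, abs_neg]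
    push_cast; ring

theorem summable_besselJ_sub (n : ℤ) (x : ℝ) : Summable fun m : ℤ => besselJ (n - m) x :=
  (Equiv.subLeft n).summable_iff.mpr (summable_besselJ x)

instance factTwoPi : Fact (0 < 2 * Real.pi) := ⟨Real.two_pi_pos⟩

/-- The function `exp (i (n θ - x sin θ))` on the circle. -/
def circleWave (n : ℤ) (x : ℝ) : C(AddCircle (2 * Real.pi), ℂ) where
  toFun t := fourier n t * Complex.exp (-(x / 2) * (fourier 1 t - fourier (-1) t))

theorem circleWave_coe (n : ℤ) (x θ : ℝ) : circleWave n x θ = besselWave n x θ := by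
  have hpi : (Real.pi : ℂ) ≠ 0 := by exact_mod_cast Real.pi_ne_zero
  have hf : ∀ k : ℤ, fourier (T := 2 * Real.pi) k (θ : AddCircle (2 * Real.pi)) =
      Complex.exp (k * θ * Complex.I) := fun k => by
    rw [fourier_coe_apply]; congr 1; push_cast; field_simp
  simp only [circleWave, ContinuousMap.coe_mk, hf, besselWave, ← Complex.exp_add]
  congr 1
  rw [Complex.sin]
  push_cast
  have : Complex.I * (n * θ - x * ((Complex.exp (-θ * Complex.I) - Complex.exp (θ * Complex.I)) *
      Complex.I / 2)) = Complex.I * (n * θ) - (Complex.I * Complex.I) * (x *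
        (Complex.exp (-θ * Complex.I) - Complex.exp (θ * Complex.I)) / 2) := by ring
  rw [this, Complex.I_mul_I]
  ring_nf

theorem fourierCoeff_circleWave (n m : ℤ) (x : ℝ) :
    fourierCoeff (circleWave n x) m = besselJ (n - m) x := by
  have hpi : (Real.pi : ℂ) ≠ 0 := by exact_mod_cast Real.pi_ne_zero
  rw [fourierCoeff_eq_intervalIntegral _ _ (-Real.pi), ← integral_besselWave]
  have : -Real.pi + 2 * Real.pi = Real.pi := by ring
  rw [this, Complex.real_smul]
  congr 1
  · push_cast; rw [one_div]
  · refine intervalIntegral.integral_congr fun θ _ => ?_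
    simp only [smul_eq_mul]
    rw [circleWave_coe, fourier_coe_apply, besselWave, besselWave, ← Complex.exp_add]
    congr 1
    push_cast
    field_simp
    ring

/-- Parseval: J_{n-m}(x) is the m-th Fourier coefficient of e_n times a unimodular function
independent of n, so the orthonormality of the e_n carries over. This is what gives the outgoing
operators the CAR. -/
theorem hasSum_besselJ_mul (n n' : ℤ) (x : ℝ) :
    HasSum (fun m : ℤ => besselJ (n - m) x * besselJ (n' - m) x) (if n = n' then 1 else 0) := by
  have h := (fourierBasis (T := 2 * Real.pi)).hasSum_inner_mul_inner
    (ContinuousMap.toLp 2 AddCircle.haarAddCircle ℂ (circleWave n x))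
    (ContinuousMap.toLp 2 AddCircle.haarAddCircle ℂ (circleWave n' x))
  have hc : ∀ (k m : ℤ), inner ℂ (fourierBasis (T := 2 * Real.pi) m)
      (ContinuousMap.toLp 2 AddCircle.haarAddCircle ℂ (circleWave k x)) =
        (besselJ (k - m) x : ℂ) := fun k m => by
    rw [← HilbertBasis.repr_apply_apply, fourierBasis_repr, fourierCoeff_toLp,
      fourierCoeff_circleWave]
  have hinner : inner ℂ (ContinuousMap.toLp 2 AddCircle.haarAddCircle ℂ (circleWave n x))
      (ContinuousMap.toLp 2 AddCircle.haarAddCircle ℂ (circleWave n' x)) =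
        if n = n' then (1 : ℂ) else 0 := by
    rw [ContinuousMap.inner_toLp]
    rw [← (orthonormal_iff_ite.mp (orthonormal_fourier (T := 2 * Real.pi))) n n']
    rw [fourierLp, fourierLp, ContinuousMap.inner_toLp]
    congr 1
    ext t
    induction t using QuotientAddGroup.induction_on with
    | H θ =>
      have h1 : fourier (T := 2 * Real.pi) n (θ : AddCircle (2 * Real.pi)) *
          besselWave 0 x θ = besselWave n x θ := by
        rw [← circleWave_coe, ← circleWave_coe]; simp [circleWave]
      have h2 : fourier (T := 2 * Real.pi) n' (θ : AddCircle (2 * Real.pi)) *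
          besselWave 0 x θ = besselWave n' x θ := by
        rw [← circleWave_coe, ← circleWave_coe]; simp [circleWave]
      have h3 : besselWave 0 x θ * (starRingEnd ℂ) (besselWave 0 x θ) = 1 := by
        rw [Complex.mul_conj, besselWave_ofReal, Complex.normSq_eq_norm_sq,
          Complex.norm_exp_ofReal_mul_I]
        simp
      change circleWave n' x (θ : AddCircle (2 * Real.pi)) * (starRingEnd ℂ)
        (circleWave n x (θ : AddCircle (2 * Real.pi))) = fourier n' (θ : AddCircle (2 * Real.pi)) *
          (starRingEnd ℂ) (fourier n (θ : AddCircle (2 * Real.pi)))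
      rw [circleWave_coe, circleWave_coe, ← h1, ← h2, map_mul]
      linear_combination (fourier n' (θ : AddCircle (2 * Real.pi)) *
          (starRingEnd ℂ) (fourier n (θ : AddCircle (2 * Real.pi)))) * h3
  rw [hinner] at h
  have h' : HasSum (fun m : ℤ => ((besselJ (n - m) x * besselJ (n' - m) x : ℝ) : ℂ))
      (((if n = n' then 1 else 0 : ℝ)) : ℂ) := by
    convert! h using 2 with m
    · rw [hc, ← inner_conj_symm, hc, Complex.conj_ofReal]; push_cast; rfl
    · split_ifs <;> simp
  exact_mod_cast h'

end Bessel

/-! ### The edge scale -/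

section Kappa

theorem kappa_pos {A : ℝ} (hA : 0 < A) : 0 < kappa A := Real.rpow_pos_of_pos (by linarith) _

theorem kappa_pow_three {A : ℝ} (hA : 0 ≤ A) : kappa A ^ 3 = A / 2 := by
  rw [kappa, ← Real.rpow_natCast, ← Real.rpow_mul (by linarith)]
  norm_num

theorem one_le_kappa {A : ℝ} (hA : 2 ≤ A) : 1 ≤ kappa A :=
  Real.one_le_rpow (by linarith) (by norm_num)

theorem tendsto_kappa_atTop : Tendsto kappa atTop atTop :=
  (tendsto_rpow_atTop (by norm_num)).comp (tendsto_id.atTop_div_const (by norm_num))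

end Kappa

/-! ### Absolute convergence of the Airy integral -/

section AiryBound

/-- The integrand of the Airy integral on the line `Im z = 1`. -/
def airyWave (x t : ℝ) : ℂ :=
  Complex.exp (Complex.I * (((t : ℂ) + Complex.I) ^ 3 / 3 + (x : ℂ) * ((t : ℂ) + Complex.I)))

theorem norm_airyWave (x t : ℝ) : ‖airyWave x t‖ = Real.exp (1 / 3 - x - t ^ 2) := by
  rw [airyWave, Complex.norm_exp]
  congr 1
  have : Complex.I * (((t : ℂ) + Complex.I) ^ 3 / 3 + (x : ℂ) * ((t : ℂ) + Complex.I)) =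
      ((1 / 3 - x - t ^ 2 : ℝ) : ℂ) + ((t ^ 3 / 3 - t + x * t : ℝ) : ℂ) * Complex.I := by
    push_cast
    linear_combination (Complex.I ^ 2 / 3 + t * Complex.I + t ^ 2 + x - 1 / 3) * Complex.I_sq
  rw [this]
  simp [-Complex.ofReal_add, -Complex.ofReal_sub]

@[fun_prop]
theorem continuous_airyWave (x : ℝ) : Continuous (airyWave x) := by
  unfold airyWave; fun_prop

theorem airyAi_eq (x : ℝ) : airyAi x = (2 * Real.pi)⁻¹ * (∫ t : ℝ, airyWave x t).re := rfl

theorem integrable_exp_sub_sq (a : ℝ) : Integrable fun t : ℝ => Real.exp (a - t ^ 2) := by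
  have := (integrable_exp_neg_mul_sq (b := 1) one_pos).const_mul (Real.exp a)
  refine this.congr (Eventually.of_forall fun t => ?_)
  simp only [← Real.exp_add]; ring_nf

theorem integrable_airyWave (x : ℝ) : Integrable (airyWave x) := by
  rw [← integrable_norm_iff (by fun_prop)]
  simpa only [norm_airyWave] using integrable_exp_sub_sq _

end AiryBound

/-! ### From Bessel to Airy at the turning point -/

section EdgeAsymptotics

/-- The exponential rate in the Gaussian majorant of the rescaled Bessel integrand. -/
def edgeMajorant (t : ℝ) : ℝ := Real.exp (2 - 4 / Real.pi ^ 2 * t ^ 2)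

theorem integrable_edgeMajorant : Integrable edgeMajorant := by
  have := (integrable_exp_neg_mul_sq (b := 4 / Real.pi ^ 2) (by positivity)).const_mul (Real.exp 2)
  refine this.congr (Eventually.of_forall fun t => ?_)
  simp only [edgeMajorant, ← Real.exp_add]; ring_nf

/-- The rescaled Bessel integrand, extended by zero to the line. -/
def edgeWave (n : ℤ) (A t : ℝ) : ℂ :=
  (Ioc (-Real.pi * kappa A) (Real.pi * kappa A)).indicator
    (fun t : ℝ => besselWave n A (t / kappa A + (kappa A)⁻¹ * Complex.I)) t

theorem measurable_edgeWave (n : ℤ) (A : ℝ) : Measurable (edgeWave n A) :=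
  Measurable.indicator (by
    have : Continuous fun t : ℝ => besselWave n A (t / kappa A + (kappa A)⁻¹ * Complex.I) := by
      fun_prop
    exact this.measurable) measurableSet_Ioc

theorem kappa_mul_besselJ (n : ℤ) {A : ℝ} (hA : 0 < A) :
    ((kappa A * besselJ n A : ℝ) : ℂ) = (2 * Real.pi : ℂ)⁻¹ * ∫ t, edgeWave n A t := by
  have hk := kappa_pos hA
  have hle : -Real.pi * kappa A ≤ Real.pi * kappa A := by nlinarith [Real.pi_pos]
  have h1 : ∫ t, edgeWave n A t = kappa A *
      ∫ θ in (-Real.pi)..Real.pi, besselWave n A (θ + (kappa A)⁻¹ * Complex.I) := by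
    have h := intervalIntegral.integral_comp_div (a := -Real.pi * kappa A) (b := Real.pi * kappa A)
      (fun θ : ℝ => besselWave n A (θ + (kappa A)⁻¹ * Complex.I)) hk.ne'
    rw [mul_div_cancel_right₀ _ hk.ne', mul_div_cancel_right₀ _ hk.ne', Complex.real_smul] at h
    rw [← h, intervalIntegral.integral_of_le hle, ← integral_indicator measurableSet_Ioc]
    simp only [edgeWave, Complex.ofReal_div]
  rw [h1, Complex.ofReal_mul, besselJ_eq_integral_shift n A (kappa A)⁻¹]
  push_cast
  ring

/-- From the Taylor bound of the complex sine at iy; the coefficient 1 is generous. -/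
theorem sinh_le_add_cube {y : ℝ} (h0 : 0 ≤ y) (h1 : y ≤ 1) : Real.sinh y ≤ y + y ^ 3 := by
  have h := Complex.sin_bound (x := y * Complex.I) (by simpa [abs_of_nonneg h0] using h1)
  rw [Complex.sin_mul_I, ← Complex.ofReal_sinh] at h
  have e : (Real.sinh y : ℂ) * Complex.I - (y * Complex.I - (y * Complex.I) ^ 3 / 6) =
      ((Real.sinh y - y - y ^ 3 / 6 : ℝ) : ℂ) * Complex.I := by
    push_cast
    linear_combination (y ^ 3 * Complex.I / 6) * Complex.I_sq
  rw [e, norm_mul, Complex.norm_I, mul_one, Complex.norm_real, norm_mul, Complex.norm_I, mul_one,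
    Complex.norm_real, Real.norm_eq_abs, Real.norm_eq_abs, abs_of_nonneg h0] at h
  have h2 := (abs_le.mp h).2
  have h3 : y ^ 5 ≤ y ^ 3 := pow_le_pow_of_le_one h0 h1 (by norm_num)
  have h4 : 0 ≤ y ^ 3 := by positivity
  linarith

/-- Put y = 1/κ, so A = 2/y³. Then A sinh y ≤ A y + 2 gives the constant 2, the remaining -ny + Ay
is the exponential prefactor, and 1 - cos θ ≥ 2θ²/π² on [-π, π] gives the Gaussian rate 4/π². -/
theorem norm_edgeWave_le (n : ℤ) {A : ℝ} (hA : 2 ≤ A) (t : ℝ) :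
    ‖edgeWave n A t‖ ≤ Real.exp (-((n - A) / kappa A)) * edgeMajorant t := by
  have hk1 := one_le_kappa hA
  have hk : 0 < kappa A := by linarith
  have hpi := Real.pi_pos
  have hk3 := kappa_pow_three (A := A) (by linarith)
  rw [edgeWave]
  by_cases ht : t ∈ Ioc (-Real.pi * kappa A) (Real.pi * kappa A)
  swap
  · rw [Set.indicator_of_notMem ht, norm_zero]
    exact mul_nonneg (Real.exp_pos _).le (Real.exp_pos _).le
  rw [Set.indicator_of_mem ht, ← Complex.ofReal_div, norm_besselWave, edgeMajorant, ← Real.exp_add]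
  refine Real.exp_le_exp.mpr ?_
  set k := kappa A with hkdef
  have hA' : A = 2 * k ^ 3 := by linarith
  set y := k⁻¹ with hy
  have hy0 : 0 < y := inv_pos.mpr hk
  have hy1 : y ≤ 1 := inv_le_one_of_one_le₀ hk1
  have hky : k * y = 1 := mul_inv_cancel₀ hk.ne'
  have hcos : Real.cos (t / k) ≤ 1 - 2 / Real.pi ^ 2 * (t / k) ^ 2 := by
    apply Real.cos_le_one_sub_mul_cos_sq
    rw [abs_div, abs_of_pos hk, div_le_iff₀ hk, abs_le]
    exact ⟨by linarith [ht.1], ht.2⟩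
  have hs1 : Real.sinh y ≤ y + y ^ 3 := sinh_le_add_cube hy0.le hy1
  have hs0 : y ≤ Real.sinh y := Real.self_le_sinh_iff.mpr hy0.le
  have hA0 : 0 ≤ A := by linarith
  have e1 : A * Real.sinh y ≤ A * y + 2 := by
    calc A * Real.sinh y ≤ A * (y + y ^ 3) := by gcongr
      _ = A * y + 2 * (k * y) ^ 3 := by rw [hA']; ring
      _ = _ := by rw [hky]; ring
  have e2 : 4 / Real.pi ^ 2 * t ^ 2 ≤ A * Real.sinh y * (2 / Real.pi ^ 2 * (t / k) ^ 2) := by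
    calc 4 / Real.pi ^ 2 * t ^ 2 = 4 / Real.pi ^ 2 * t ^ 2 * (k * y) ^ 3 := by rw [hky]; ring
      _ = A * y * (2 / Real.pi ^ 2 * (t / k) ^ 2) := by
        rw [hA', div_eq_mul_inv t k, ← hy]; ring
      _ ≤ _ := by gcongr
  have e3 : A * (Real.cos (t / k) * Real.sinh y) ≤
      A * Real.sinh y * (1 - 2 / Real.pi ^ 2 * (t / k) ^ 2) := by
    calc A * (Real.cos (t / k) * Real.sinh y) = A * Real.sinh y * Real.cos (t / k) := by ring
      _ ≤ _ := by
        have : 0 ≤ A * Real.sinh y := mul_nonneg hA0 (hy0.le.trans hs0)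
        gcongr
  have e4 : ((n : ℝ) - A) / k = n * y - A * y := by rw [div_eq_mul_inv, sub_mul]
  rw [e4]
  rw [mul_sub, mul_one] at e3
  linarith

/-- The constant in the uniform exponential bound for rescaled Bessel functions. -/
def edgeConst : ℝ := (2 * Real.pi)⁻¹ * ∫ t, edgeMajorant t

theorem edgeConst_nonneg : 0 ≤ edgeConst :=
  mul_nonneg (by positivity) (integral_nonneg fun _ => (Real.exp_pos _).le)

theorem norm_two_pi_inv : ‖(2 * Real.pi : ℂ)⁻¹‖ = (2 * Real.pi)⁻¹ := by
  rw [norm_inv]; simp [abs_of_pos Real.pi_pos]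

theorem abs_kappa_mul_besselJ_le (n : ℤ) {A : ℝ} (hA : 2 ≤ A) :
    |kappa A * besselJ n A| ≤ edgeConst * Real.exp (-((n - A) / kappa A)) := by
  rw [← Real.norm_eq_abs, ← Complex.norm_real, kappa_mul_besselJ n (by linarith), norm_mul,
    norm_two_pi_inv, edgeConst, mul_assoc]
  gcongr
  rw [mul_comm, ← integral_const_mul]
  exact norm_integral_le_of_norm_le (integrable_edgeMajorant.const_mul _)
    (Eventually.of_forall fun t => norm_edgeWave_le n hA t)

/-- With z = t + i, the phase n z/κ - A sin(z/κ) equals ((n - A)/κ) z + A (z/κ - sin(z/κ)). Since A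
= 2κ³, the last term is z³/3 + O(κ⁻²). -/
theorem tendsto_edgeWave {X : Type*} {l : Filter X} {A : X → ℝ} (hA : Tendsto A l atTop)
    {n : X → ℤ} {σ : ℝ} (hn : Tendsto (fun x => ((n x : ℝ) - A x) / kappa (A x)) l (𝓝 σ)) (t : ℝ) :
    Tendsto (fun x => edgeWave (n x) (A x) t) l (𝓝 (airyWave σ t)) := by
  have hk : Tendsto (fun x => kappa (A x)) l atTop := tendsto_kappa_atTop.comp hA
  have hk' : Tendsto (fun x => (kappa (A x))⁻¹) l (𝓝 0) := tendsto_inv_atTop_zero.comp hk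
  set z : ℂ := t + Complex.I with hz
  -- the cubic Taylor remainder of the sine, at the scale `κ⁻¹`
  have hrem : Tendsto (fun x => (A x : ℂ) * (z * (kappa (A x))⁻¹ -
      Complex.sin (z * (kappa (A x))⁻¹)) - z ^ 3 / 3) l (𝓝 0) := by
    refine squeeze_zero_norm' (a := fun x => ‖z‖ ^ 5 / 50 * ((kappa (A x))⁻¹) ^ 2) ?_ (by
      simpa using (hk'.pow 2).const_mul (‖z‖ ^ 5 / 50))
    have hsmall : ∀ᶠ x in l, (kappa (A x))⁻¹ * ‖z‖ < 1 :=
      (by simpa using hk'.mul_const ‖z‖ :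
        Tendsto (fun x => (kappa (A x))⁻¹ * ‖z‖) l (𝓝 0)).eventually_lt_const one_pos
    filter_upwards [hsmall, hA.eventually_ge_atTop 2] with x hx hx2
    have hk1 := one_le_kappa hx2
    have hk0 : 0 < kappa (A x) := by linarith
    have hk3 := kappa_pow_three (A := A x) (by linarith)
    set k := kappa (A x)
    have hkC : (k : ℂ) ≠ 0 := by exact_mod_cast hk0.ne'
    have hAx : (A x : ℂ) = 2 * (k : ℂ) ^ 3 := by
      have : A x = 2 * k ^ 3 := by linarith
      rw [this]; push_cast; ring
    have hnorm : ‖z * ((k⁻¹ : ℝ) : ℂ)‖ = k⁻¹ * ‖z‖ := by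
      rw [norm_mul, Complex.norm_real, Real.norm_eq_abs, abs_of_pos (inv_pos.mpr hk0), mul_comm]
    have hb := Complex.sin_bound (x := z * ((k⁻¹ : ℝ) : ℂ)) (by rw [hnorm]; exact hx.le)
    have e : (A x : ℂ) * (z * ((k⁻¹ : ℝ) : ℂ) - Complex.sin (z * ((k⁻¹ : ℝ) : ℂ))) - z ^ 3 / 3 =
        -(A x : ℂ) * (Complex.sin (z * ((k⁻¹ : ℝ) : ℂ)) -
          (z * ((k⁻¹ : ℝ) : ℂ) - (z * ((k⁻¹ : ℝ) : ℂ)) ^ 3 / 6)) := by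
      rw [hAx]; push_cast; field_simp; ring
    have hAn : ‖-(A x : ℂ)‖ = 2 * k ^ 3 := by
      rw [hAx, norm_neg, norm_mul, norm_pow, Complex.norm_real, Real.norm_eq_abs,
        abs_of_pos hk0]
      simp
    rw [e, norm_mul, hAn]
    rw [hnorm] at hb
    calc 2 * k ^ 3 * _ ≤ 2 * k ^ 3 * ((k⁻¹ * ‖z‖) ^ 5 / 100) := by gcongr
      _ = _ := by field_simp; ring
  have hlim : Tendsto (fun x => Complex.exp (Complex.I * (((A x : ℂ) * (z * (kappa (A x))⁻¹ -
      Complex.sin (z * (kappa (A x))⁻¹)) - z ^ 3 / 3) + z ^ 3 / 3 +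
        ((((n x : ℝ) - A x) / kappa (A x) : ℝ) : ℂ) * z))) l
      (𝓝 (Complex.exp (Complex.I * (0 + z ^ 3 / 3 + (σ : ℂ) * z)))) := by
    refine (Complex.continuous_exp.tendsto _).comp (Tendsto.const_mul _ ?_)
    exact (hrem.add_const _).add (((Complex.continuous_ofReal.tendsto σ).comp hn).mul_const z)
  have heq : airyWave σ t = Complex.exp (Complex.I * (0 + z ^ 3 / 3 + (σ : ℂ) * z)) := by
    rw [airyWave, zero_add]
  rw [heq]
  refine hlim.congr' ?_
  -- A fixed t eventually lies in the integration window, where the indicator is inactive.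
  have hbig : ∀ᶠ x in l, |t| + 1 ≤ Real.pi * kappa (A x) :=
    (hk.const_mul_atTop Real.pi_pos).eventually_ge_atTop _
  filter_upwards [hbig, hA.eventually_ge_atTop 2] with x hx hx2
  have hk0 : 0 < kappa (A x) := by linarith [one_le_kappa hx2]
  have hkC : (kappa (A x) : ℂ) ≠ 0 := by exact_mod_cast hk0.ne'
  have hmem : t ∈ Ioc (-Real.pi * kappa (A x)) (Real.pi * kappa (A x)) :=
    ⟨by linarith [neg_abs_le t], by linarith [le_abs_self t]⟩
  rw [edgeWave, Set.indicator_of_mem hmem, besselWave]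
  have harg : (t : ℂ) / kappa (A x) + (((kappa (A x))⁻¹ : ℝ) : ℂ) * Complex.I =
      z * (((kappa (A x))⁻¹ : ℝ) : ℂ) := by
    rw [hz]; push_cast; field_simp
  rw [harg]
  congr 2
  push_cast
  field_simp
  ring

/-- Dominated convergence under the Gaussian majorant. The general filter lets n vary jointly with
A, which later yields local uniformity. -/
theorem tendsto_kappa_mul_besselJ {X : Type*} {l : Filter X} [l.IsCountablyGenerated]
    {A : X → ℝ} (hA : Tendsto A l atTop) {n : X → ℤ} {σ : ℝ}
    (hn : Tendsto (fun x => ((n x : ℝ) - A x) / kappa (A x)) l (𝓝 σ)) :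
    Tendsto (fun x => kappa (A x) * besselJ (n x) (A x)) l (𝓝 (airyAi σ)) := by
  have hint : Tendsto (fun x => ∫ t, edgeWave (n x) (A x) t) l (𝓝 (∫ t, airyWave σ t)) := by
    refine tendsto_integral_filter_of_dominated_convergence
      -- Eventually (n - A)/κ ≥ σ - 1, which bounds the exponential prefactor.
      (fun t => Real.exp (-(σ - 1)) * edgeMajorant t)
      (Eventually.of_forall fun x => (measurable_edgeWave _ _).aestronglyMeasurable) ?_
      (integrable_edgeMajorant.const_mul _)
      (Eventually.of_forall fun t => tendsto_edgeWave hA hn t)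
    filter_upwards [hA.eventually_ge_atTop 2, hn.eventually_const_le (sub_one_lt σ)] with x h2 hx
    refine Eventually.of_forall fun t => (norm_edgeWave_le _ h2 t).trans ?_
    have : 0 ≤ edgeMajorant t := (Real.exp_pos _).le
    gcongr
  have h := (Complex.continuous_re.tendsto _).comp (hint.const_mul (2 * Real.pi : ℂ)⁻¹)
  have e : ((2 * Real.pi : ℂ)⁻¹ * ∫ t, airyWave σ t).re = airyAi σ := by
    rw [airyAi_eq]
    have : (2 * Real.pi : ℂ)⁻¹ = ((2 * Real.pi)⁻¹ : ℝ) := by push_cast; rfl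
    rw [this, Complex.re_ofReal_mul]
  rw [e] at h
  refine h.congr' ?_
  filter_upwards [hA.eventually_gt_atTop 0] with x hx
  simp only [Function.comp_apply]
  rw [← kappa_mul_besselJ _ hx, Complex.ofReal_re]

end EdgeAsymptotics

/-! ### Analyticity and non-vanishing of Ai -/

section Airy

/-- The reflection t ↦ -t conjugates the integrand, so the integral is already real. -/
theorem ofReal_airyAi (x : ℝ) : (airyAi x : ℂ) = (2 * Real.pi : ℂ)⁻¹ * ∫ t : ℝ, airyWave x t := by
  have hconj : ∀ t : ℝ, airyWave x (-t) = (starRingEnd ℂ) (airyWave x t) := fun t => by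
    rw [airyWave, airyWave, ← Complex.exp_conj]
    congr 1
    simp only [map_mul, map_add, map_div₀, map_pow, Complex.conj_I, Complex.conj_ofReal, map_ofNat]
    push_cast
    ring
  have h1 : (starRingEnd ℂ) (∫ t : ℝ, airyWave x t) = ∫ t : ℝ, airyWave x t := by
    rw [← integral_conj]
    simp only [← hconj]
    exact integral_neg_eq_self (airyWave x) volume
  rw [airyAi_eq, ← Complex.conj_eq_iff_re.mp h1]
  push_cast
  simp

/-- The constant in the exponential bound for the Airy function. -/
def airyConst : ℝ := (2 * Real.pi)⁻¹ * ∫ t : ℝ, Real.exp (1 / 3 - t ^ 2)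

theorem abs_airyAi_le (x : ℝ) : |airyAi x| ≤ airyConst * Real.exp (-x) := by
  rw [← Real.norm_eq_abs, ← Complex.norm_real, ofReal_airyAi, norm_mul, norm_two_pi_inv, airyConst,
    mul_assoc]
  gcongr
  rw [mul_comm, ← integral_const_mul]
  refine norm_integral_le_of_norm_le ((integrable_exp_sub_sq _).const_mul _)
    (Eventually.of_forall fun t => ?_)
  rw [norm_airyWave, ← Real.exp_add]
  exact Real.exp_le_exp.mpr (by linarith)

/-- The entire extension of the Airy integral. -/
def airyEntire (w : ℂ) : ℂ :=
  ∫ t : ℝ, Complex.exp (Complex.I * (((t : ℂ) + Complex.I) ^ 3 / 3 + w * ((t : ℂ) + Complex.I)))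

theorem airyEntire_ofReal (x : ℝ) : airyEntire x = 2 * Real.pi * airyAi x := by
  have hpi : (Real.pi : ℂ) ≠ 0 := by exact_mod_cast Real.pi_ne_zero
  rw [ofReal_airyAi, airyEntire]
  simp only [airyWave]
  field_simp

theorem differentiable_airyEntire : Differentiable ℂ airyEntire := by
  intro w₀
  set R : ℝ := ‖w₀‖ + 1 with hR
  have hR0 : 0 ≤ R := by positivity
  have hbound_int : Integrable fun t : ℝ =>
      Real.exp (1 / 3 + R + (R + 1) ^ 2 / 2) * Real.exp (-(1 / 2) * t ^ 2) :=
    (integrable_exp_neg_mul_sq (by norm_num)).const_mul _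
  have hexp : ∀ (w : ℂ) (t : ℝ), ‖Complex.exp (Complex.I *
      (((t : ℂ) + Complex.I) ^ 3 / 3 + w * ((t : ℂ) + Complex.I)))‖ =
        Real.exp (1 / 3 - t ^ 2 - w.re - t * w.im) := fun w t => by
    rw [Complex.norm_exp]
    congr 1
    have : Complex.I * (((t : ℂ) + Complex.I) ^ 3 / 3 + w * ((t : ℂ) + Complex.I)) =
        ((1 / 3 - t ^ 2 : ℝ) : ℂ) + ((t ^ 3 / 3 - t : ℝ) : ℂ) * Complex.I
          + (Complex.I * t - 1) * w := by
      push_cast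
      linear_combination (Complex.I ^ 2 / 3 + t * Complex.I + t ^ 2 + w - 1 / 3) * Complex.I_sq
    rw [this]
    simp [-Complex.ofReal_sub]
    ring
  have hle : ∀ w ∈ Metric.ball w₀ 1, ∀ t : ℝ, ‖(Complex.I * ((t : ℂ) + Complex.I)) *
      Complex.exp (Complex.I * (((t : ℂ) + Complex.I) ^ 3 / 3 + w * ((t : ℂ) + Complex.I)))‖ ≤
        Real.exp (1 / 3 + R + (R + 1) ^ 2 / 2) * Real.exp (-(1 / 2) * t ^ 2) := by
    intro w hw t
    have hwR : ‖w‖ ≤ R := by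
      have := norm_sub_norm_le w w₀
      have h2 : ‖w - w₀‖ < 1 := by rwa [← dist_eq_norm]
      linarith
    have h1 : ‖Complex.I * ((t : ℂ) + Complex.I)‖ ≤ Real.exp |t| := by
      rw [norm_mul, Complex.norm_I, one_mul]
      refine (norm_add_le _ _).trans ?_
      rw [Complex.norm_I, Complex.norm_real]
      exact Real.add_one_le_exp _
    rw [norm_mul, hexp, ← Real.exp_add]
    refine (mul_le_mul_of_nonneg_right h1 (Real.exp_pos _).le).trans ?_
    rw [← Real.exp_add]
    refine Real.exp_le_exp.mpr ?_
    have hre : -w.re ≤ R := (neg_le_abs _).trans ((Complex.abs_re_le_norm w).trans hwR)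
    have him : -(t * w.im) ≤ |t| * R := by
      refine (neg_le_abs _).trans ?_
      rw [abs_mul]
      exact mul_le_mul_of_nonneg_left ((Complex.abs_im_le_norm w).trans hwR) (abs_nonneg t)
    have hsq : t ^ 2 = |t| ^ 2 := (sq_abs t).symm
    rw [hsq]
    -- Completing the square: |t|(R + 1) ≤ t²/2 + (R + 1)²/2, so half of the Gaussian absorbs the
    -- linear growth.
    nlinarith [sq_nonneg (|t| - (R + 1))]
  have hmeas : ∀ w : ℂ, Continuous fun t : ℝ => Complex.exp (Complex.I *
      (((t : ℂ) + Complex.I) ^ 3 / 3 + w * ((t : ℂ) + Complex.I))) := fun w => by fun_prop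
  have hint : Integrable fun t : ℝ => Complex.exp (Complex.I *
      (((t : ℂ) + Complex.I) ^ 3 / 3 + w₀ * ((t : ℂ) + Complex.I))) := by
    refine hbound_int.mono' (hmeas w₀).aestronglyMeasurable (Eventually.of_forall fun t => ?_)
    rw [hexp, ← Real.exp_add]
    refine Real.exp_le_exp.mpr ?_
    have hre : -w₀.re ≤ R := (neg_le_abs _).trans ((Complex.abs_re_le_norm w₀).trans (by linarith))
    have him : -(t * w₀.im) ≤ |t| * R := by
      refine (neg_le_abs _).trans ?_
      rw [abs_mul]
      exact mul_le_mul_of_nonneg_left ((Complex.abs_im_le_norm w₀).trans (by linarith))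
        (abs_nonneg t)
    have hsq : t ^ 2 = |t| ^ 2 := (sq_abs t).symm
    rw [hsq]
    nlinarith [sq_nonneg (|t| - R)]
  refine (hasDerivAt_integral_of_dominated_loc_of_deriv_le (F' := fun w t =>
    (Complex.I * ((t : ℂ) + Complex.I)) * Complex.exp (Complex.I *
      (((t : ℂ) + Complex.I) ^ 3 / 3 + w * ((t : ℂ) + Complex.I))))
    (Metric.ball_mem_nhds w₀ one_pos)
    (Eventually.of_forall fun w => (hmeas w).aestronglyMeasurable) hint
    ((by fun_prop : Continuous fun t : ℝ => (Complex.I * ((t : ℂ) + Complex.I)) *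
      Complex.exp (Complex.I * (((t : ℂ) + Complex.I) ^ 3 / 3 +
        w₀ * ((t : ℂ) + Complex.I)))).aestronglyMeasurable)
    (Eventually.of_forall fun t w hw => hle w hw t) hbound_int
    (Eventually.of_forall fun t w _ => ?_)).2.differentiableAt
  have h1 : HasDerivAt (fun w : ℂ => Complex.I * (((t : ℂ) + Complex.I) ^ 3 / 3 +
      w * ((t : ℂ) + Complex.I))) (Complex.I * (1 * ((t : ℂ) + Complex.I))) w :=
    (((hasDerivAt_id w).mul_const _).const_add _).const_mul _
  convert! h1.cexp using 1
  ring

@[fun_prop]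
theorem continuous_airyAi : Continuous airyAi := by
  have h : ∀ x, airyAi x = (2 * Real.pi)⁻¹ * (airyEntire x).re := fun x => rfl
  have hc : Continuous airyEntire := differentiable_airyEntire.continuous
  rw [funext h]
  fun_prop

/-- The Airy function has no half-line of zeros. -/
theorem exists_airyAi_ne_zero (s : ℝ) : ∃ x, s < x ∧ airyAi x ≠ 0 := by
  by_contra! hzero
  -- Zeros filling a half-line accumulate, so by the identity theorem the entire extension is
  -- identically zero.
  have han : AnalyticOnNhd ℂ airyEntire univ :=
    differentiable_airyEntire.differentiableOn.analyticOnNhd isOpen_univ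
  have hfreq : ∃ᶠ z in 𝓝[≠] ((s + 1 : ℝ) : ℂ), airyEntire z = (fun _ => (0 : ℂ)) z := by
    have htend : Tendsto (fun y : ℝ => (y : ℂ)) (𝓝[≠] (s + 1)) (𝓝[≠] ((s + 1 : ℝ) : ℂ)) := by
      refine tendsto_nhdsWithin_of_tendsto_nhds_of_eventually_within _
        ((Complex.continuous_ofReal.tendsto _).mono_left nhdsWithin_le_nhds) ?_
      filter_upwards [self_mem_nhdsWithin] with y hy
      exact fun h => hy (Complex.ofReal_injective h)
    refine htend.frequently (Eventually.frequently ?_)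
    filter_upwards [nhdsWithin_le_nhds (lt_mem_nhds (lt_add_one s))] with y hy
    rw [airyEntire_ofReal, hzero y hy]
    simp
  have hall := han.eq_of_frequently_eq analyticOnNhd_const hfreq
  set g : ℝ → ℂ := airyWave 0 with hg
  -- At w = -2πξ the entire extension is a nonzero factor times the Fourier transform of the Airy
  -- integrand at x = 0. Fourier inversion then makes an exponential vanish.
  have hF : FourierTransform.fourier g = 0 := by
    ext ξ
    rw [Real.fourier_real_eq_integral_exp_smul]
    have h := congrFun hall ((-2 * Real.pi * ξ : ℝ) : ℂ)
    simp only [airyEntire] at h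
    have e : ∀ t : ℝ, Complex.exp (Complex.I * (((t : ℂ) + Complex.I) ^ 3 / 3 +
        ((-2 * Real.pi * ξ : ℝ) : ℂ) * ((t : ℂ) + Complex.I))) =
        Complex.exp (((2 * Real.pi * ξ : ℝ) : ℂ)) *
          (Complex.exp (((-2 * Real.pi * t * ξ : ℝ) : ℂ) * Complex.I) • g t) := fun t => by
      rw [hg, airyWave, smul_eq_mul, ← Complex.exp_add, ← Complex.exp_add]
      congr 1
      push_cast
      linear_combination (-2 * Real.pi * ξ) * Complex.I_sq
    simp only [e, integral_const_mul] at h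
    simpa [Complex.exp_ne_zero] using h
  have hinv := (integrable_airyWave 0).fourierInv_fourier_eq
    (by rw [← hg, hF]; exact integrable_zero _ _ _)
    (continuous_airyWave 0).continuousAt (v := 0)
  rw [← hg, hF] at hinv
  have h0 : FourierTransformInv.fourierInv (0 : ℝ → ℂ) 0 = 0 := by
    rw [Real.fourierInv_eq]; simp
  rw [h0] at hinv
  exact Complex.exp_ne_zero _ hinv.symm

end Airy

/-! ### The Airy kernel: continuity and positivity -/

section AiryKernel

theorem abs_airyAi_mul_le (s t u : ℝ) : |airyAi (s + u) * airyAi (t + u)| ≤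
    airyConst ^ 2 * Real.exp (-s - t) * Real.exp (-2 * u) := by
  have h0 : 0 ≤ airyConst * Real.exp (-(s + u)) := (abs_nonneg _).trans (abs_airyAi_le _)
  calc |airyAi (s + u) * airyAi (t + u)| ≤
      (airyConst * Real.exp (-(s + u))) * (airyConst * Real.exp (-(t + u))) := by
        rw [abs_mul]
        exact mul_le_mul (abs_airyAi_le _) (abs_airyAi_le _) (abs_nonneg _) h0
    _ = airyConst ^ 2 * (Real.exp (-(s + u)) * Real.exp (-(t + u))) := by ring
    _ = airyConst ^ 2 * (Real.exp (-s - t) * Real.exp (-2 * u)) := by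
      rw [← Real.exp_add, ← Real.exp_add]; ring_nf
    _ = _ := by ring

theorem integrableOn_exp_neg_two (c : ℝ) :
    IntegrableOn (fun u => c * Real.exp (-2 * u)) (Ioi 0) :=
  Integrable.const_mul (exp_neg_integrableOn_Ioi 0 two_pos) c

theorem integrableOn_airyAi_mul (s t : ℝ) :
    IntegrableOn (fun u => airyAi (s + u) * airyAi (t + u)) (Ioi 0) :=
  (integrableOn_exp_neg_two (airyConst ^ 2 * Real.exp (-s - t))).mono'
    (by fun_prop : Continuous fun u => airyAi (s + u) * airyAi (t + u)).aestronglyMeasurable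
    (Eventually.of_forall fun u => abs_airyAi_mul_le s t u)

theorem airyKernel_comm (s t : ℝ) : airyKernel s t = airyKernel t s := by
  simp only [airyKernel, mul_comm]

/-- The integrand is a continuous square, nonzero somewhere in the half-line. -/
theorem airyKernel_self_pos (s : ℝ) : 0 < airyKernel s s := by
  obtain ⟨x, hx, hne⟩ := exists_airyAi_ne_zero s
  rw [airyKernel, integral_pos_iff_support_of_nonneg (fun u => mul_self_nonneg _)
    (integrableOn_airyAi_mul s s), Measure.restrict_apply']
  · have hopen : IsOpen (Function.support (fun u => airyAi (s + u) * airyAi (s + u)) ∩ Ioi 0) :=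
      ((by fun_prop : Continuous fun u => airyAi (s + u) * airyAi (s + u)).isOpen_support).inter
        isOpen_Ioi
    refine hopen.measure_pos _ ⟨x - s, ?_, ?_⟩
    · simp [hne]
    · simpa using hx
  · exact measurableSet_Ioi

theorem continuous_airyKernel : Continuous fun p : ℝ × ℝ => airyKernel p.1 p.2 := by
  refine continuous_iff_continuousAt.mpr fun p => ?_
  refine tendsto_integral_filter_of_dominated_convergence
    (fun u => airyConst ^ 2 * Real.exp (-(p.1 - 1) - (p.2 - 1)) * Real.exp (-2 * u))
    (Eventually.of_forall fun q => (by fun_prop :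
      Continuous fun u => airyAi (q.1 + u) * airyAi (q.2 + u)).aestronglyMeasurable) ?_
    (integrableOn_exp_neg_two _) (Eventually.of_forall fun u => ?_)
  · have h1 : ∀ᶠ q : ℝ × ℝ in 𝓝 p, p.1 - 1 ≤ q.1 :=
      (continuous_fst.tendsto p).eventually_const_le (sub_one_lt _)
    have h2 : ∀ᶠ q : ℝ × ℝ in 𝓝 p, p.2 - 1 ≤ q.2 :=
      (continuous_snd.tendsto p).eventually_const_le (sub_one_lt _)
    filter_upwards [h1, h2] with q hq1 hq2
    refine Eventually.of_forall fun u => (abs_airyAi_mul_le q.1 q.2 u).trans ?_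
    gcongr
  · exact (by fun_prop : Continuous fun q : ℝ × ℝ => airyAi (q.1 + u) * airyAi (q.2 + u)).tendsto p

/-- A Gram matrix: the entries are L²(0,∞) inner products of the translates Ai(s_i + ·). -/
theorem posSemidef_airyKernel {k : ℕ} (s : Fin k → ℝ) :
    (Matrix.of fun i j => airyKernel (s i) (s j)).PosSemidef := by
  refine .of_dotProduct_mulVec_nonneg ?_ fun x => ?_
  · ext i j
    simp [airyKernel_comm (s i)]
  · have h : star x ⬝ᵥ (Matrix.of fun i j => airyKernel (s i) (s j)).mulVec x =
        ∫ u in Ioi (0 : ℝ), (∑ i, x i * airyAi (s i + u)) * (∑ i, x i * airyAi (s i + u)) := by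
      simp only [Finset.sum_mul_sum]
      have hij : ∀ i j, Integrable (fun u => x i * airyAi (s i + u) * (x j * airyAi (s j + u)))
          (volume.restrict (Ioi 0)) := fun i j => by
        refine ((integrableOn_airyAi_mul (s i) (s j)).const_mul (x i * x j)).congr
            (Eventually.of_forall fun u => ?_)
        simp only; ring
      rw [integral_finsetSum _ fun i _ => integrable_finsetSum _ fun j _ => hij i j]
      simp only [dotProduct, Matrix.mulVec, Pi.star_apply, star_trivial, Matrix.of_apply,
        Finset.mul_sum]
      refine Finset.sum_congr rfl fun i _ => ?_
      rw [integral_finsetSum _ fun j _ => hij i j]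
      refine Finset.sum_congr rfl fun j _ => ?_
      rw [airyKernel, mul_comm _ (x j), ← mul_assoc, ← integral_const_mul]
      congr 1; ext u; ring
    rw [h]
    exact integral_nonneg fun u => mul_self_nonneg _

/-- The inequality of arithmetic and geometric means. -/
theorem prod_le_pow_of_sum_le {k : ℕ} {z : Fin k → ℝ} (hz : ∀ i, 0 ≤ z i) {C : ℝ}
    (hC : ∑ i, z i ≤ k * C) : ∏ i, z i ≤ C ^ k := by
  rcases Nat.eq_zero_or_pos k with rfl | hk
  · simp
  have hk' : (0 : ℝ) < k := by exact_mod_cast hk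
  have h := Real.geom_mean_le_arith_mean_weighted Finset.univ (fun _ : Fin k => (k : ℝ)⁻¹) z
    (fun _ _ => by positivity) (by simp [hk'.ne']) fun i _ => hz i
  rw [← Finset.mul_sum] at h
  have h2 : (k : ℝ)⁻¹ * ∑ i, z i ≤ C := by rwa [inv_mul_le_iff₀ hk']
  have h3 := pow_le_pow_left₀ (Finset.prod_nonneg fun i _ => Real.rpow_nonneg (hz i) _)
    (h.trans h2) k
  rw [← Finset.prod_pow] at h3
  refine le_trans (le_of_eq (Finset.prod_congr rfl fun i _ => ?_)) h3
  rw [← Real.rpow_mul_natCast (hz i), inv_mul_cancel₀ hk'.ne', Real.rpow_one]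

/-- A weak Hadamard inequality: the nonnegative eigenvalues have sum equal to the trace. The absence
of a factor k! is essential for the moment method. -/
theorem det_airyKernel_le {k : ℕ} (s : Fin k → ℝ) {C : ℝ} (hC : ∀ i, airyKernel (s i) (s i) ≤ C) :
    (Matrix.of fun i j => airyKernel (s i) (s j)).det ≤ C ^ k := by
  have hps := posSemidef_airyKernel s
  rw [hps.isHermitian.det_eq_prod_eigenvalues]
  refine prod_le_pow_of_sum_le (fun i => hps.eigenvalues_nonneg i) ?_
  have htr := hps.isHermitian.trace_eq_sum_eigenvalues
  have htr' : ∑ i, hps.isHermitian.eigenvalues i = ∑ i, airyKernel (s i) (s i) := by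
    rw [Matrix.trace] at htr
    simpa using htr.symm
  rw [htr']
  refine (Finset.sum_le_card_nsmul _ _ C fun i _ => hC i).trans ?_
  simp

end AiryKernel

/-! ### The discrete kernel and its scaling limit -/

section EdgeKernel

/-- The correlation kernel `∑_{j ≥ 0} J_{ν+j}(A) J_{l+j}(A)` of the outgoing occupations. -/
def edgeKernel (A : ℝ) (ν l : ℤ) : ℝ := ∑' j : ℕ, besselJ (ν + j) A * besselJ (l + j) A

theorem summable_edgeKernel (A : ℝ) (ν l : ℤ) :
    Summable fun j : ℕ => besselJ (ν + j) A * besselJ (l + j) A := by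
  have h : ∀ ν : ℤ, Summable fun j : ℕ => besselJ (ν + j) A := fun ν =>
    (summable_besselJ A).comp_injective (i := fun j : ℕ => ν + (j : ℤ)) fun a b hab => by
      simpa using hab
  have hb : ∀ j : ℕ, |besselJ (l + j) A| ≤ 1 := fun j => by
    simpa using abs_besselJ_le (l + j) A 0
  refine Summable.of_norm_bounded (h ν).norm fun j => ?_
  rw [norm_mul]
  exact mul_le_of_le_one_right (norm_nonneg _) (hb j)

/-- A series as the integral of a step function. -/
theorem integral_floor_mul {h : ℕ → ℝ} (hs : Summable h) {κ : ℝ} (hκ : 0 < κ) :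
    ∫ u in Ioi (0 : ℝ), h ⌊κ * u⌋₊ = κ⁻¹ * ∑' j, h j := by
  have h1 := integral_comp_mul_left_Ioi (fun u => h ⌊u⌋₊) 0 hκ
  rw [mul_zero, smul_eq_mul] at h1
  rw [h1]
  congr 1
  have hU : (⋃ j : ℕ, Ico (j : ℝ) (j + 1)) = Ici 0 := by
    ext u
    simp only [mem_iUnion, mem_Ico, mem_Ici]
    exact ⟨fun ⟨j, hj, _⟩ => (Nat.cast_nonneg j).trans hj,
      fun hu => ⟨⌊u⌋₊, Nat.floor_le hu, Nat.lt_floor_add_one u⟩⟩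
  have hval : ∀ (j : ℕ), ∀ u ∈ Ico (j : ℝ) (j + 1), ⌊u⌋₊ = j := fun j u hu =>
    (Nat.floor_eq_iff ((Nat.cast_nonneg j).trans hu.1)).mpr hu
  have hint : ∀ (f : ℕ → ℝ) (j : ℕ), ∫ u in Ico (j : ℝ) (j + 1), f ⌊u⌋₊ = f j := fun f j => by
    rw [setIntegral_congr_fun measurableSet_Ico
      (fun u hu => by simp only [hval j u hu] : EqOn (fun u => f ⌊u⌋₊) (fun _ => f j) _)]
    simp
  have hon : IntegrableOn (fun u : ℝ => h ⌊u⌋₊) (⋃ j : ℕ, Ico (j : ℝ) (j + 1)) := by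
    refine integrableOn_iUnion_of_summable_integral_norm (fun j => ?_) ?_
    · exact (integrableOn_congr_fun (fun u hu => by simp only [hval j u hu] :
        EqOn (fun u => h ⌊u⌋₊) (fun _ => h j) _) measurableSet_Ico).mpr
          (integrableOn_const (by simp))
    · simpa only [hint fun j => ‖h j‖] using hs.norm
  have hsum := hasSum_integral_iUnion (fun j : ℕ => measurableSet_Ico)
    (fun i j hij => Set.disjoint_left.mpr fun u hi hj => hij ((hval i u hi).symm.trans
      (hval j u hj))) hon
  rw [hU, integral_Ici_eq_integral_Ioi] at hsum
  simp only [hint h] at hsum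
  exact hsum.tsum_eq.symm

/-- Writing the sum as an integral of a step function of mesh 1/κ puts it on the same domain as the
Airy kernel, ready for dominated convergence. -/
theorem kappa_mul_edgeKernel {A : ℝ} (hA : 0 < A) (ν l : ℤ) :
    kappa A * edgeKernel A ν l = ∫ u in Ioi (0 : ℝ),
      (kappa A * besselJ (ν + ⌊kappa A * u⌋₊) A) * (kappa A * besselJ (l + ⌊kappa A * u⌋₊) A) := by
  have hk := kappa_pos hA
  have h := integral_floor_mul (((summable_edgeKernel A ν l).mul_left (kappa A ^ 2))) hk
  rw [tsum_mul_left] at h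
  have e : ∀ u : ℝ, (kappa A * besselJ (ν + ⌊kappa A * u⌋₊) A) *
      (kappa A * besselJ (l + ⌊kappa A * u⌋₊) A) = kappa A ^ 2 *
        (besselJ (ν + ⌊kappa A * u⌋₊) A * besselJ (l + ⌊kappa A * u⌋₊) A) := fun u => by ring
  simp only [e]
  rw [h, edgeKernel]
  field_simp

theorem abs_kappa_mul_besselJ_floor_le {A : ℝ} (hA : 2 ≤ A) (ν : ℤ) (u : ℝ) :
    |kappa A * besselJ (ν + ⌊kappa A * u⌋₊) A| ≤
      edgeConst * Real.exp (1 - (ν - A) / kappa A - u) := by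
  have hk1 := one_le_kappa hA
  have hk : 0 < kappa A := by linarith
  refine (abs_kappa_mul_besselJ_le _ hA).trans ?_
  refine mul_le_mul_of_nonneg_left (Real.exp_le_exp.mpr ?_) edgeConst_nonneg
  have h1 : kappa A * u < ⌊kappa A * u⌋₊ + 1 := Nat.lt_floor_add_one _
  -- The floor loses less than 1 ≤ κ, hence at most 1 after division; this is the extra 1 in the
  -- exponent.
  have h2 : (kappa A * u - kappa A) / kappa A ≤ (⌊kappa A * u⌋₊ : ℝ) / kappa A := by
    gcongr; linarith
  have h3 : (kappa A * u - kappa A) / kappa A = u - 1 := by field_simp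
  push_cast
  have h4 : ((ν : ℝ) + ⌊kappa A * u⌋₊ - A) / kappa A =
      (ν - A) / kappa A + (⌊kappa A * u⌋₊ : ℝ) / kappa A := by ring
  rw [h4]
  linarith

theorem abs_edgeIntegrand_le {A : ℝ} (hA : 2 ≤ A) (ν l : ℤ) (u : ℝ) :
    |(kappa A * besselJ (ν + ⌊kappa A * u⌋₊) A) * (kappa A * besselJ (l + ⌊kappa A * u⌋₊) A)| ≤
      edgeConst ^ 2 * Real.exp (2 - (ν - A) / kappa A - (l - A) / kappa A) *
        Real.exp (-2 * u) := by
  have h0 := (abs_nonneg _).trans (abs_kappa_mul_besselJ_floor_le hA ν u)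
  rw [abs_mul]
  refine (mul_le_mul (abs_kappa_mul_besselJ_floor_le hA ν u)
    (abs_kappa_mul_besselJ_floor_le hA l u) (abs_nonneg _) h0).trans (le_of_eq ?_)
  rw [mul_mul_mul_comm, ← Real.exp_add, mul_assoc (edgeConst ^ 2), ← Real.exp_add]
  ring_nf

theorem abs_kappa_mul_edgeKernel_le {A : ℝ} (hA : 2 ≤ A) (ν l : ℤ) :
    |kappa A * edgeKernel A ν l| ≤
      edgeConst ^ 2 * Real.exp (2 - (ν - A) / kappa A - (l - A) / kappa A) := by
  rw [kappa_mul_edgeKernel (by linarith), ← Real.norm_eq_abs]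
  refine (norm_integral_le_of_norm_le (integrableOn_exp_neg_two (edgeConst ^ 2 *
    Real.exp (2 - (ν - A) / kappa A - (l - A) / kappa A)))
    (Eventually.of_forall fun u => abs_edgeIntegrand_le hA ν l u)).trans ?_
  rw [integral_const_mul, integral_exp_mul_Ioi (by norm_num)]
  refine mul_le_of_le_one_right (by positivity) (by norm_num)

theorem tendsto_kappa_mul_edgeKernel {X : Type*} {L : Filter X} [L.IsCountablyGenerated]
    {A : X → ℝ} (hA : Tendsto A L atTop) {ν l : X → ℤ} {s t : ℝ}
    (hν : Tendsto (fun x => ((ν x : ℝ) - A x) / kappa (A x)) L (𝓝 s))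
    (hl : Tendsto (fun x => ((l x : ℝ) - A x) / kappa (A x)) L (𝓝 t)) :
    Tendsto (fun x => kappa (A x) * edgeKernel (A x) (ν x) (l x)) L (𝓝 (airyKernel s t)) := by
  have hk : Tendsto (fun x => kappa (A x)) L atTop := tendsto_kappa_atTop.comp hA
  have hshift : ∀ {ν : X → ℤ} {s : ℝ},
      Tendsto (fun x => ((ν x : ℝ) - A x) / kappa (A x)) L (𝓝 s) → ∀ u : ℝ, 0 < u →
      Tendsto (fun x => kappa (A x) * besselJ (ν x + ⌊kappa (A x) * u⌋₊) (A x)) L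
        (𝓝 (airyAi (s + u))) := by
    intro ν s hν u hu
    refine tendsto_kappa_mul_besselJ hA ?_
    have hfl : Tendsto (fun x => (⌊u * kappa (A x)⌋₊ : ℝ) / kappa (A x)) L (𝓝 u) :=
      (tendsto_nat_floor_mul_div_atTop hu.le).comp hk
    refine (hν.add hfl).congr fun x => ?_
    push_cast
    rw [mul_comm u]
    ring
  have hint : Tendsto (fun x => ∫ u in Ioi (0 : ℝ),
      (kappa (A x) * besselJ (ν x + ⌊kappa (A x) * u⌋₊) (A x)) *
        (kappa (A x) * besselJ (l x + ⌊kappa (A x) * u⌋₊) (A x))) L (𝓝 (airyKernel s t)) := by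
    refine tendsto_integral_filter_of_dominated_convergence
      (fun u => edgeConst ^ 2 * Real.exp (2 - (s - 1) - (t - 1)) * Real.exp (-2 * u))
      (Eventually.of_forall fun x => ?_) ?_ (integrableOn_exp_neg_two _) ?_
    · have hm : Measurable fun u : ℝ => ⌊kappa (A x) * u⌋₊ :=
        Nat.measurable_floor.comp (measurable_const_mul _)
      exact ((measurable_from_nat (f := fun j : ℕ => (kappa (A x) * besselJ (ν x + j) (A x)) *
        (kappa (A x) * besselJ (l x + j) (A x)))).comp hm).aestronglyMeasurable
    · filter_upwards [hA.eventually_ge_atTop 2, hν.eventually_const_le (sub_one_lt s),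
        hl.eventually_const_le (sub_one_lt t)] with x h2 h3 h4
      refine Eventually.of_forall fun u => (abs_edgeIntegrand_le h2 _ _ u).trans ?_
      gcongr
    · exact (ae_restrict_mem measurableSet_Ioi).mono fun u hu =>
        (hshift hν u hu).mul (hshift hl u hu)
  refine hint.congr' ?_
  filter_upwards [hA.eventually_gt_atTop 0] with x hx
  rw [kappa_mul_edgeKernel hx]

end EdgeKernel

/-! ### Reduction to a single chain with filled and empty modes -/

section LeadModes

variable {𝒜 : Type*} [CStarAlgebra 𝒜] {ι : Type*} [Fintype ι] [DecidableEq ι]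
  {a : ι → ℤ → 𝒜} {ω : 𝒜 →L[ℂ] ℂ} {U : Matrix ι ι ℂ}

/-- The static mixture `∑_β U^{αβ} a_{βm}` of the incoming channels seen in lead `α`. -/
def leadMode (a : ι → ℤ → 𝒜) (U : Matrix ι ι ℂ) (α : ι) (m : ℤ) : 𝒜 := ∑ β, U α β • a β m

theorem sum_norm_sq_row (hU : U ∈ Matrix.unitaryGroup ι ℂ) (α : ι) :
    ∑ β, ((‖U α β‖ ^ 2 : ℝ) : ℂ) = 1 := by
  have h := congrFun (congrFun (Matrix.mem_unitaryGroup_iff.mp hU) α) α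
  rw [Matrix.mul_apply, Matrix.one_apply_eq] at h
  rw [← h]
  refine Finset.sum_congr rfl fun β _ => ?_
  rw [Matrix.star_apply, RCLike.star_def, Complex.mul_conj, Complex.normSq_eq_norm_sq]

omit [Fintype ι] in
theorem IsCAR.channel (ha : IsCAR a) (β : ι) : IsModeCAR (a β) where
  anticomm m n := ha.anticomm β m β n
  anticomm_star m n := by simpa using ha.anticomm_star β m β n

/-- Only the unit norm of the row α of U enters: distinct channels anticommute, and the diagonal
weights sum to 1. -/
theorem IsCAR.leadMode (ha : IsCAR a) (hU : U ∈ Matrix.unitaryGroup ι ℂ) (α : ι) :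
    IsModeCAR (leadMode a U α) where
  anticomm m n := by
    simp only [SidebandEdge.leadMode, Finset.sum_mul_sum]
    rw [Finset.sum_comm (γ := ι), ← Finset.sum_add_distrib]
    refine Finset.sum_eq_zero fun β _ => ?_
    rw [← Finset.sum_add_distrib]
    refine Finset.sum_eq_zero fun β' _ => ?_
    rw [smul_mul_smul_comm, smul_mul_smul_comm, mul_comm (U α β) (U α β'), ← smul_add,
      ha.anticomm, smul_zero]
  anticomm_star m n := by
    simp only [SidebandEdge.leadMode, star_sum, Finset.sum_mul_sum]
    rw [Finset.sum_comm (γ := ι), ← Finset.sum_add_distrib]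
    have hterm : ∀ β, ∑ β', U α β' • a β' m * star (U α β • a β n) +
        ∑ β', star (U α β • a β n) * U α β' • a β' m =
          ((‖U α β‖ ^ 2 : ℝ) : ℂ) • (if m = n then (1 : 𝒜) else 0) := fun β => by
      rw [← Finset.sum_add_distrib, Finset.sum_eq_single β]
      · rw [star_smul, smul_mul_smul_comm, smul_mul_smul_comm, mul_comm (star (U α β)), ← smul_add,
          ha.anticomm_star, RCLike.star_def, Complex.mul_conj, Complex.normSq_eq_norm_sq]
        simp
      · intro β' _ hβ
        rw [star_smul, smul_mul_smul_comm, smul_mul_smul_comm, mul_comm (star (U α β)), ← smul_add,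
          ha.anticomm_star, if_neg fun h => hβ h.1, smul_zero]
      · simp
    rw [Finset.sum_congr rfl fun β _ => hterm β, ← Finset.sum_smul, sum_norm_sq_row hU, one_smul]

/-- The scattering matrix factors into a channel part and a sideband part, so the channel sum can be
done first. -/
theorem outgoing_eq_smear (ha : IsCAR a) (U : Matrix ι ι ℂ) (A : ℝ) (α : ι) (n : ℤ) :
    outgoing a U A α n = smear (leadMode a U α) fun m => besselJ (n - m) A := by
  have hs : ∀ β, Summable fun m : ℤ => floquetS U A α β n m • a β m := fun β => by
    refine (((ha.channel β).summable_smear (summable_besselJ_sub n A)).const_smul (U α β)).congr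
      fun m => ?_
    rw [floquetS, mul_smul]
  rw [outgoing, ← Summable.tsum_finsetSum fun β _ => hs β, smear]
  refine tsum_congr fun m => ?_
  rw [leadMode, Finset.smul_sum]
  refine Finset.sum_congr rfl fun β _ => ?_
  rw [floquetS, mul_comm, mul_smul]

/-! ### Filled and empty modes -/

omit [Fintype ι] in
theorem occupation_mem_Icc (ha : IsCAR a) (hω : IsState ω) (β : ι) (m : ℤ) :
    ∃ p : ℝ, 0 ≤ p ∧ p ≤ 1 ∧ ω (star (a β m) * a β m) = p ∧ ω (a β m * star (a β m)) = 1 - p := by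
  have h0 := hω.nonneg (a β m)
  have h1 := hω.nonneg (star (a β m))
  have hsum : ω (a β m * star (a β m)) + ω (star (a β m) * a β m) = 1 := by
    have h := ha.anticomm_star β m β m
    rw [if_pos ⟨rfl, rfl⟩] at h
    rw [← map_add, h, hω.map_one]
  rw [star_star] at h1
  obtain ⟨hre0, him0⟩ := Complex.le_def.mp h0
  obtain ⟨hre1, -⟩ := Complex.le_def.mp h1
  have hp : ω (star (a β m) * a β m) = ((ω (star (a β m) * a β m)).re : ℂ) :=
    Complex.ext (by simp) (by simpa using him0.symm)
  have hre := congrArg Complex.re hsum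
  simp only [Complex.add_re, Complex.one_re, Complex.zero_re] at hre hre0 hre1
  exact ⟨_, hre0, by linarith, hp, by rw [← hp]; linear_combination hsum⟩

/-- The weights sum to 1 and each occupation is at most 1, so an average of 1 forces occupation 1
wherever U^{αβ} ≠ 0. There a† is a null vector of the state. -/
theorem leadMode_filled (ha : IsCAR a) (hω : IsState ω) (hU : U ∈ Matrix.unitaryGroup ι ℂ) {α : ι}
    {m : ℤ} (hm : effectiveOccupation ω a U α m = 1) (x : 𝒜) : ω (leadMode a U α m * x) = 0 := by
  choose p hp0 hp1 hp hq using fun β => occupation_mem_Icc ha hω β m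
  have hsum : ∑ β, ‖U α β‖ ^ 2 * (1 - p β) = 0 := by
    have h : ∑ β, ((‖U α β‖ ^ 2 : ℝ) : ℂ) - effectiveOccupation ω a U α m = 0 := by
      rw [hm, sum_norm_sq_row hU, sub_self]
    simp only [effectiveOccupation, hp, ← Finset.sum_sub_distrib] at h
    have h' : ((∑ β, ‖U α β‖ ^ 2 * (1 - p β) : ℝ) : ℂ) = 0 := by
      rw [← h]; push_cast
      exact Finset.sum_congr rfl fun β _ => by ring
    exact_mod_cast h'
  have hz := (Finset.sum_eq_zero_iff_of_nonneg fun β _ =>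
    mul_nonneg (sq_nonneg _) (sub_nonneg.mpr (hp1 β))).mp hsum
  rw [leadMode, Finset.sum_mul, map_sum]
  refine Finset.sum_eq_zero fun β _ => ?_
  rw [smul_mul_assoc, map_smul]
  rcases mul_eq_zero.mp (hz β (Finset.mem_univ β)) with h | h
  · rw [norm_eq_zero.mp (pow_eq_zero_iff two_ne_zero |>.mp h), zero_smul]
  · have hnull : ω (star (star (a β m)) * star (a β m)) = 0 := by
      rw [star_star, hq]; exact_mod_cast h
    have := (hω.mul_null hnull x).2
    rw [star_star] at this
    rw [this, smul_zero]

theorem leadMode_empty (ha : IsCAR a) (hω : IsState ω) {α : ι}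
    {m : ℤ} (hm : effectiveOccupation ω a U α m = 0) (x : 𝒜) : ω (x * leadMode a U α m) = 0 := by
  choose p hp0 hp1 hp hq using fun β => occupation_mem_Icc ha hω β m
  have hsum : ∑ β, ‖U α β‖ ^ 2 * p β = 0 := by
    simp only [effectiveOccupation, hp] at hm
    exact_mod_cast hm
  have hz := (Finset.sum_eq_zero_iff_of_nonneg fun β _ =>
    mul_nonneg (sq_nonneg _) (hp0 β)).mp hsum
  rw [leadMode, Finset.mul_sum, map_sum]
  refine Finset.sum_eq_zero fun β _ => ?_
  rw [mul_smul_comm, map_smul]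
  rcases mul_eq_zero.mp (hz β (Finset.mem_univ β)) with h | h
  · rw [norm_eq_zero.mp (pow_eq_zero_iff two_ne_zero |>.mp h), zero_smul]
  · have hnull : ω (star (a β m) * a β m) = 0 := by rw [hp, h]; rfl
    rw [(hω.mul_null hnull x).1, smul_zero]

/-! ### Outgoing occupations -/

theorem outgoing_anticomm (ha : IsCAR a) (hU : U ∈ Matrix.unitaryGroup ι ℂ) (A : ℝ) (α : ι)
    (n n' : ℤ) : outgoing a U A α n * outgoing a U A α n' +
      outgoing a U A α n' * outgoing a U A α n = 0 := by
  rw [outgoing_eq_smear ha, outgoing_eq_smear ha]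
  exact (ha.leadMode hU α).smear_anticomm (summable_besselJ_sub _ _) (summable_besselJ_sub _ _)

theorem outgoing_anticomm_star (ha : IsCAR a) (hU : U ∈ Matrix.unitaryGroup ι ℂ) (A : ℝ) (α : ι)
    (n n' : ℤ) : outgoing a U A α n * star (outgoing a U A α n') +
      star (outgoing a U A α n') * outgoing a U A α n = if n = n' then 1 else 0 := by
  rw [outgoing_eq_smear ha, outgoing_eq_smear ha, (ha.leadMode hU α).smear_anticomm_star
    (summable_besselJ_sub _ _) (summable_besselJ_sub _ _) (hasSum_besselJ_mul n n' A)]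
  split_ifs <;> simp

omit [DecidableEq ι] in
theorem star_number (a : ι → ℤ → 𝒜) (U : Matrix ι ι ℂ) (α : ι) (mF : ℤ) (A : ℝ) (ν : ℤ) :
    star (number a U α mF A ν) = number a U α mF A ν := by
  simp [number]

theorem number_mul_self (ha : IsCAR a) (hU : U ∈ Matrix.unitaryGroup ι ℂ) (α : ι) (mF : ℤ) (A : ℝ)
    (ν : ℤ) : number a U α mF A ν * number a U α mF A ν = number a U α mF A ν := by
  set b := outgoing a U A α (mF + ν) with hb
  have h0 : b * b = 0 := by
    have h := outgoing_anticomm ha hU A α (mF + ν) (mF + ν)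
    rw [← hb, ← two_smul ℂ] at h
    exact (smul_eq_zero.mp h).resolve_left two_ne_zero
  have h1 : b * star b = 1 - star b * b := by
    rw [eq_sub_iff_add_eq]
    simpa using outgoing_anticomm_star ha hU A α (mF + ν) (mF + ν)
  rw [number, ← hb, mul_assoc, ← mul_assoc b, h1, sub_mul, one_mul, mul_assoc (star b), h0]
  simp

theorem number_commute (ha : IsCAR a) (hU : U ∈ Matrix.unitaryGroup ι ℂ) (α : ι) (mF : ℤ) (A : ℝ)
    (ν l : ℤ) : number a U α mF A ν * number a U α mF A l =
      number a U α mF A l * number a U α mF A ν := by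
  rcases eq_or_ne ν l with rfl | hne
  · rfl
  set b := outgoing a U A α (mF + ν) with hb
  set d := outgoing a U A α (mF + l) with hd
  have hne1 : mF + ν ≠ mF + l := fun h => hne (by linarith)
  have h1 : b * d = -(d * b) := eq_neg_of_add_eq_zero_left (outgoing_anticomm ha hU A α _ _)
  have h2 : b * star d = -(star d * b) := eq_neg_of_add_eq_zero_left (by
    simpa [hne1] using outgoing_anticomm_star ha hU A α (mF + ν) (mF + l))
  have h3 : star b * star d = -(star d * star b) := by
    have := congrArg star h1
    simp only [star_mul, star_neg] at this
    rw [this, neg_neg]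
  have h4 : star b * d = -(d * star b) := by
    have := congrArg star h2
    simp only [star_mul, star_neg, star_star] at this
    rw [this, neg_neg]
  rw [number, number, ← hb, ← hd]
  calc star b * b * (star d * d) = star b * (b * star d) * d := by noncomm_ring
    _ = -((star b * star d) * (b * d)) := by rw [h2]; noncomm_ring
    _ = -(star d * (star b * d) * b) := by rw [h1, h3]; noncomm_ring
    _ = star d * d * (star b * b) := by rw [h4]; noncomm_ring

/-- Counting down from the Fermi level, m = mF - j, turns mF + ν - m into ν + j, so the kernel does
not depend on mF. -/
theorem hasSum_edgeKernel (A : ℝ) (mF ν l : ℤ) :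
    HasSum ((Iic mF).indicator fun m => besselJ (mF + l - m) A * besselJ (mF + ν - m) A)
      (edgeKernel A ν l) := by
  have hinj : Function.Injective fun j : ℕ => mF - (j : ℤ) := fun i j h => by
    simpa using h
  rw [← hinj.hasSum_iff]
  · refine (summable_edgeKernel A ν l).hasSum.congr_fun fun j => ?_
    rw [Function.comp_apply, Set.indicator_of_mem (by simp), mul_comm]
    congr 2 <;> ring
  · intro m hm
    refine Set.indicator_of_notMem (fun h => hm ⟨(mF - m).toNat, ?_⟩) _
    have : m ≤ mF := h
    simp only
    omega

/-- Distinct sites: normal ordering, then Wick. Coincident sites: two equal rows match the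
convention that the correlation is 0. -/
theorem siteCorrelation_eq_det (ha : IsCAR a) (hω : IsState ω)
    (hU : U ∈ Matrix.unitaryGroup ι ℂ) {α : ι} {mF : ℤ}
    (hstep : ∀ m : ℤ, effectiveOccupation ω a U α m = if m ≤ mF then 1 else 0)
    (A : ℝ) {k : ℕ} (ν : Fin k → ℤ) :
    siteCorrelation ω (number a U α mF A) ν =
      (((Matrix.of fun i j => edgeKernel A (ν i) (ν j)).det : ℝ) : ℂ) := by
  have hcast : (((Matrix.of fun i j => edgeKernel A (ν i) (ν j)).det : ℝ) : ℂ) =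
      (Matrix.of fun i j => (edgeKernel A (ν i) (ν j) : ℂ)).det := by
    rw [← Complex.ofRealHom_eq_coe, RingHom.map_det]
    rfl
  by_cases hν : Function.Injective ν
  · rw [siteCorrelation, if_pos hν, expectProd, hcast]
    simp only [number]
    rw [ofFn_prod_eq_normal]
    · simp only [outgoing_eq_smear ha]
      refine wick_det (ha.leadMode hU α) hω.map_one (Iic mF) (fun m hm x => ?_)
        (fun m hm x => ?_) _ _ (fun _ => summable_besselJ_sub _ _)
        (fun _ => summable_besselJ_sub _ _) _ fun i j => hasSum_edgeKernel A mF (ν i) (ν j)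
      · exact leadMode_filled ha hω hU (by rw [hstep, if_pos (show m ≤ mF from hm)]) x
      · exact leadMode_empty ha hω (by rw [hstep, if_neg (show ¬m ≤ mF from hm)]) x
    · exact fun i j => outgoing_anticomm ha hU A α _ _
    · intro i j hij
      rw [outgoing_anticomm_star ha hU, if_neg fun h => hij (hν (by linarith))]
  · rw [siteCorrelation, if_neg hν]
    obtain ⟨i, j, hij, hne⟩ := Function.not_injective_iff.mp hν
    rw [Matrix.det_zero_of_row_eq hne (by ext l; simp [hij])]
    simp

end LeadModes

/-! ### The joint law of commuting projections -/

section JointLaw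

/-- A state on a unital commutative C⋆-algebra is integration over its character space. -/
theorem exists_measure_of_state {B : Type*} [CommCStarAlgebra B] (ω : B →ₗ[ℂ] ℂ) (h1 : ω 1 = 1)
    (hpos : ∀ x, 0 ≤ ω (star x * x)) [MeasurableSpace (WeakDual.characterSpace ℂ B)]
    [BorelSpace (WeakDual.characterSpace ℂ B)] :
    ∃ μ : Measure (WeakDual.characterSpace ℂ B), IsProbabilityMeasure μ ∧
      ∀ (b : B) (f : C(WeakDual.characterSpace ℂ B, ℝ)), (∀ φ, φ b = (f φ : ℂ)) →
        ω b = ((∫ φ, f φ ∂μ : ℝ) : ℂ) := by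
  let G := gelfandStarTransform B
  let emb : C(WeakDual.characterSpace ℂ B, ℝ) → C(WeakDual.characterSpace ℂ B, ℂ) :=
    fun f => ⟨fun φ => (f φ : ℂ), by fun_prop⟩
  have hnonneg : ∀ f : C(WeakDual.characterSpace ℂ B, ℝ), (∀ φ, 0 ≤ f φ) →
      0 ≤ ω (G.symm (emb f)) := by
    intro f hf
    -- A nonnegative function is r̄ r with r its square root, so positivity of ω applies.
    let r : C(WeakDual.characterSpace ℂ B, ℝ) := ⟨fun φ => √(f φ), by fun_prop⟩
    have hr : emb f = star (emb r) * emb r := by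
      ext φ
      simp only [emb, r, ContinuousMap.coe_mk, ContinuousMap.mul_apply, ContinuousMap.star_apply,
        RCLike.star_def, Complex.conj_ofReal]
      rw [← Complex.ofReal_mul, Real.mul_self_sqrt (hf φ)]
    rw [hr, map_mul, map_star]
    exact hpos _
  let Λ₀ : C_c(WeakDual.characterSpace ℂ B, ℝ) →ₗ[ℝ] ℝ :=
    { toFun := fun f => (ω (G.symm (emb f.toContinuousMap))).re
      map_add' := fun f g => by
        have : emb (f + g).toContinuousMap = emb f.toContinuousMap + emb g.toContinuousMap := by
          ext φ; simp [emb]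
        rw [this, map_add, map_add, Complex.add_re]
      map_smul' := fun c f => by
        have : emb (c • f).toContinuousMap = (c : ℂ) • emb f.toContinuousMap := by
          ext φ; simp [emb]
        rw [this, map_smul, map_smul, smul_eq_mul, Complex.re_ofReal_mul]
        rfl }
  let Λ : C_c(WeakDual.characterSpace ℂ B, ℝ) →ₚ[ℝ] ℝ :=
    PositiveLinearMap.mk₀ Λ₀ fun f hf => (Complex.le_def.mp (hnonneg f.toContinuousMap hf)).1
  let toCc : C(WeakDual.characterSpace ℂ B, ℝ) → C_c(WeakDual.characterSpace ℂ B, ℝ) :=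
    fun f => ⟨f, HasCompactSupport.of_compactSpace f⟩
  have hint : ∀ (b : B) (f : C(WeakDual.characterSpace ℂ B, ℝ)), (∀ φ, φ b = (f φ : ℂ)) →
      (ω b).re = ∫ φ, f φ ∂(RealRMK.rieszMeasure Λ) := by
    intro b f hbf
    have hb : G.symm (emb f) = b := by
      rw [StarAlgEquiv.symm_apply_eq]
      ext φ
      exact (hbf φ).symm
    have := RealRMK.integral_rieszMeasure Λ (toCc f)
    rw [← hb]
    exact this.symm
  have him : ∀ f : C(WeakDual.characterSpace ℂ B, ℝ), (ω (G.symm (emb f))).im = 0 := by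
    intro f
    -- f is the difference of the nonnegative functions f + ‖f‖ and ‖f‖, on both of which ω is real.
    let c : C(WeakDual.characterSpace ℂ B, ℝ) := ContinuousMap.const _ ‖f‖
    have hc : 0 ≤ ω (G.symm (emb c)) := hnonneg c fun φ => norm_nonneg f
    have hfc : 0 ≤ ω (G.symm (emb (f + c))) := hnonneg _ fun φ => by
      have := (abs_le.mp (f.norm_coe_le_norm φ)).1
      simp only [ContinuousMap.add_apply, c, ContinuousMap.const_apply]
      linarith
    have hadd : emb (f + c) = emb f + emb c := by ext φ; simp [emb]
    rw [hadd, map_add, map_add] at hfc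
    have e1 := (Complex.le_def.mp hc).2
    have e2 := (Complex.le_def.mp hfc).2
    simp only [Complex.zero_im, Complex.add_im] at e1 e2
    linarith
  have hmass := hint 1 1 fun φ => by simp
  refine ⟨RealRMK.rieszMeasure Λ, ⟨?_⟩, fun b f hbf => ?_⟩
  · rw [h1] at hmass
    simp only [Complex.one_re, ContinuousMap.one_apply, integral_const, smul_eq_mul,
      mul_one] at hmass
    rw [Measure.real, eq_comm, ENNReal.toReal_eq_one_iff] at hmass
    exact hmass
  · have hb : G.symm (emb f) = b := by
      rw [StarAlgEquiv.symm_apply_eq]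
      ext φ
      exact (hbf φ).symm
    apply Complex.ext
    · rw [Complex.ofReal_re]; exact hint b f hbf
    · rw [Complex.ofReal_im, ← hb, him]

theorem measurableSet_forall_mem {k : ℕ} (ν : Fin k → ℤ) :
    MeasurableSet {S : Set ℤ | ∀ i, ν i ∈ S} := by
  rw [Set.ofPred_forall]
  exact MeasurableSet.iInter fun i => measurableSet_setOfPred.mpr (measurable_set_mem (ν i))

/-- Commuting projections have a joint law in every state. -/
theorem exists_isOccupationLaw {𝒜 : Type*} [CStarAlgebra 𝒜] {ω : 𝒜 →L[ℂ] ℂ} (hω : IsState ω)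
    {N : ℤ → 𝒜} (hstar : ∀ ν, star (N ν) = N ν) (hidem : ∀ ν, N ν * N ν = N ν)
    (hcomm : ∀ ν l, N ν * N l = N l * N ν) :
    ∃ P : ProbabilityMeasure (Set ℤ), IsOccupationLaw ω N P := by
  -- The closed star-algebra generated by the commuting self-adjoint N is a commutative C⋆-algebra,
  -- to which Gelfand duality applies.
  let S₀ := StarAlgebra.adjoin ℂ (range N)
  have hS₀ : IsMulCommutative S₀ := StarAlgebra.isMulCommutative_adjoin ℂ
    (by rintro _ ⟨i, rfl⟩ _ ⟨j, rfl⟩; exact hcomm i j)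
    (by rintro _ ⟨i, rfl⟩ _ ⟨j, rfl⟩; rw [hstar]; exact hcomm i j)
  let S := S₀.topologicalClosure
  have hclosed : IsClosed (S : Set 𝒜) := S₀.isClosed_topologicalClosure
  let _ : CommRing S := S₀.commRingTopologicalClosure fun x y => mul_comm' x y
  let _ : CommCStarAlgebra S := { }
  let n : ℤ → S := fun ν =>
    ⟨N ν, S₀.le_topologicalClosure (StarAlgebra.subset_adjoin ℂ _ (mem_range_self ν))⟩
  have hn : ∀ ν, n ν * n ν = n ν := fun ν => Subtype.ext (hidem ν)
  let _ : MeasurableSpace (WeakDual.characterSpace ℂ S) := borel _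
  have _ : BorelSpace (WeakDual.characterSpace ℂ S) := ⟨rfl⟩
  obtain ⟨μ, hμ, hint⟩ := exists_measure_of_state
    (ω.toLinearMap ∘ₗ S.subtype.toAlgHom.toLinearMap : S →ₗ[ℂ] ℂ) hω.map_one
    fun x => hω.nonneg x
  have h01 : ∀ (φ : WeakDual.characterSpace ℂ S) ν, φ (n ν) = 0 ∨ φ (n ν) = 1 := fun φ ν => by
    have h : φ (n ν) * φ (n ν) = φ (n ν) := by rw [← map_mul, hn]
    rcases eq_or_ne (φ (n ν)) 0 with h0 | h0
    · exact Or.inl h0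
    · exact Or.inr (mul_right_cancel₀ h0 (by rw [h, one_mul]))
  -- A character takes the value 0 or 1 on each projection: it is a joint outcome, and the law is
  -- the image of the representing measure.
  let T : WeakDual.characterSpace ℂ S → Set ℤ := fun φ => {ν | φ (n ν) = 1}
  have hcont : ∀ b : S, Continuous fun φ : WeakDual.characterSpace ℂ S => φ b := fun b =>
    map_continuous (WeakDual.gelfandTransform ℂ S b)
  have hT : Measurable T := measurable_set_iff.mpr fun ν =>
    measurableSet_setOfPred.mp (isClosed_singleton.preimage (hcont (n ν))).measurableSet
  refine ⟨⟨μ.map T, Measure.isProbabilityMeasure_map hT.aemeasurable⟩, fun k ν => ?_⟩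
  let f : C(WeakDual.characterSpace ℂ S, ℝ) := ⟨fun φ => ∏ i, (φ (n (ν i))).re,
    continuous_finsetProd _ fun i _ => Complex.continuous_re.comp (hcont _)⟩
  have hf : ∀ φ : WeakDual.characterSpace ℂ S,
      φ (List.ofFn fun i => n (ν i)).prod = (f φ : ℂ) := fun φ => by
    rw [map_list_prod, List.map_ofFn, List.prod_ofFn]
    simp only [f, ContinuousMap.coe_mk, Complex.ofReal_prod, Function.comp_apply]
    refine Finset.prod_congr rfl fun i _ => ?_
    rcases h01 φ (ν i) with h | h <;> simp [h]
  have hprod : expectProd ω N ν = ω ((List.ofFn fun i => n (ν i)).prod : S) := by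
    rw [expectProd]
    congr 1
    have := map_list_prod S.subtype (List.ofFn fun i => n (ν i))
    rw [List.map_ofFn] at this
    exact this.symm
  have hind : ∀ φ, f φ = (T ⁻¹' {S | ∀ i, ν i ∈ S}).indicator
      (1 : WeakDual.characterSpace ℂ S → ℝ) φ := fun φ => by
    by_cases h : ∀ i, φ (n (ν i)) = 1
    · rw [Set.indicator_of_mem (show φ ∈ T ⁻¹' {S | ∀ i, ν i ∈ S} from h)]
      simp [f, h]
    · rw [Set.indicator_of_notMem (show φ ∉ T ⁻¹' {S | ∀ i, ν i ∈ S} from h)]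
      obtain ⟨i, hi⟩ := not_forall.mp h
      exact Finset.prod_eq_zero (Finset.mem_univ i) (by simp [(h01 φ (ν i)).resolve_right hi])
  have hreal : ∫ φ, f φ ∂μ = (μ.map T).real {S | ∀ i, ν i ∈ S} := by
    rw [integral_congr_ae (Eventually.of_forall hind),
      integral_indicator_one (hT (measurableSet_forall_mem ν)),
      map_measureReal_apply hT (measurableSet_forall_mem ν)]
  rw [hprod]
  exact (hint _ f hf).trans (congrArg _ hreal)

end JointLaw

/-! ### Criteria for weak convergence -/

section CubeConvergence

/-- Weak convergence on a countable power of the unit interval follows from convergence of the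
integrals of monomials. -/
theorem tendsto_of_forall_monomial {D : Type*} [Countable D] {γ : Type*} {L : Filter γ}
    {μs : γ → ProbabilityMeasure (D → unitInterval)} {μ : ProbabilityMeasure (D → unitInterval)}
    (h : ∀ f ∈ Submonoid.closure (range fun d : D =>
      (⟨fun x => (x d : ℝ), by fun_prop⟩ : C(D → unitInterval, ℝ))),
      Tendsto (fun i => ∫ x, f x ∂(μs i : Measure (D → unitInterval))) L
        (𝓝 (∫ x, f x ∂(μ : Measure (D → unitInterval))))) :
    Tendsto μs L (𝓝 μ) := by
  set coord : D → C(D → unitInterval, ℝ) := fun d => ⟨fun x => (x d : ℝ), by fun_prop⟩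
  have hint : ∀ (ρ : ProbabilityMeasure (D → unitInterval)) (f : C(D → unitInterval, ℝ)),
      Integrable f (ρ : Measure (D → unitInterval)) := fun ρ f =>
    (BoundedContinuousFunction.mkOfCompact f).integrable _
  have hadj : ∀ f ∈ Algebra.adjoin ℝ (range coord),
      Tendsto (fun i => ∫ x, f x ∂(μs i : Measure (D → unitInterval))) L
        (𝓝 (∫ x, f x ∂(μ : Measure (D → unitInterval)))) := by
    intro f hf
    -- The polynomial algebra is the linear span of the monomials; Stone–Weierstrass then passes to
    -- all continuous functions.
    rw [← Subalgebra.mem_toSubmodule, Algebra.adjoin_eq_span] at hf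
    induction hf using Submodule.span_induction with
    | mem f hf => exact h f hf
    | zero => simpa using tendsto_const_nhds
    | add f g _ _ hf hg =>
      simp only [ContinuousMap.add_apply]
      simp_rw [fun ρ : ProbabilityMeasure (D → unitInterval) =>
        integral_add (hint ρ f) (hint ρ g)]
      exact hf.add hg
    | smul c f _ hf =>
      simp only [ContinuousMap.smul_apply, smul_eq_mul, integral_const_mul]
      exact hf.const_mul c
  have hsep : (Algebra.adjoin ℝ (range coord)).SeparatesPoints := by
    intro x y hxy
    obtain ⟨d, hd⟩ := Function.ne_iff.mp hxy
    exact ⟨coord d, ⟨coord d, Algebra.subset_adjoin (mem_range_self d), rfl⟩,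
      fun h => hd (Subtype.ext h)⟩
  have hdense := ContinuousMap.subalgebra_topologicalClosure_eq_top_of_separatesPoints _ hsep
  rw [ProbabilityMeasure.tendsto_iff_forall_integral_tendsto]
  intro f
  have hf : f.toContinuousMap ∈ (Algebra.adjoin ℝ (range coord)).topologicalClosure := by
    rw [hdense]; trivial
  rw [← SetLike.mem_coe, Subalgebra.topologicalClosure_coe, Metric.mem_closure_iff] at hf
  rw [Metric.tendsto_nhds]
  intro ε hε
  obtain ⟨g, hg, hfg⟩ := hf (ε / 3) (by linarith)
  have hclose : ∀ ρ : ProbabilityMeasure (D → unitInterval),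
      |∫ x, f x ∂(ρ : Measure (D → unitInterval)) -
        ∫ x, g x ∂(ρ : Measure (D → unitInterval))| ≤ ε / 3 := fun ρ => by
    rw [← integral_sub (f.integrable _) (hint ρ g)]
    have hn : ∀ x, ‖f x - g x‖ ≤ ε / 3 := fun x => by
      rw [dist_eq_norm] at hfg
      exact ((f.toContinuousMap - g).norm_coe_le_norm x).trans hfg.le
    have := norm_integral_le_of_norm_le_const (μ := (ρ : Measure (D → unitInterval)))
      (Eventually.of_forall hn)
    rwa [probReal_univ, mul_one] at this
  filter_upwards [Metric.tendsto_nhds.mp (hadj g hg) (ε / 3) (by linarith)] with i hi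
  rw [Real.dist_eq] at hi ⊢
  have h1 := abs_le.mp (hclose (μs i))
  have h2 := abs_le.mp (hclose μ)
  have h3 := abs_lt.mp hi
  rw [abs_lt]
  constructor <;> linarith [h1.1, h1.2, h2.1, h2.2, h3.1, h3.2]

/-- Weak convergence can be tested after an inducing map into a metrizable space. -/
theorem tendsto_of_isInducing {Y Z γ : Type*} [TopologicalSpace Y] [MeasurableSpace Y]
    [BorelSpace Y] [TopologicalSpace Z] [MeasurableSpace Z] [OpensMeasurableSpace Z]
    [HasOuterApproxClosed Z] {L : Filter γ} [L.IsCountablyGenerated] {e : Y → Z}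
    (he : IsInducing e) (hem : Measurable e) {μs : γ → ProbabilityMeasure Y}
    {μ : ProbabilityMeasure Y}
    (h : Tendsto (fun i => (μs i).map hem.aemeasurable) L (𝓝 (μ.map hem.aemeasurable))) :
    Tendsto μs L (𝓝 μ) := by
  -- The portmanteau criterion transfers because every open set of the source is the preimage of one
  -- of the target.
  refine tendsto_of_forall_isOpen_le_liminf' fun G hG => ?_
  obtain ⟨V, hV, rfl⟩ := he.isOpen_iff.mp hG
  have := ProbabilityMeasure.le_liminf_measure_open_of_tendsto h hV
  simpa only [ProbabilityMeasure.toMeasure_map, Measure.map_apply hem hV.measurableSet] using this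

end CubeConvergence

namespace PointConfig

/-! ### Linear statistics of configurations -/

section Pairing

/-- The sum `∑_{x ∈ X} f x`, as an integral. -/
def pairing (X : PointConfig) (f : C_c(ℝ, ℝ)) : ℝ := ∫ x, f x ∂X.toMeasure

theorem continuous_pairing (f : C_c(ℝ, ℝ)) : Continuous fun X : PointConfig => X.pairing f :=
  (continuous_apply f).comp (continuous_induced_dom
    (f := fun (X : PointConfig) (f : C_c(ℝ, ℝ)) => ∫ x, f x ∂X.toMeasure))

/-- The finitely many points in a compact set. -/
def pointsIn (X : PointConfig) {K : Set ℝ} (hK : IsCompact K) : Finset ℝ :=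
  (X.locallyFinite K hK).toFinset

theorem mem_pointsIn {X : PointConfig} {K : Set ℝ} {hK : IsCompact K} {x : ℝ} :
    x ∈ X.pointsIn hK ↔ x ∈ X.carrier ∧ x ∈ K := by
  simp [pointsIn]

theorem toMeasure_restrict (X : PointConfig) {K : Set ℝ} (hK : IsCompact K) :
    X.toMeasure.restrict K = ∑ x ∈ X.pointsIn hK, Measure.dirac x := by
  ext B hB
  rw [Measure.restrict_apply hB, toMeasure, Measure.sum_apply _ (hB.inter hK.measurableSet),
    Measure.finsetSum_apply]
  rw [tsum_subtype X.carrier fun x => Measure.dirac x (B ∩ K), tsum_eq_sum (s := X.pointsIn hK)]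
  · refine Finset.sum_congr rfl fun x hx => ?_
    obtain ⟨hX, hxK⟩ := mem_pointsIn.mp hx
    rw [Set.indicator_of_mem hX, Measure.dirac_apply' _ (hB.inter hK.measurableSet),
      Measure.dirac_apply' _ hB]
    by_cases hxB : x ∈ B <;> simp [hxB, hxK]
  · intro x hx
    by_cases hX : x ∈ X.carrier
    · have hxK : x ∉ K := fun h => hx (mem_pointsIn.mpr ⟨hX, h⟩)
      rw [Set.indicator_of_mem hX, Measure.dirac_apply' _ (hB.inter hK.measurableSet)]
      simp [hxK]
    · simp [hX]

theorem pairing_eq_sum (X : PointConfig) (f : C_c(ℝ, ℝ)) {K : Set ℝ} (hK : IsCompact K)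
    (hf : ∀ x ∉ K, f x = 0) : X.pairing f = ∑ x ∈ X.pointsIn hK, f x := by
  rw [pairing, ← setIntegral_eq_integral_of_forall_compl_eq_zero hf, X.toMeasure_restrict hK,
    integral_finsetSum_measure]
  · simp
  · exact fun x _ => integrable_dirac (by simp)

theorem exists_compact_support (f : C_c(ℝ, ℝ)) :
    ∃ R : ℕ, ∀ x, (R : ℝ) < |x| → f x = 0 := by
  obtain ⟨r, hr⟩ := f.hasCompactSupport.isCompact.isBounded.exists_norm_le
  obtain ⟨R, hR⟩ := exists_nat_ge r
  refine ⟨R, fun x hx => by_contra fun hne => ?_⟩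
  have := hr x (subset_tsupport _ hne)
  rw [Real.norm_eq_abs] at this
  linarith

theorem exists_common_compact (f g : C_c(ℝ, ℝ)) :
    ∃ K : Set ℝ, IsCompact K ∧ (∀ x ∉ K, f x = 0) ∧ ∀ x ∉ K, g x = 0 :=
  ⟨tsupport f ∪ tsupport g, f.hasCompactSupport.isCompact.union g.hasCompactSupport.isCompact,
    fun _ hx => image_eq_zero_of_notMem_tsupport fun h => hx (Or.inl h),
    fun _ hx => image_eq_zero_of_notMem_tsupport fun h => hx (Or.inr h)⟩

theorem pairing_add (X : PointConfig) (f g : C_c(ℝ, ℝ)) :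
    X.pairing (f + g) = X.pairing f + X.pairing g := by
  obtain ⟨K, hK, hf, hg⟩ := exists_common_compact f g
  rw [X.pairing_eq_sum f hK hf, X.pairing_eq_sum g hK hg, X.pairing_eq_sum (f + g) hK
    fun x hx => by simp [hf x hx, hg x hx], ← Finset.sum_add_distrib]
  rfl

theorem pairing_zero (X : PointConfig) : X.pairing 0 = 0 := by simp [pairing]

theorem pairing_nonneg (X : PointConfig) {f : C_c(ℝ, ℝ)} (hf : ∀ x, 0 ≤ f x) : 0 ≤ X.pairing f :=
  integral_nonneg hf

theorem abs_pairing_sub_le (X : PointConfig) {f g χ : C_c(ℝ, ℝ)} {δ : ℝ}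
    (h : ∀ x, |f x - g x| ≤ δ * χ x) : |X.pairing f - X.pairing g| ≤ δ * X.pairing χ := by
  obtain ⟨K, hK, hf, hg⟩ := exists_common_compact f (g + χ)
  obtain ⟨K', hK', hg', hχ⟩ := exists_common_compact g χ
  have hKK := hK.union hK'
  rw [X.pairing_eq_sum f hKK fun x hx => hf x fun h => hx (Or.inl h),
    X.pairing_eq_sum g hKK fun x hx => hg' x fun h => hx (Or.inr h),
    X.pairing_eq_sum χ hKK fun x hx => hχ x fun h => hx (Or.inr h), ← Finset.sum_sub_distrib,
    Finset.mul_sum]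
  exact (Finset.abs_sum_le_sum_abs _ _).trans (Finset.sum_le_sum fun x _ => h x)

end Pairing

/-! ### Countably many test functions and Laplace functionals -/

section TestFunctions

/-- The plateau function equal to `1` on `[-n, n]` and to `0` off `[-n-1, n+1]`. -/
def plateau (n : ℕ) (x : ℝ) : ℝ := max 0 (min 1 (n + 1 - |x|))

@[fun_prop]
theorem continuous_plateau (n : ℕ) : Continuous (plateau n) := by unfold plateau; fun_prop

theorem plateau_nonneg (n : ℕ) (x : ℝ) : 0 ≤ plateau n x := le_max_left _ _

theorem plateau_eq_one {n : ℕ} {x : ℝ} (hx : |x| ≤ n) : plateau n x = 1 := by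
  rw [plateau, min_eq_left (by linarith), max_eq_right zero_le_one]

theorem plateau_eq_zero {n : ℕ} {x : ℝ} (hx : (n : ℝ) + 1 < |x|) : plateau n x = 0 := by
  rw [plateau, max_eq_left]
  exact (min_le_right _ _).trans (by linarith)

/-- A continuous function, cut off by a plateau. -/
def cutoff (p : ℝ → ℝ) (hp : Continuous p) (n : ℕ) : C_c(ℝ, ℝ) where
  toFun x := p x * plateau n x
  continuous_toFun := by fun_prop
  hasCompactSupport' := HasCompactSupport.intro (isCompact_Icc (a := -((n : ℝ) + 1)) (b := n + 1))
    fun x hx => by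
      have : (n : ℝ) + 1 < |x| := by
        by_contra h
        exact hx (abs_le.mp (not_lt.mp h))
      simp [plateau_eq_zero this]

/-- A countable family of nonnegative test functions that generates the vague topology. -/
def testFun : ℕ × (Option (ℕ × Bool)) → C_c(ℝ, ℝ)
  | (n, none) => cutoff (fun _ => 1) continuous_const n
  | (n, some (j, true)) => cutoff (fun x => max (TopologicalSpace.denseSeq C(ℝ, ℝ) j x) 0)
      (by fun_prop) n
  | (n, some (j, false)) => cutoff (fun x => max (-TopologicalSpace.denseSeq C(ℝ, ℝ) j x) 0)
      (by fun_prop) n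

theorem testFun_nonneg (d : ℕ × Option (ℕ × Bool)) (x : ℝ) : 0 ≤ testFun d x := by
  obtain ⟨n, _ | ⟨j, _ | _⟩⟩ := d
  · exact mul_nonneg zero_le_one (plateau_nonneg n x)
  · exact mul_nonneg (le_max_right _ _) (plateau_nonneg n x)
  · exact mul_nonneg (le_max_right _ _) (plateau_nonneg n x)

/-- On the support of the plateau χ, f is within δ of some dense-sequence element, so the pairings
differ by at most δ times the pairing with χ. That pairing is locally bounded, χ being itself a test
function. -/
theorem continuous_pairing_of_testFun {Z : Type*} [TopologicalSpace Z] {e : Z → PointConfig}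
    (he : ∀ d, Continuous fun z => (e z).pairing (testFun d)) (f : C_c(ℝ, ℝ)) :
    Continuous fun z => (e z).pairing f := by
  rw [continuous_iff_continuousAt]
  intro z₀
  rw [ContinuousAt, Metric.tendsto_nhds]
  intro ε hε
  obtain ⟨n, hn⟩ := exists_compact_support f
  set χ := testFun (n, none) with hχ
  have hχval : ∀ x, χ x = plateau n x := fun x => one_mul _
  set M := (e z₀).pairing χ with hM
  have hM0 : 0 ≤ M := (e z₀).pairing_nonneg (testFun_nonneg _)
  -- Near z₀ the pairing with χ stays below M + 1, so each approximation error is at most ε/4.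
  set δ := ε / (4 * (M + 1)) with hδ
  have hδ0 : 0 < δ := by positivity
  have hδM : δ * (M + 1) = ε / 4 := by rw [hδ]; field_simp
  have hopen : IsOpen {g : C(ℝ, ℝ) | MapsTo (g - f.toContinuousMap) (Icc (-((n : ℝ) + 1)) (n + 1))
      (Metric.ball 0 δ)} :=
    (ContinuousMap.isOpen_setOfPred_mapsTo isCompact_Icc Metric.isOpen_ball).preimage
      (continuous_id.sub continuous_const)
  obtain ⟨j, hj⟩ := (TopologicalSpace.denseRange_denseSeq C(ℝ, ℝ)).exists_mem_open hopen
    ⟨f.toContinuousMap, fun x _ => by simp [hδ0]⟩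
  set q := TopologicalSpace.denseSeq C(ℝ, ℝ) j with hq
  set P := testFun (n, some (j, true)) with hP
  set N := testFun (n, some (j, false)) with hN
  have hbound : ∀ x, |f x - (P + -N) x| ≤ δ * χ x := by
    intro x
    have hPN : (P + -N) x = q x * plateau n x := by
      have h1 : (P + -N) x = max (q x) 0 * plateau n x - max (-q x) 0 * plateau n x := by
        rw [sub_eq_add_neg]; rfl
      rw [h1, ← sub_mul]
      congr 1
      rcases le_total 0 (q x) with h | h
      · rw [max_eq_left h, max_eq_right (by linarith)]; ring
      · rw [max_eq_right h, max_eq_left (by linarith)]; ring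
    have hf : f x = f x * plateau n x := by
      rcases le_or_gt |x| n with h | h
      · rw [plateau_eq_one h, mul_one]
      · rw [hn x h, zero_mul]
    rw [hPN, hf, hχval, ← sub_mul, abs_mul, abs_of_nonneg (plateau_nonneg n x)]
    rcases le_or_gt |x| (n + 1) with h | h
    · refine mul_le_mul_of_nonneg_right ?_ (plateau_nonneg n x)
      have := hj (abs_le.mp h)
      rw [mem_ball_zero_iff] at this
      rw [abs_sub_comm]
      exact this.le
    · rw [plateau_eq_zero h]; simp
  have hdiff : ∀ z, (e z).pairing (P + -N) = (e z).pairing P - (e z).pairing N := fun z => by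
    rw [pairing_add, sub_eq_add_neg]
    congr 1
    simp [pairing, integral_neg]
  have hcont : Tendsto (fun z => (e z).pairing (P + -N)) (𝓝 z₀) (𝓝 ((e z₀).pairing (P + -N))) := by
    simp only [hdiff]
    exact ((he _).sub (he _)).tendsto z₀
  filter_upwards [Metric.tendsto_nhds.mp hcont (ε / 4) (by linarith),
    ((he (n, none)).tendsto z₀).eventually_lt_const (lt_add_one M)] with z hz1 hz2
  have h1 := abs_le.mp ((e z).abs_pairing_sub_le hbound)
  have h2 := abs_le.mp ((e z₀).abs_pairing_sub_le hbound)
  rw [Real.dist_eq] at hz1 ⊢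
  have h3 := abs_lt.mp hz1
  have h4 : δ * (e z).pairing χ ≤ ε / 4 := by
    rw [← hδM]; exact mul_le_mul_of_nonneg_left hz2.le hδ0.le
  have h5 : δ * (e z₀).pairing χ ≤ ε / 4 := by
    rw [← hδM]; exact mul_le_mul_of_nonneg_left (by linarith) hδ0.le
  rw [abs_lt]
  constructor <;> linarith [h1.1, h1.2, h2.1, h2.2, h3.1, h3.2]

/-- The Laplace coordinates `exp (-∑_{x ∈ X} f x)` along the countable test family. -/
def laplaceCoord (X : PointConfig) (d : ℕ × Option (ℕ × Bool)) : unitInterval :=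
  ⟨Real.exp (-X.pairing (testFun d)), (Real.exp_pos _).le,
    Real.exp_le_one_iff.mpr (neg_nonpos.mpr (X.pairing_nonneg (testFun_nonneg d)))⟩

theorem continuous_laplaceCoord : Continuous laplaceCoord :=
  continuous_pi fun d => Continuous.subtype_mk
    (Real.continuous_exp.comp (continuous_pairing (testFun d)).neg) _

/-- The pairings with the test family are recovered as -log of the coordinates, and they control all
other pairings. -/
theorem isInducing_laplaceCoord : IsInducing laplaceCoord := by
  refine ⟨le_antisymm continuous_laplaceCoord.le_induced ?_⟩
  let τ := TopologicalSpace.induced laplaceCoord inferInstance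
  have hτ : @Continuous _ _ τ _ laplaceCoord := continuous_induced_dom
  have hd : ∀ d, @Continuous _ _ τ _ fun X : PointConfig => X.pairing (testFun d) := fun d => by
    have h1 : @Continuous _ _ τ _ fun X : PointConfig => (laplaceCoord X d : ℝ) :=
      @Continuous.comp _ _ _ τ _ _ _ (fun p : ℕ × Option (ℕ × Bool) → unitInterval => (p d : ℝ))
        (by fun_prop) hτ
    have h2 : @Continuous _ _ τ _ fun X : PointConfig => -Real.log (laplaceCoord X d : ℝ) :=
      @Continuous.comp _ _ _ τ _ _ _ _ continuous_neg
        (@Continuous.log _ τ _ h1 fun X => (Real.exp_pos _).ne')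
    convert h2 using 2 with X
    simp [laplaceCoord]
  have hall : ∀ f, @Continuous _ _ τ _ fun X : PointConfig => X.pairing f := fun f =>
    @continuous_pairing_of_testFun PointConfig τ id hd f
  exact continuous_iff_le_induced.mp (@continuous_pi _ _ _ τ _ _ hall)

/-- Convergence of Laplace functionals implies weak convergence of point processes. -/
theorem tendsto_of_laplace {γ : Type*} {L : Filter γ} [L.IsCountablyGenerated]
    {μs : γ → ProbabilityMeasure PointConfig} {μ : ProbabilityMeasure PointConfig}
    (h : ∀ f : C_c(ℝ, ℝ), (∀ x, 0 ≤ f x) →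
      Tendsto (fun i => ∫ X : PointConfig, Real.exp (-X.pairing f) ∂(μs i : Measure PointConfig)) L
        (𝓝 (∫ X : PointConfig, Real.exp (-X.pairing f) ∂(μ : Measure PointConfig)))) :
    Tendsto μs L (𝓝 μ) := by
  have hm : Measurable laplaceCoord := continuous_laplaceCoord.measurable
  refine tendsto_of_isInducing isInducing_laplaceCoord hm ?_
  refine tendsto_of_forall_monomial fun F hF => ?_
  -- A monomial in the Laplace coordinates is again a Laplace functional, since products of
  -- exponentials add the test functions.
  have hform : ∃ f : C_c(ℝ, ℝ), (∀ x, 0 ≤ f x) ∧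
      ∀ X : PointConfig, F (laplaceCoord X) = Real.exp (-X.pairing f) := by
    induction hF using Submonoid.closure_induction with
    | mem F hF =>
      obtain ⟨d, rfl⟩ := hF
      exact ⟨testFun d, testFun_nonneg d, fun X => rfl⟩
    | one => exact ⟨0, fun x => le_rfl, fun X => by simp [pairing_zero]⟩
    | mul F G _ _ hF hG =>
      obtain ⟨f, hf0, hf⟩ := hF
      obtain ⟨g, hg0, hg⟩ := hG
      refine ⟨f + g, fun x => add_nonneg (hf0 x) (hg0 x), fun X => ?_⟩
      rw [ContinuousMap.mul_apply, hf, hg, pairing_add, neg_add, Real.exp_add]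
  obtain ⟨f, hf0, hf⟩ := hform
  have hmap : ∀ ρ : ProbabilityMeasure PointConfig,
      ∫ x, F x ∂(ρ.map hm.aemeasurable : Measure (ℕ × Option (ℕ × Bool) → unitInterval)) =
        ∫ X : PointConfig, Real.exp (-X.pairing f) ∂(ρ : Measure PointConfig) := fun ρ => by
    rw [ProbabilityMeasure.toMeasure_map, integral_map hm.aemeasurable
      F.continuous.aestronglyMeasurable]
    simp only [hf]
  simp only [hmap]
  exact h f hf0

end TestFunctions

end PointConfig

/-! ### Truncated inclusion–exclusion -/

section Bonferroni

variable {α : Type*}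

/-- The `k`-th elementary symmetric function of the values `g x`, `x ∈ F`. -/
def elemSymm (F : Finset α) (g : α → ℝ) (k : ℕ) : ℝ := ∑ s ∈ F.powersetCard k, ∏ x ∈ s, g x

theorem elemSymm_nonneg {F : Finset α} {g : α → ℝ} (hg : ∀ x, 0 ≤ g x) (k : ℕ) :
    0 ≤ elemSymm F g k := Finset.sum_nonneg fun _ _ => Finset.prod_nonneg fun x _ => hg x

theorem elemSymm_zero (F : Finset α) (g : α → ℝ) : elemSymm F g 0 = 1 := by simp [elemSymm]

theorem elemSymm_mul_left (F : Finset α) (g : α → ℝ) (t : ℝ) (k : ℕ) :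
    elemSymm F (fun x => t * g x) k = t ^ k * elemSymm F g k := by
  rw [elemSymm, elemSymm, Finset.mul_sum]
  refine Finset.sum_congr rfl fun s hs => ?_
  rw [Finset.prod_mul_distrib, Finset.prod_const, (Finset.mem_powersetCard.mp hs).2]

theorem elemSymm_insert [DecidableEq α] {F : Finset α} {a : α} (ha : a ∉ F) (g : α → ℝ) (k : ℕ) :
    elemSymm (insert a F) g (k + 1) = elemSymm F g (k + 1) + g a * elemSymm F g k := by
  rw [elemSymm, Finset.powersetCard_succ_insert ha, Finset.sum_union, elemSymm, elemSymm,
    Finset.mul_sum]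
  · congr 1
    rw [Finset.sum_image]
    · refine Finset.sum_congr rfl fun s hs => ?_
      rw [Finset.prod_insert fun h => ha ((Finset.mem_powersetCard.mp hs).1 h)]
    · intro s hs t ht hst
      have hs' : a ∉ s := fun h => ha ((Finset.mem_powersetCard.mp hs).1 h)
      have ht' : a ∉ t := fun h => ha ((Finset.mem_powersetCard.mp ht).1 h)
      rw [← Finset.erase_insert hs', ← Finset.erase_insert ht', hst]
  · rw [Finset.disjoint_left]
    intro s hs hs'
    obtain ⟨t, -, rfl⟩ := Finset.mem_image.mp hs'
    exact ha ((Finset.mem_powersetCard.mp hs).1 (Finset.mem_insert_self a t))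

/-- The signed remainder of the truncated inclusion–exclusion expansion. -/
def bonferroniRem (F : Finset α) (g : α → ℝ) (n : ℕ) : ℝ :=
  (-1) ^ n * (∏ x ∈ F, (1 - g x) - ∑ k ∈ Finset.range n, (-1) ^ k * elemSymm F g k)

/-- The signed remainder and the elementary symmetric functions obey the same recursion; for g ≥ 0
its coefficients are nonnegative, so induction preserves both inequalities. -/
theorem bonferroniRem_insert [DecidableEq α] {F : Finset α} {a : α} (ha : a ∉ F) (g : α → ℝ)
    (n : ℕ) : bonferroniRem (insert a F) g (n + 1) =
      bonferroniRem F g (n + 1) + g a * bonferroniRem F g n := by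
  simp only [bonferroniRem, Finset.prod_insert ha, Finset.sum_range_succ', elemSymm_zero,
    elemSymm_insert ha, pow_zero, mul_add, Finset.sum_add_distrib]
  have : ∑ k ∈ Finset.range n, (-1 : ℝ) ^ (k + 1) * (g a * elemSymm F g k) =
      -(g a * ∑ k ∈ Finset.range n, (-1) ^ k * elemSymm F g k) := by
    rw [Finset.mul_sum, ← Finset.sum_neg_distrib]
    exact Finset.sum_congr rfl fun k _ => by ring
  rw [this]
  ring

/-- The Bonferroni inequalities. -/
theorem bonferroniRem_mem_Icc (F : Finset α) {g : α → ℝ} (h0 : ∀ x, 0 ≤ g x) (h1 : ∀ x, g x ≤ 1)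
    (n : ℕ) : 0 ≤ bonferroniRem F g n ∧ bonferroniRem F g n ≤ elemSymm F g n := by
  classical
  induction F using Finset.induction_on generalizing n with
  | empty =>
    cases n with
    | zero => simp [bonferroniRem, elemSymm]
    | succ n =>
      have he : ∀ k, elemSymm (∅ : Finset α) g (k + 1) = 0 := fun k => by
        rw [elemSymm, Finset.powersetCard_eq_empty.mpr (by simp), Finset.sum_empty]
      simp [bonferroniRem, Finset.sum_range_succ', he, elemSymm_zero]
  | insert a F ha ih =>
    cases n with
    | zero =>
      simp only [bonferroniRem, pow_zero, Finset.range_zero, Finset.sum_empty, sub_zero, one_mul,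
        elemSymm_zero]
      exact ⟨Finset.prod_nonneg fun x _ => sub_nonneg.mpr (h1 x),
        Finset.prod_le_one (fun x _ => sub_nonneg.mpr (h1 x)) fun x _ => by linarith [h0 x]⟩
    | succ n =>
      rw [bonferroniRem_insert ha, elemSymm_insert ha]
      exact ⟨add_nonneg (ih _).1 (mul_nonneg (h0 a) (ih n).1),
        add_le_add (ih _).2 (mul_le_mul_of_nonneg_left (ih n).2 (h0 a))⟩

theorem abs_prod_sub_le (F : Finset α) {g : α → ℝ} (h0 : ∀ x, 0 ≤ g x) (h1 : ∀ x, g x ≤ 1)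
    (n : ℕ) : |∏ x ∈ F, (1 - g x) - ∑ k ∈ Finset.range n, (-1) ^ k * elemSymm F g k| ≤
      elemSymm F g n := by
  obtain ⟨hl, hu⟩ := bonferroniRem_mem_Icc F h0 h1 n
  have : |bonferroniRem F g n| =
      |∏ x ∈ F, (1 - g x) - ∑ k ∈ Finset.range n, (-1) ^ k * elemSymm F g k| := by
    rw [bonferroniRem, abs_mul, abs_pow, abs_neg, abs_one, one_pow, one_mul]
  rw [← this, abs_of_nonneg hl]
  exact hu

open Classical in
/-- Summing over ordered tuples of distinct points. -/
theorem sum_injective_eq (F : Finset α) (g : α → ℝ) (k : ℕ) :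
    ∑ y ∈ Fintype.piFinset (fun _ : Fin k => F) with Function.Injective y, ∏ i, g (y i) =
      k.factorial * elemSymm F g k := by
  have hmaps : ∀ y ∈ (Fintype.piFinset (fun _ : Fin k => F)).filter fun y => Function.Injective y,
      Finset.univ.image y ∈ F.powersetCard k := fun y hy => by
    rw [Finset.mem_filter, Fintype.mem_piFinset] at hy
    rw [Finset.mem_powersetCard, Finset.card_image_of_injective _ hy.2]
    refine ⟨fun x hx => ?_, by simp⟩
    obtain ⟨i, -, rfl⟩ := Finset.mem_image.mp hx
    exact hy.1 i
  rw [← Finset.sum_fiberwise_of_maps_to hmaps, elemSymm, Finset.mul_sum]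
  refine Finset.sum_congr rfl fun s hs => ?_
  obtain ⟨hsF, hsk⟩ := Finset.mem_powersetCard.mp hs
  -- Each k-subset is the image of exactly k! injective tuples, one for each embedding of `Fin k`.
  have hfib : {y ∈ {y ∈ Fintype.piFinset (fun _ : Fin k => F) | Function.Injective y} |
      Finset.univ.image y = s} =
        (Finset.univ : Finset (Fin k ↪ s)).image fun e i => (e i : α) := by
    ext y
    simp only [Finset.mem_filter, Fintype.mem_piFinset, Finset.mem_image, Finset.mem_univ, true_and]
    constructor
    · rintro ⟨⟨-, hinj⟩, rfl⟩
      exact ⟨⟨fun i => ⟨y i, Finset.mem_image_of_mem _ (Finset.mem_univ i)⟩,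
        fun i j h => hinj (congrArg Subtype.val h)⟩, rfl⟩
    · rintro ⟨e, rfl⟩
      have hinj : Function.Injective fun i => (e i : α) :=
        Subtype.val_injective.comp e.injective
      refine ⟨⟨fun i => hsF (e i).2, hinj⟩, Finset.eq_of_subset_of_card_le ?_ ?_⟩
      · intro x hx
        obtain ⟨i, -, rfl⟩ := Finset.mem_image.mp hx
        exact (e i).2
      · rw [Finset.card_image_of_injective _ hinj, hsk]; simp
  have hcard : ({y ∈ {y ∈ Fintype.piFinset (fun _ : Fin k => F) | Function.Injective y} |
      Finset.univ.image y = s}).card = k.factorial := by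
    rw [hfib, Finset.card_image_of_injective]
    · rw [Finset.card_univ, Fintype.card_embedding_eq, Fintype.card_coe, Fintype.card_fin, hsk,
        Nat.descFactorial_self]
    · intro e e' h
      ext i
      exact congrFun h i
  rw [← hcard, ← nsmul_eq_mul, ← Finset.sum_const]
  refine Finset.sum_congr rfl fun y hy => ?_
  simp only [Finset.mem_filter] at hy
  rw [← hy.2, Finset.prod_image fun i _ j _ h => hy.1.2 h]

end Bonferroni

namespace PointConfig

/-! ### Symmetric functions of a configuration -/

section Moments

/-- The `k`-th elementary symmetric function of a compactly supported function on a
configuration. -/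
def symm (X : PointConfig) (g : C_c(ℝ, ℝ)) (k : ℕ) : ℝ :=
  elemSymm (X.pointsIn g.hasCompactSupport.isCompact) g k

theorem symm_nonneg (X : PointConfig) {g : C_c(ℝ, ℝ)} (hg : ∀ x, 0 ≤ g x) (k : ℕ) :
    0 ≤ X.symm g k := elemSymm_nonneg hg k

/-- The product `∏_{x ∈ X} (1 - g x)`. -/
def avoid (X : PointConfig) (g : C_c(ℝ, ℝ)) : ℝ :=
  ∏ x ∈ X.pointsIn g.hasCompactSupport.isCompact, (1 - g x)

/-- As g < 1, the product is the Laplace functional of the test function -log(1 - g). -/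
theorem continuous_avoid {g : C_c(ℝ, ℝ)} (hg : ∀ x, g x < 1) :
    Continuous fun X : PointConfig => X.avoid g := by
  have hpos : ∀ x, 0 < 1 - g x := fun x => sub_pos.mpr (hg x)
  let f : C_c(ℝ, ℝ) := ⟨⟨fun x => -Real.log (1 - g x),
    (Continuous.log (by fun_prop) fun x => (hpos x).ne').neg⟩,
    HasCompactSupport.intro g.hasCompactSupport.isCompact fun x hx => by
      simp [image_eq_zero_of_notMem_tsupport hx]⟩
  have : ∀ X : PointConfig, X.avoid g = Real.exp (-X.pairing f) := fun X => by
    rw [X.pairing_eq_sum f g.hasCompactSupport.isCompact fun x hx => by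
      simp [f, image_eq_zero_of_notMem_tsupport hx], ← Finset.sum_neg_distrib, Real.exp_sum, avoid]
    refine Finset.prod_congr rfl fun x _ => ?_
    have : f x = -Real.log (1 - g x) := rfl
    rw [this, neg_neg, Real.exp_log (hpos x)]
  simp only [this]
  exact Real.continuous_exp.comp (continuous_pairing f).neg

/-- The elementary symmetric functions are, up to sign, the Taylor coefficients in t of the
measurable ∏(1 - t g). Subtracting the lower ones, known by induction, and dividing by (-t)^k leaves
an error of at most t times the next one, by Bonferroni. -/
theorem measurable_symm {g : C_c(ℝ, ℝ)} (h0 : ∀ x, 0 ≤ g x) (h1 : ∀ x, g x < 1) (k : ℕ) :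
    Measurable fun X : PointConfig => X.symm g k := by
  induction k using Nat.strong_induction_on with
  | _ k ih =>
    let t : ℕ → ℝ := fun m => 1 / ((m : ℝ) + 1)
    have ht0 : ∀ m, 0 < t m := fun m => Nat.one_div_pos_of_nat
    have ht1 : ∀ m, t m ≤ 1 := fun m => by
      rw [div_le_one (by positivity)]; linarith [(Nat.cast_nonneg m : (0 : ℝ) ≤ m)]
    have hscale0 : ∀ m x, 0 ≤ t m * g x := fun m x => mul_nonneg (ht0 m).le (h0 x)
    have hscale1 : ∀ m x, t m * g x < 1 := fun m x =>
      (mul_le_of_le_one_left (h0 x) (ht1 m)).trans_lt (h1 x)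
    let L : ℕ → PointConfig → ℝ := fun m X =>
      ∏ x ∈ X.pointsIn g.hasCompactSupport.isCompact, (1 - t m * g x)
    have hL : ∀ m, Measurable (L m) := fun m => by
      have hle : ∀ X : PointConfig, L m X = X.avoid (t m • g) := fun X => by
        have hs : (X.pointsIn (t m • g).hasCompactSupport.isCompact) =
            X.pointsIn g.hasCompactSupport.isCompact := by
          ext x
          rw [mem_pointsIn, mem_pointsIn]
          have : tsupport (t m • g : C_c(ℝ, ℝ)) = tsupport g := by
            rw [tsupport, tsupport]
            congr 1
            ext x
            simp [(ht0 m).ne']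
          rw [this]
        rw [avoid, hs]
        rfl
      rw [funext hle]
      exact (continuous_avoid (hscale1 m)).measurable
    have hlim : ∀ X : PointConfig, Tendsto (fun m => (-1) ^ k * ((t m) ^ k)⁻¹ *
        (L m X - ∑ j ∈ Finset.range k, (-1) ^ j * ((t m) ^ j * X.symm g j))) atTop
          (𝓝 (X.symm g k)) := by
      intro X
      have htend : Tendsto (fun m => t m * X.symm g (k + 1)) atTop (𝓝 0) := by
        simpa [t] using tendsto_one_div_add_atTop_nhds_zero_nat.mul_const (X.symm g (k + 1))
      rw [tendsto_iff_norm_sub_tendsto_zero]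
      refine squeeze_zero (fun m => norm_nonneg _) (fun m => ?_) htend
      have hb := abs_prod_sub_le (X.pointsIn g.hasCompactSupport.isCompact) (hscale0 m)
        (fun x => (hscale1 m x).le) (k + 1)
      simp only [elemSymm_mul_left] at hb
      rw [Finset.sum_range_succ] at hb
      have hsq : ((-1 : ℝ) ^ k) * (-1) ^ k = 1 := by rw [← mul_pow]; simp
      have htk : (t m) ^ k ≠ 0 := pow_ne_zero _ (ht0 m).ne'
      have e : (-1) ^ k * ((t m) ^ k)⁻¹ *
          (L m X - ∑ j ∈ Finset.range k, (-1) ^ j * ((t m) ^ j * X.symm g j)) - X.symm g k =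
          (-1) ^ k * ((t m) ^ k)⁻¹ * (L m X - (∑ j ∈ Finset.range k,
            (-1) ^ j * ((t m) ^ j * X.symm g j) + (-1) ^ k * ((t m) ^ k * X.symm g k))) := by
        have : X.symm g k = ((-1 : ℝ) ^ k * (-1) ^ k) * (((t m) ^ k)⁻¹ * (t m) ^ k) *
            X.symm g k := by rw [hsq, inv_mul_cancel₀ htk]; ring
        linear_combination (-1 : ℝ) * this
      rw [e, norm_mul, norm_mul, norm_pow, norm_neg, norm_one, one_pow, one_mul, norm_inv,
        norm_pow, Real.norm_eq_abs, abs_of_pos (ht0 m), Real.norm_eq_abs,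
        inv_mul_le_iff₀ (pow_pos (ht0 m) k)]
      refine hb.trans (le_of_eq ?_)
      rw [pow_succ, mul_assoc]
      rfl
    refine measurable_of_tendsto_metrizable (fun m => ?_) (tendsto_pi_nhds.mpr hlim)
    refine Measurable.const_mul ((hL m).sub ?_) _
    exact Finset.measurable_fun_sum _ fun j hj =>
      ((ih j (Finset.mem_range.mp hj)).const_mul _).const_mul _

/-- Sums over ordered tuples of distinct points of a configuration, as sums over all tuples of
reals. -/
theorem tsum_embedding_eq (X : PointConfig) {k : ℕ} (h : (Fin k → ℝ) → ℝ≥0∞) :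
    ∑' x : Fin k ↪ X.carrier, h (fun i => (x i : ℝ)) =
      ∑' y : Fin k → ℝ, {y | Function.Injective y ∧ ∀ i, y i ∈ X.carrier}.indicator h y := by
  have hinj : Function.Injective fun (x : Fin k ↪ X.carrier) (i : Fin k) => (x i : ℝ) :=
    fun x x' hx => by ext i; exact congrFun hx i
  rw [← hinj.tsum_eq]
  · refine tsum_congr fun x => (Set.indicator_of_mem ?_ h).symm
    exact ⟨Subtype.val_injective.comp x.injective, fun i => (x i).2⟩
  · intro y hy
    have hy' := Set.mem_of_indicator_ne_zero hy
    exact ⟨⟨fun i => ⟨y i, hy'.2 i⟩, fun i j hij => hy'.1 (congrArg Subtype.val hij)⟩, rfl⟩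

theorem tsum_embedding_prod (X : PointConfig) {g : C_c(ℝ, ℝ)} (hg : ∀ x, 0 ≤ g x) (k : ℕ) :
    ∑' x : Fin k ↪ X.carrier, ∏ i, ENNReal.ofReal (g (x i)) =
      ENNReal.ofReal (k.factorial * X.symm g k) := by
  classical
  rw [X.tsum_embedding_eq fun y => ∏ i, ENNReal.ofReal (g (y i)), symm, ← sum_injective_eq,
    ENNReal.ofReal_sum_of_nonneg fun y _ => Finset.prod_nonneg fun i _ => hg _,
    tsum_eq_sum (s := (Fintype.piFinset fun _ : Fin k =>
      X.pointsIn g.hasCompactSupport.isCompact).filter fun y => Function.Injective y)]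
  · refine Finset.sum_congr rfl fun y hy => ?_
    rw [Finset.mem_filter, Fintype.mem_piFinset] at hy
    rw [Set.indicator_of_mem (show y ∈ {y : Fin k → ℝ |
        Function.Injective y ∧ ∀ i, y i ∈ X.carrier} from
        ⟨hy.2, fun i => (mem_pointsIn.mp (hy.1 i)).1⟩),
      ENNReal.ofReal_prod_of_nonneg fun i _ => hg _]
  · intro y hy
    by_cases hmem : Function.Injective y ∧ ∀ i, y i ∈ X.carrier
    · rw [Set.indicator_of_mem (show y ∈ {y : Fin k → ℝ |
        Function.Injective y ∧ ∀ i, y i ∈ X.carrier} from hmem)]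
      have : ∃ i, y i ∉ tsupport g := by
        by_contra! hall
        exact hy (Finset.mem_filter.mpr ⟨Fintype.mem_piFinset.mpr fun i =>
          mem_pointsIn.mpr ⟨hmem.2 i, hall i⟩, hmem.1⟩)
      obtain ⟨i, hi⟩ := this
      exact Finset.prod_eq_zero (Finset.mem_univ i) (by
        rw [image_eq_zero_of_notMem_tsupport hi, ENNReal.ofReal_zero])
    · exact Set.indicator_of_notMem (show y ∉ {y : Fin k → ℝ |
        Function.Injective y ∧ ∀ i, y i ∈ X.carrier} from
        hmem) _

end Moments

end PointConfig

namespace PointConfig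

/-! ### The method of factorial moments -/

section MomentMethod

/-- The `k`-th factorial moment `𝔼 ∑ g (x₁) ⋯ g (x_k)`, over tuples of distinct points. -/
def moment (ρ : Measure PointConfig) (g : C_c(ℝ, ℝ)) (k : ℕ) : ℝ≥0∞ :=
  ∫⁻ X : PointConfig, ∑' x : Fin k ↪ X.carrier, ∏ i, ENNReal.ofReal (g (x i)) ∂ρ

variable {g : C_c(ℝ, ℝ)} (h0 : ∀ x, 0 ≤ g x) (h1 : ∀ x, g x < 1)

include h0 h1

theorem integrable_symm {ρ : Measure PointConfig} {k : ℕ} (hfin : moment ρ g k ≠ ⊤) :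
    Integrable (fun X : PointConfig => X.symm g k) ρ ∧
      ∫ X : PointConfig, X.symm g k ∂ρ = (moment ρ g k).toReal / k.factorial := by
  have hk : (0 : ℝ) < k.factorial := by exact_mod_cast k.factorial_pos
  have hnn : ∀ X : PointConfig, 0 ≤ k.factorial * X.symm g k := fun X =>
    mul_nonneg hk.le (X.symm_nonneg h0 k)
  have hm : Measurable fun X : PointConfig => k.factorial * X.symm g k :=
    (measurable_symm h0 h1 k).const_mul _
  have hM : moment ρ g k = ∫⁻ X : PointConfig, ENNReal.ofReal (k.factorial * X.symm g k) ∂ρ :=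
    lintegral_congr fun X => X.tsum_embedding_prod h0 k
  have hint : Integrable (fun X : PointConfig => k.factorial * X.symm g k) ρ := by
    refine ⟨hm.aestronglyMeasurable, ?_⟩
    rw [hasFiniteIntegral_iff_ofReal (Eventually.of_forall hnn), ← hM]
    exact hfin.lt_top
  have e : (fun X : PointConfig => X.symm g k) =
      fun X => (k.factorial : ℝ)⁻¹ * (k.factorial * X.symm g k) := by
    ext X; rw [inv_mul_cancel_left₀ hk.ne']
  have hI : ∫ X : PointConfig, k.factorial * X.symm g k ∂ρ = (moment ρ g k).toReal := by
    rw [integral_eq_lintegral_of_nonneg_ae (Eventually.of_forall hnn) hm.aestronglyMeasurable, hM]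
  refine ⟨by rw [e]; exact hint.const_mul _, ?_⟩
  rw [eq_div_iff hk.ne', ← hI, integral_const_mul, mul_comm]

theorem avoid_mem_Icc (X : PointConfig) : 0 ≤ X.avoid g ∧ X.avoid g ≤ 1 :=
  ⟨Finset.prod_nonneg fun x _ => sub_nonneg.mpr (h1 x).le,
    Finset.prod_le_one (fun x _ => sub_nonneg.mpr (h1 x).le) fun x _ => by linarith [h0 x]⟩

theorem abs_integral_avoid_sub_le {ρ : Measure PointConfig} [IsProbabilityMeasure ρ] {n : ℕ}
    (hfin : ∀ k ≤ n, moment ρ g k ≠ ⊤) :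
    |∫ X : PointConfig, X.avoid g ∂ρ -
        ∑ k ∈ Finset.range n, (-1) ^ k * ((moment ρ g k).toReal / k.factorial)| ≤
      (moment ρ g n).toReal / n.factorial := by
  have hav : Integrable (fun X : PointConfig => X.avoid g) ρ :=
    Integrable.of_bound (continuous_avoid h1).measurable.aestronglyMeasurable 1
      (Eventually.of_forall fun X => by
        rw [Real.norm_eq_abs, abs_of_nonneg (avoid_mem_Icc h0 h1 X).1]
        exact (avoid_mem_Icc h0 h1 X).2)
  have hs : ∀ k ≤ n, Integrable (fun X : PointConfig => X.symm g k) ρ := fun k hk =>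
    (integrable_symm h0 h1 (hfin k hk)).1
  have hsum : Integrable (fun X : PointConfig =>
      ∑ k ∈ Finset.range n, (-1) ^ k * X.symm g k) ρ :=
    integrable_finsetSum _ fun k hk => (hs k (Finset.mem_range.mp hk).le).const_mul _
  have e : ∑ k ∈ Finset.range n, (-1) ^ k * ((moment ρ g k).toReal / k.factorial) =
      ∫ X : PointConfig, ∑ k ∈ Finset.range n, (-1) ^ k * X.symm g k ∂ρ := by
    rw [integral_finsetSum _ fun k hk => (hs k (Finset.mem_range.mp hk).le).const_mul _]
    refine Finset.sum_congr rfl fun k hk => ?_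
    rw [integral_const_mul, (integrable_symm h0 h1 (hfin k (Finset.mem_range.mp hk).le)).2]
  rw [e, ← integral_sub hav hsum, ← (integrable_symm h0 h1 (hfin n le_rfl)).2,
    ← Real.norm_eq_abs]
  refine norm_integral_le_of_norm_le (hs n le_rfl) (Eventually.of_forall fun X => ?_)
  exact abs_prod_sub_le _ h0 (fun x => (h1 x).le) n

/-- Truncate where the limiting remainder is below ε/4. Convergence of that one moment eventually
bounds the remainder of ρ_i as well, so no moment growth bound uniform in i is needed. -/
theorem tendsto_integral_avoid {I : Type*} {L : Filter I} {ρ : I → Measure PointConfig}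
    [∀ i, IsProbabilityMeasure (ρ i)] {Q : Measure PointConfig} [IsProbabilityMeasure Q]
    (hfin : ∀ k, moment Q g k ≠ ⊤)
    (hconv : ∀ k, Tendsto (fun i => moment (ρ i) g k) L (𝓝 (moment Q g k)))
    (hdecay : Tendsto (fun n : ℕ => (moment Q g n).toReal / n.factorial) atTop (𝓝 0)) :
    Tendsto (fun i => ∫ X : PointConfig, X.avoid g ∂ρ i) L
      (𝓝 (∫ X : PointConfig, X.avoid g ∂Q)) := by
  have hr : ∀ k, Tendsto (fun i => (moment (ρ i) g k).toReal / k.factorial) L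
      (𝓝 ((moment Q g k).toReal / k.factorial)) := fun k =>
    ((ENNReal.tendsto_toReal (hfin k)).comp (hconv k)).div_const _
  rw [Metric.tendsto_nhds]
  intro ε hε
  obtain ⟨n, hn⟩ := (hdecay.eventually_lt_const (show (0 : ℝ) < ε / 4 by linarith)).exists
  have hS : Tendsto (fun i => ∑ k ∈ Finset.range n,
      (-1) ^ k * ((moment (ρ i) g k).toReal / k.factorial)) L
      (𝓝 (∑ k ∈ Finset.range n, (-1) ^ k * ((moment Q g k).toReal / k.factorial))) :=
    tendsto_finsetSum _ fun k _ => (hr k).const_mul _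
  have hfini : ∀ᶠ i in L, ∀ k ∈ Finset.range (n + 1), moment (ρ i) g k ≠ ⊤ := by
    rw [Filter.eventually_all_finset]
    exact fun k _ => (hconv k).eventually_ne (hfin k)
  filter_upwards [hfini, (hr n).eventually_lt_const hn,
    Metric.tendsto_nhds.mp hS (ε / 4) (by linarith)] with i hi hri hSi
  have b1 := abs_integral_avoid_sub_le h0 h1 (ρ := ρ i) (n := n)
    fun k hk => hi k (Finset.mem_range.mpr (by omega))
  have b2 := abs_integral_avoid_sub_le h0 h1 (ρ := Q) (n := n) fun k _ => hfin k
  rw [Real.dist_eq] at hSi ⊢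
  rw [abs_lt] at hSi ⊢
  rw [abs_le] at b1 b2
  constructor <;> linarith [b1.1, b1.2, b2.1, b2.2, hSi.1, hSi.2]

omit h0 h1

/-- `1 - exp (-f)`. -/
def oneSubExp (f : C_c(ℝ, ℝ)) : C_c(ℝ, ℝ) :=
  ⟨⟨fun x => 1 - Real.exp (-f x), by fun_prop⟩,
    HasCompactSupport.intro f.hasCompactSupport.isCompact fun x hx => by
      simp [image_eq_zero_of_notMem_tsupport hx]⟩

theorem oneSubExp_apply (f : C_c(ℝ, ℝ)) (x : ℝ) : oneSubExp f x = 1 - Real.exp (-f x) := rfl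

theorem avoid_oneSubExp (X : PointConfig) (f : C_c(ℝ, ℝ)) :
    X.avoid (oneSubExp f) = Real.exp (-X.pairing f) := by
  rw [X.pairing_eq_sum f (oneSubExp f).hasCompactSupport.isCompact fun x hx => by
    have := image_eq_zero_of_notMem_tsupport hx
    rw [oneSubExp_apply, sub_eq_zero, eq_comm, Real.exp_eq_one_iff, neg_eq_zero] at this
    exact this, ← Finset.sum_neg_distrib, Real.exp_sum, avoid]
  exact Finset.prod_congr rfl fun x _ => by rw [oneSubExp_apply, sub_sub_cancel]

/-- The method of moments for point processes: if the factorial moments converge to those of a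
process whose moments grow more slowly than factorially, the processes converge in law. -/
theorem tendsto_of_moment {I : Type*} {L : Filter I} [L.IsCountablyGenerated]
    {ρ : I → ProbabilityMeasure PointConfig} {Q : ProbabilityMeasure PointConfig}
    (h : ∀ g : C_c(ℝ, ℝ), (∀ x, 0 ≤ g x) → (∀ x, g x < 1) →
      (∀ k, moment Q g k ≠ ⊤) ∧
      (∀ k, Tendsto (fun i => moment (ρ i) g k) L (𝓝 (moment Q g k))) ∧
      Tendsto (fun n : ℕ => (moment Q g n).toReal / n.factorial) atTop (𝓝 0)) :
    Tendsto ρ L (𝓝 Q) := by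
  refine tendsto_of_laplace fun f hf => ?_
  have h0 : ∀ x, 0 ≤ oneSubExp f x := fun x => by
    rw [oneSubExp_apply, sub_nonneg, Real.exp_le_one_iff, neg_nonpos]; exact hf x
  have h1 : ∀ x, oneSubExp f x < 1 := fun x => by
    rw [oneSubExp_apply]; linarith [Real.exp_pos (-f x)]
  obtain ⟨hfin, hconv, hdecay⟩ := h _ h0 h1
  simpa only [avoid_oneSubExp] using tendsto_integral_avoid h0 h1 hfin hconv hdecay

end MomentMethod

end PointConfig

/-! ### Airy moments and measurability of configurations -/

section EdgeProcess

open PointConfig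

theorem IsDeterminantal.moment_eq {K : ℝ → ℝ → ℝ} {Q : ProbabilityMeasure PointConfig}
    (hQ : IsDeterminantal K Q) (g : C_c(ℝ, ℝ)) (k : ℕ) :
    moment Q g k = ∫⁻ x : Fin k → ℝ, (∏ i, ENNReal.ofReal (g (x i))) *
      ENNReal.ofReal (Matrix.of fun i j : Fin k => K (x i) (x j)).det :=
  hQ k (fun x => ∏ i, ENNReal.ofReal (g (x i))) (by fun_prop)

/-- On tuples with all coordinates in `[-R, R]`, a constant; zero elsewhere. -/
theorem lintegral_indicator_box (k : ℕ) (R : ℝ) (B : ℝ≥0∞) :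
    ∫⁻ x : Fin k → ℝ, (Set.univ.pi fun _ => Icc (-R) R).indicator (fun _ => B) x =
      B * ENNReal.ofReal (2 * R) ^ k := by
  rw [lintegral_indicator_const (MeasurableSet.univ_pi fun _ => measurableSet_Icc), volume_pi_pi]
  simp [Real.volume_Icc, two_mul]

theorem prod_ofReal_le_one {g : C_c(ℝ, ℝ)} (h1 : ∀ x, g x < 1) {k : ℕ} (x : Fin k → ℝ) :
    ∏ i, ENNReal.ofReal (g (x i)) ≤ 1 :=
  Finset.prod_le_one' fun _ _ => ENNReal.ofReal_le_one.mpr (h1 _).le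

/-- The determinant is at most C^k on the box [-R, R]^k, of volume (2R)^k, that carries the product
of the g's. -/
theorem moment_airy_le {Q : ProbabilityMeasure PointConfig} (hQ : IsDeterminantal airyKernel Q)
    {g : C_c(ℝ, ℝ)} (h1 : ∀ x, g x < 1) :
    ∃ D : ℝ, 0 ≤ D ∧ ∀ k, moment Q g k ≤ ENNReal.ofReal (D ^ k) := by
  obtain ⟨R, hR⟩ := exists_compact_support g
  have hcont : Continuous fun x : ℝ => airyKernel x x := by
    have hd : Continuous fun x : ℝ => (x, x) := by fun_prop
    have h := continuous_airyKernel.comp hd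
    simp only [Function.comp_def] at h
    exact h
  obtain ⟨C, hC'⟩ : ∃ C, ∀ x ∈ Icc (-(R : ℝ)) R, airyKernel x x ≤ C := by
    obtain ⟨C, hC⟩ := (isCompact_Icc (a := -(R : ℝ)) (b := R)).exists_bound_of_continuousOn
      hcont.continuousOn
    exact ⟨C, fun x hx => (le_abs_self _).trans (hC x hx)⟩
  have hC0 : 0 ≤ C := (airyKernel_self_pos 0).le.trans
    (hC' 0 ⟨neg_nonpos.mpr (Nat.cast_nonneg R), Nat.cast_nonneg R⟩)
  have hD : 0 ≤ C * (2 * (R : ℝ)) := by positivity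
  refine ⟨C * (2 * R), hD, fun k => ?_⟩
  rw [hQ.moment_eq, mul_pow, ENNReal.ofReal_mul (by positivity),
    ENNReal.ofReal_pow (p := 2 * (R : ℝ)) (by positivity),
    ← lintegral_indicator_box k R (ENNReal.ofReal (C ^ k))]
  refine lintegral_mono fun x => ?_
  by_cases hx : ∀ i, x i ∈ Icc (-(R : ℝ)) R
  · have hmem : x ∈ Set.univ.pi fun _ : Fin k => Icc (-(R : ℝ)) R := fun i _ => hx i
    rw [Set.indicator_of_mem hmem]
    refine (mul_le_of_le_one_left' (prod_ofReal_le_one h1 x)).trans (ENNReal.ofReal_le_ofReal ?_)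
    exact det_airyKernel_le x fun i => hC' _ (hx i)
  · obtain ⟨i, hi⟩ := not_forall.mp hx
    have : g (x i) = 0 := hR _ (by
      by_contra! h
      exact hi (abs_le.mp h))
    rw [Finset.prod_eq_zero (Finset.mem_univ i) (by rw [this, ENNReal.ofReal_zero]), zero_mul]
    exact zero_le

open Classical in
-- The index set no longer depends on S, which makes measurability in S visible; the existential
-- avoids assuming that sites have distinct positions.
theorem pairing_edgeConfig (A : ℝ) (f : C_c(ℝ, ℝ)) (S : Set ℤ) :
    (edgeConfig A S).pairing f =
      ∑ x ∈ (edgeConfig A univ).pointsIn f.hasCompactSupport.isCompact,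
        if ∃ ν : ℤ, ((ν : ℝ) - A) / kappa A = x ∧ ν ∈ S then f x else 0 := by
  rw [pairing_eq_sum _ f f.hasCompactSupport.isCompact
    fun x hx => image_eq_zero_of_notMem_tsupport hx, ← Finset.sum_filter]
  refine Finset.sum_congr ?_ fun _ _ => rfl
  ext x
  simp only [Finset.mem_filter, mem_pointsIn, edgeConfig, Set.mem_image, Set.mem_univ, true_and]
  constructor
  · rintro ⟨⟨ν, hν, rfl⟩, hx⟩
    exact ⟨⟨⟨ν, rfl⟩, hx⟩, ν, rfl, hν⟩
  · rintro ⟨⟨-, hx⟩, ν, h, hν⟩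
    exact ⟨⟨ν, hν, h⟩, hx⟩

/-- The topology is induced from a countable cube, so the Laplace coordinates generate the Borel
σ-algebra. -/
theorem measurable_pointConfig {X : Type*} [MeasurableSpace X] {c : X → PointConfig}
    (h : ∀ f : C_c(ℝ, ℝ), Measurable fun x => (c x).pairing f) : Measurable c := by
  have hb : (inferInstance : MeasurableSpace PointConfig) =
      MeasurableSpace.comap laplaceCoord inferInstance := by
    rw [BorelSpace.measurable_eq (α := PointConfig), isInducing_laplaceCoord.eq_induced,
      borel_comap, ← BorelSpace.measurable_eq]
  have : @Measurable X PointConfig _ (MeasurableSpace.comap laplaceCoord inferInstance) c :=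
    measurable_comap_iff.mpr (measurable_pi_lambda _ fun d =>
      Measurable.subtype_mk (Real.measurable_exp.comp (h _).neg))
  rw [← hb] at this
  exact this

theorem measurable_edgeConfig (A : ℝ) : Measurable (edgeConfig A) := by
  classical
  refine measurable_pointConfig fun f => ?_
  simp only [pairing_edgeConfig]
  refine Finset.measurable_fun_sum _ fun x _ => Measurable.ite ?_ measurable_const measurable_const
  have : {S : Set ℤ | ∃ ν : ℤ, ((ν : ℝ) - A) / kappa A = x ∧ ν ∈ S} =
      ⋃ ν : ℤ, ⋃ _ : ((ν : ℝ) - A) / kappa A = x, {S : Set ℤ | ∀ _ : Fin 1, ν ∈ S} := by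
    ext S
    simp only [Set.mem_iUnion]
    constructor
    · rintro ⟨ν, h1, h2⟩
      exact ⟨ν, h1, fun _ => h2⟩
    · rintro ⟨ν, h1, h2⟩
      exact ⟨ν, h1, h2 0⟩
  rw [this]
  exact MeasurableSet.iUnion fun ν => MeasurableSet.iUnion fun _ =>
    measurableSet_forall_mem fun _ => ν

end EdgeProcess

/-! ### Convergence of the edge moments -/

section EdgeMoments

open PointConfig

/-- The rescaled position `(ν - A)/κ_A` of a site. -/
def edgePos (A : ℝ) (ν : ℤ) : ℝ := ((ν : ℝ) - A) / kappa A

theorem edgePos_injective {A : ℝ} (hA : 0 < A) : Function.Injective (edgePos A) := by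
  intro x y hxy
  have h := (div_left_inj' (kappa_pos hA).ne').mp hxy
  exact_mod_cast sub_left_injective h

theorem abs_edgePos_edgeIndex_sub_le {A : ℝ} (hA : 0 < A) (s : ℝ) :
    |edgePos A (edgeIndex A s) - s| ≤ (kappa A)⁻¹ := by
  have hκ := kappa_pos hA
  have e : edgePos A (edgeIndex A s) - s =
      ((⌊A + s * kappa A⌋ : ℤ) - (A + s * kappa A)) / kappa A := by
    rw [edgePos, edgeIndex]; field_simp; ring
  rw [e, abs_div, abs_of_pos hκ, div_eq_mul_inv]
  refine mul_le_of_le_one_left (inv_nonneg.mpr hκ.le) ?_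
  rw [abs_le]
  constructor <;> linarith [Int.floor_le (A + s * kappa A), Int.lt_floor_add_one (A + s * kappa A)]

theorem tendsto_edgePos_edgeIndex {X : Type*} {L : Filter X} {A s : X → ℝ}
    (hA : Tendsto A L atTop) {s₀ : ℝ} (hs : Tendsto s L (𝓝 s₀)) :
    Tendsto (fun x => edgePos (A x) (edgeIndex (A x) (s x))) L (𝓝 s₀) := by
  have h : Tendsto (fun x => edgePos (A x) (edgeIndex (A x) (s x)) - s x) L (𝓝 0) := by
    refine squeeze_zero_norm' ?_ (tendsto_kappa_atTop.comp hA).inv_tendsto_atTop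
    filter_upwards [hA.eventually_gt_atTop 0] with x hx
    exact abs_edgePos_edgeIndex_sub_le hx _
  simpa using h.add hs

/-- The `k × k` determinant of the edge kernel. -/
def edgeDet (A : ℝ) {k : ℕ} (ν : Fin k → ℤ) : ℝ :=
  (Matrix.of fun i j => edgeKernel A (ν i) (ν j)).det

theorem edgeDet_eq_zero (A : ℝ) {k : ℕ} {ν : Fin k → ℤ} (hν : ¬Function.Injective ν) :
    edgeDet A ν = 0 := by
  obtain ⟨i, j, hij, hne⟩ := Function.not_injective_iff.mp hν
  exact Matrix.det_zero_of_row_eq hne (by ext l; simp [hij])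

theorem kappa_pow_mul_edgeDet (A : ℝ) {k : ℕ} (ν : Fin k → ℤ) :
    kappa A ^ k * edgeDet A ν =
      (Matrix.of fun i j => kappa A * edgeKernel A (ν i) (ν j)).det := by
  have := Matrix.det_smul (Matrix.of fun i j => edgeKernel A (ν i) (ν j)) (kappa A)
  rw [Fintype.card_fin] at this
  rw [edgeDet, ← this]
  rfl

theorem tendsto_kappa_pow_mul_edgeDet {X : Type*} {L : Filter X} [L.IsCountablyGenerated]
    {A : X → ℝ} (hA : Tendsto A L atTop) {k : ℕ} {s : X → Fin k → ℝ} {s₀ : Fin k → ℝ}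
    (hs : Tendsto s L (𝓝 s₀)) :
    Tendsto (fun x => kappa (A x) ^ k * edgeDet (A x) fun i => edgeIndex (A x) (s x i)) L
      (𝓝 (Matrix.of fun i j => airyKernel (s₀ i) (s₀ j)).det) := by
  simp only [kappa_pow_mul_edgeDet]
  have hdet : Continuous fun M : Matrix (Fin k) (Fin k) ℝ => M.det := by fun_prop
  refine (hdet.tendsto _).comp (tendsto_pi_nhds.mpr fun i => tendsto_pi_nhds.mpr fun j => ?_)
  exact tendsto_kappa_mul_edgeKernel hA
    (tendsto_edgePos_edgeIndex hA (tendsto_pi_nhds.mp hs i))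
    (tendsto_edgePos_edgeIndex hA (tendsto_pi_nhds.mp hs j))

/-- The crude Leibniz bound suffices: it only serves as a dominating constant at fixed k. -/
theorem kappa_pow_mul_edgeDet_le {A : ℝ} (hA : 2 ≤ A) {R : ℝ} {k : ℕ} {ν : Fin k → ℤ}
    (hν : ∀ i, |edgePos A (ν i)| ≤ R) :
    kappa A ^ k * edgeDet A ν ≤ k.factorial * (edgeConst ^ 2 * Real.exp (2 + 2 * R)) ^ k := by
  rw [kappa_pow_mul_edgeDet]
  refine (le_abs_self _).trans ?_
  have h := Matrix.det_le (abv := AbsoluteValue.abs)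
    (A := Matrix.of fun i j => kappa A * edgeKernel A (ν i) (ν j))
    (x := edgeConst ^ 2 * Real.exp (2 + 2 * R)) fun i j => by
      refine (abs_kappa_mul_edgeKernel_le hA (ν i) (ν j)).trans ?_
      gcongr
      have h1 := (abs_le.mp (hν i)).1
      have h2 := (abs_le.mp (hν j)).1
      simp only [edgePos] at h1 h2
      linarith
  rw [Fintype.card_fin, nsmul_eq_mul] at h
  exact h

/-- Tuples of distinct points of `edgeConfig A S` come from tuples of distinct sites in `S`. -/
theorem tsum_embedding_edgeConfig {A : ℝ} (hA : 0 < A) (S : Set ℤ) {k : ℕ}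
    (h : (Fin k → ℝ) → ℝ≥0∞) :
    ∑' x : Fin k ↪ (edgeConfig A S).carrier, h (fun i => (x i : ℝ)) =
      ∑' ν : Fin k → ℤ, {T : Set ℤ | Function.Injective ν ∧ ∀ i, ν i ∈ T}.indicator
        (fun _ => h fun i => edgePos A (ν i)) S := by
  have hinj : Function.Injective fun (ν : Fin k → ℤ) (i : Fin k) => edgePos A (ν i) :=
    fun ν ν' hν => funext fun i => edgePos_injective hA (congrFun hν i)
  rw [tsum_embedding_eq, ← hinj.tsum_eq]
  · refine tsum_congr fun ν => ?_
    have hiff : (Function.Injective (fun i => edgePos A (ν i)) ∧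
        ∀ i, edgePos A (ν i) ∈ (edgeConfig A S).carrier) ↔
        (Function.Injective ν ∧ ∀ i, ν i ∈ S) := by
      refine and_congr ((edgePos_injective hA).of_comp_iff ν) (forall_congr' fun i => ?_)
      exact (edgePos_injective hA).mem_set_image
    by_cases hν : Function.Injective ν ∧ ∀ i, ν i ∈ S
    · rw [Set.indicator_of_mem (show S ∈ {T : Set ℤ | Function.Injective ν ∧ ∀ i, ν i ∈ T} from hν)]
      exact Set.indicator_of_mem (show (fun i => edgePos A (ν i)) ∈ {y : Fin k → ℝ |
        Function.Injective y ∧ ∀ i, y i ∈ (edgeConfig A S).carrier} from hiff.mpr hν) h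
    · rw [Set.indicator_of_notMem
        (show S ∉ {T : Set ℤ | Function.Injective ν ∧ ∀ i, ν i ∈ T} from hν)]
      exact Set.indicator_of_notMem (show (fun i => edgePos A (ν i)) ∉ {y : Fin k → ℝ |
        Function.Injective y ∧ ∀ i, y i ∈ (edgeConfig A S).carrier} from
          fun hm => hν (hiff.mp hm)) h
  · intro y hy
    have hy' := Set.mem_of_indicator_ne_zero hy
    choose ν hν using hy'.2
    exact ⟨ν, funext fun i => (hν i).2⟩

/-- The points that round to a given tuple of sites form a cube of side 1/κ. -/
theorem lintegral_edgeIndex {A : ℝ} (hA : 0 < A) {k : ℕ} (F : (Fin k → ℤ) → ℝ≥0∞) :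
    ∫⁻ x : Fin k → ℝ, F (fun i => edgeIndex A (x i)) =
      (∑' ν, F ν) * ENNReal.ofReal ((kappa A)⁻¹ ^ k) := by
  have hκ := kappa_pos hA
  have hT : Measurable fun (x : Fin k → ℝ) (i : Fin k) => edgeIndex A (x i) :=
    measurable_pi_lambda _ fun i =>
      Int.measurable_floor.comp (((measurable_pi_apply i).mul_const _).const_add _)
  rw [← lintegral_map (f := F) (Measurable.of_discrete) hT, lintegral_countable',
    ← ENNReal.tsum_mul_right]
  refine tsum_congr fun ν => ?_
  have hpre : (fun (x : Fin k → ℝ) (i : Fin k) => edgeIndex A (x i)) ⁻¹' {ν} =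
      Set.univ.pi fun i => Ico (edgePos A (ν i)) (edgePos A (ν i) + (kappa A)⁻¹) := by
    ext x
    simp only [Set.mem_preimage, Set.mem_singleton_iff, funext_iff, Set.mem_univ_pi, Set.mem_Ico]
    refine forall_congr' fun i => ?_
    rw [edgeIndex, Int.floor_eq_iff, edgePos, div_le_iff₀ hκ, ← one_div, ← add_div,
      lt_div_iff₀ hκ]
    constructor <;> rintro ⟨h1, h2⟩ <;> constructor <;> linarith
  rw [Measure.map_apply hT (measurableSet_singleton ν), hpre, volume_pi_pi]
  simp only [Real.volume_Ico, add_sub_cancel_left, Finset.prod_const, Finset.card_univ,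
    Fintype.card_fin]
  rw [ENNReal.ofReal_pow (inv_nonneg.mpr hκ.le)]

/-- The lattice sum becomes a Lebesgue integral on a space independent of A; the factor κ^k offsets
the cell volume. -/
theorem moment_edgeConfig {A : ℝ} (hA : 0 < A) {P : ProbabilityMeasure (Set ℤ)}
    (hP : ∀ (k : ℕ) (ν : Fin k → ℤ), Function.Injective ν →
      (P : Measure (Set ℤ)).real {S | ∀ i, ν i ∈ S} = edgeDet A ν)
    {g : C_c(ℝ, ℝ)} (h0 : ∀ x, 0 ≤ g x) (h1 : ∀ x, g x < 1) (k : ℕ) :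
    moment ((P : Measure (Set ℤ)).map (edgeConfig A)) g k =
      ∫⁻ x : Fin k → ℝ, (∏ i, ENNReal.ofReal (g (edgePos A (edgeIndex A (x i))))) *
        ENNReal.ofReal (kappa A ^ k * edgeDet A fun i => edgeIndex A (x i)) := by
  have hκ := kappa_pos hA
  have hmeas : Measurable fun X : PointConfig =>
      ∑' x : Fin k ↪ X.carrier, ∏ i, ENNReal.ofReal (g (x i)) := by
    simp only [tsum_embedding_prod _ h0]
    exact ((measurable_symm h0 h1 k).const_mul _).ennreal_ofReal
  rw [moment, lintegral_map hmeas (measurable_edgeConfig A)]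
  simp only [fun S : Set ℤ => tsum_embedding_edgeConfig hA S (k := k)
    fun y => ∏ i, ENNReal.ofReal (g (y i))]
  have hset : ∀ ν : Fin k → ℤ,
      MeasurableSet {T : Set ℤ | Function.Injective ν ∧ ∀ i, ν i ∈ T} := fun ν =>
    (MeasurableSet.const _).inter (measurableSet_forall_mem ν)
  rw [lintegral_tsum fun ν => (measurable_const.indicator (hset ν)).aemeasurable]
  rw [lintegral_edgeIndex hA fun ν => (∏ i, ENNReal.ofReal (g (edgePos A (ν i)))) *
        ENNReal.ofReal (kappa A ^ k * edgeDet A ν), ← ENNReal.tsum_mul_right]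
  refine tsum_congr fun ν => ?_
  rw [lintegral_indicator_const (hset ν), mul_assoc, ← ENNReal.ofReal_mul' (by positivity)]
  congr 1
  have e : kappa A ^ k * edgeDet A ν * (kappa A)⁻¹ ^ k = edgeDet A ν := by
    rw [mul_right_comm, ← mul_pow, mul_inv_cancel₀ hκ.ne', one_pow, one_mul]
  rw [e]
  by_cases hν : Function.Injective ν
  · rw [← hP k ν hν, ofReal_measureReal]
    congr 1
    ext S
    exact and_iff_right hν
  · rw [edgeDet_eq_zero A hν, ENNReal.ofReal_zero]
    have : {T : Set ℤ | Function.Injective ν ∧ ∀ i, ν i ∈ T} = ∅ := by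
      ext S
      exact iff_of_false (fun h => hν h.1) id
    rw [this, measure_empty]

theorem tendsto_moment_edgeConfig {P : ℝ → ProbabilityMeasure (Set ℤ)}
    (hP : ∀ A (k : ℕ) (ν : Fin k → ℤ), Function.Injective ν →
      (P A : Measure (Set ℤ)).real {S | ∀ i, ν i ∈ S} = edgeDet A ν)
    {Q : ProbabilityMeasure PointConfig} (hQ : IsDeterminantal airyKernel Q)
    {g : C_c(ℝ, ℝ)} (h0 : ∀ x, 0 ≤ g x) (h1 : ∀ x, g x < 1) (k : ℕ) :
    Tendsto (fun A => moment ((P A : Measure (Set ℤ)).map (edgeConfig A)) g k) atTop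
      (𝓝 (moment Q g k)) := by
  obtain ⟨R, hR⟩ := exists_compact_support g
  let B : ℝ := k.factorial * (edgeConst ^ 2 * Real.exp (2 + 2 * R)) ^ k
  have hmain : Tendsto (fun A => ∫⁻ x : Fin k → ℝ,
      (∏ i, ENNReal.ofReal (g (edgePos A (edgeIndex A (x i))))) *
        ENNReal.ofReal (kappa A ^ k * edgeDet A fun i => edgeIndex A (x i))) atTop
      (𝓝 (moment Q g k)) := by
    rw [hQ.moment_eq]
    refine tendsto_lintegral_filter_of_dominated_convergence
      -- Rounding moves a point by at most 1/κ ≤ 1, hence the box enlarged by 1.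
      ((Set.univ.pi fun _ => Icc (-((R : ℝ) + 1)) (R + 1)).indicator fun _ => ENNReal.ofReal B)
      (Eventually.of_forall fun A => ?_) ?_ ?_ (Eventually.of_forall fun x => ?_)
    · have hT : Measurable fun (x : Fin k → ℝ) (i : Fin k) => edgeIndex A (x i) :=
        measurable_pi_lambda _ fun i =>
          Int.measurable_floor.comp (((measurable_pi_apply i).mul_const _).const_add _)
      exact (Measurable.of_discrete (f := fun ν : Fin k → ℤ =>
        (∏ i, ENNReal.ofReal (g (edgePos A (ν i)))) *
          ENNReal.ofReal (kappa A ^ k * edgeDet A ν))).comp hT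
    · filter_upwards [eventually_ge_atTop 2] with A hA
      refine Eventually.of_forall fun x => ?_
      by_cases hx : ∀ i, |edgePos A (edgeIndex A (x i))| ≤ R
      · have hmem : x ∈ Set.univ.pi fun _ : Fin k => Icc (-((R : ℝ) + 1)) (R + 1) := by
          intro i _
          have h1 := abs_edgePos_edgeIndex_sub_le (show 0 < A by linarith) (x i)
          have h2 : (kappa A)⁻¹ ≤ 1 := inv_le_one_of_one_le₀ (one_le_kappa hA)
          rw [Set.mem_Icc, ← abs_le]
          have h3 := abs_sub_abs_le_abs_sub (x i) (edgePos A (edgeIndex A (x i)))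
          rw [abs_sub_comm] at h3
          linarith [hx i]
        rw [Set.indicator_of_mem hmem]
        exact (mul_le_of_le_one_left' (prod_ofReal_le_one h1
          fun i => edgePos A (edgeIndex A (x i)))).trans
          (ENNReal.ofReal_le_ofReal (kappa_pow_mul_edgeDet_le hA hx))
      · obtain ⟨i, hi⟩ := not_forall.mp hx
        rw [Finset.prod_eq_zero (Finset.mem_univ i)
          (by rw [hR _ (not_le.mp hi), ENNReal.ofReal_zero]), zero_mul]
        exact zero_le
    · rw [lintegral_indicator_box]
      exact ENNReal.mul_ne_top ENNReal.ofReal_ne_top (ENNReal.pow_ne_top ENNReal.ofReal_ne_top)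
    · refine ENNReal.Tendsto.mul ?_ (Or.inr ENNReal.ofReal_ne_top) ?_ (Or.inr ?_)
      · refine ENNReal.tendsto_finsetProd_of_ne_top _ (fun i _ => ?_)
          fun i _ => ENNReal.ofReal_ne_top
        exact ENNReal.tendsto_ofReal ((g.continuous.tendsto _).comp
          (tendsto_edgePos_edgeIndex tendsto_id tendsto_const_nhds))
      · exact ENNReal.tendsto_ofReal (tendsto_kappa_pow_mul_edgeDet tendsto_id tendsto_const_nhds)
      · exact ((prod_ofReal_le_one h1 x).trans_lt ENNReal.one_lt_top).ne
  refine hmain.congr' ?_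
  filter_upwards [eventually_gt_atTop 0] with A hA
  exact (moment_edgeConfig hA (hP A) h0 h1 k).symm

/-- If the joint law of the occupations has determinantal correlations given by the edge kernel,
the rescaled configurations converge in law to the Airy process. -/
theorem tendstoInDistribution_edgeConfig {P : ℝ → ProbabilityMeasure (Set ℤ)}
    (hP : ∀ A (k : ℕ) (ν : Fin k → ℤ), Function.Injective ν →
      (P A : Measure (Set ℤ)).real {S | ∀ i, ν i ∈ S} = edgeDet A ν)
    {Q : ProbabilityMeasure PointConfig} (hQ : IsDeterminantal airyKernel Q) :
    TendstoInDistribution (fun A => edgeConfig A) atTop (id : PointConfig → PointConfig)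
      (fun A => (P A : Measure (Set ℤ))) (Q : Measure PointConfig) := by
  refine ⟨fun A => (measurable_edgeConfig A).aemeasurable, measurable_id.aemeasurable, ?_⟩
  have hid : ∀ h, (⟨(Q : Measure PointConfig).map id, h⟩ : ProbabilityMeasure PointConfig) = Q :=
    fun h => Subtype.ext Measure.map_id
  rw [hid]
  refine tendsto_of_moment fun g h0 h1 => ?_
  obtain ⟨D, hD, hle⟩ := moment_airy_le hQ h1
  refine ⟨fun k => ((hle k).trans_lt ENNReal.ofReal_lt_top).ne,
    fun k => tendsto_moment_edgeConfig hP hQ h0 h1 k, ?_⟩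
  refine squeeze_zero (fun n => by positivity) (fun n => ?_)
    (FloorSemiring.tendsto_pow_div_factorial_atTop D)
  gcongr
  exact ENNReal.toReal_le_of_le_ofReal (by positivity) (hle n)

end EdgeMoments

/-! ### One- and two-point functions -/

section Occupations

variable {𝒜 : Type*} [CStarAlgebra 𝒜]

theorem siteCorrelation_one (ω : 𝒜 →L[ℂ] ℂ) (N : ℤ → 𝒜) (ν : ℤ) :
    siteCorrelation ω N (fun _ : Fin 1 => ν) = ω (N ν) := by
  rw [siteCorrelation, if_pos (Function.injective_of_subsingleton _), expectProd]
  simp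

theorem siteCorrelation_two (ω : 𝒜 →L[ℂ] ℂ) (N : ℤ → 𝒜) {ν l : ℤ} (h : ν ≠ l) :
    siteCorrelation ω N ![ν, l] = ω (N ν * N l) := by
  have hinj : Function.Injective ![ν, l] := by
    intro i j hij
    fin_cases i <;> fin_cases j <;> simp_all
  rw [siteCorrelation, if_pos hinj, expectProd]
  simp

theorem edgeKernel_comm (A : ℝ) (ν l : ℤ) : edgeKernel A ν l = edgeKernel A l ν :=
  tsum_congr fun _ => mul_comm _ _

variable {ω : 𝒜 →L[ℂ] ℂ} {N : ℤ → 𝒜} {A : ℝ}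

theorem expect_number (hN : ∀ (k : ℕ) (ν : Fin k → ℤ), siteCorrelation ω N ν = (edgeDet A ν : ℂ))
    (ν : ℤ) : ω (N ν) = (edgeKernel A ν ν : ℂ) := by
  rw [← siteCorrelation_one, hN, edgeDet, Matrix.det_fin_one]
  rfl

theorem connected_eq (hN : ∀ (k : ℕ) (ν : Fin k → ℤ), siteCorrelation ω N ν = (edgeDet A ν : ℂ))
    {ν l : ℤ} (h : ν ≠ l) : connected ω N ν l = ((-(edgeKernel A ν l ^ 2) : ℝ) : ℂ) := by
  rw [connected, ← siteCorrelation_two ω N h, hN, expect_number hN, expect_number hN, edgeDet,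
    Matrix.det_fin_two]
  simp only [Matrix.of_apply, Matrix.cons_val_zero, Matrix.cons_val_one]
  rw [edgeKernel_comm A l ν]
  push_cast
  ring

theorem tendsto_kappa_mul_edgeKernel_edgeIndex (s t : ℝ) :
    Tendsto (fun A => kappa A * edgeKernel A (edgeIndex A s) (edgeIndex A t)) atTop
      (𝓝 (airyKernel s t)) :=
  tendsto_kappa_mul_edgeKernel tendsto_id
    (tendsto_edgePos_edgeIndex tendsto_id tendsto_const_nhds)
    (tendsto_edgePos_edgeIndex tendsto_id tendsto_const_nhds)

/-- The rescaled positions have distinct limits, so the sites separate. -/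
theorem eventually_edgeIndex_ne {s t : ℝ} (h : s ≠ t) :
    ∀ᶠ A : ℝ in atTop, edgeIndex A s ≠ edgeIndex A t := by
  have hs := tendsto_edgePos_edgeIndex tendsto_id (tendsto_const_nhds (x := s) (f := atTop))
  have ht := tendsto_edgePos_edgeIndex tendsto_id (tendsto_const_nhds (x := t) (f := atTop))
  filter_upwards [(hs.sub ht).eventually_ne (sub_ne_zero.mpr h)] with A hA hst
  exact hA (sub_eq_zero.mpr (congrArg (edgePos A) hst))

end Occupations

end SidebandEdge

end

/-! ### Assembly of the edge limit -/

open SidebandEdge in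
theorem corollary1
    {𝒜 : Type*} [CStarAlgebra 𝒜] {ι : Type*} [Fintype ι] [DecidableEq ι]
    (a : ι → ℤ → 𝒜) (ha : IsCAR a)
    (ω : 𝒜 →L[ℂ] ℂ) (hω : IsState ω)
    (U : Matrix ι ι ℂ) (hU : U ∈ Matrix.unitaryGroup ι ℂ) (α : ι)
    (hΩ μ E : ℝ) (hΩ_pos : 0 < hΩ) (hE : E ∈ Set.Ico 0 hΩ)
    (hstep : ∀ m : ℤ,
      effectiveOccupation ω a U α m = if m ≤ fermiCutoff hΩ μ E then 1 else 0) :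
    -- the rescaled correlation functions converge, locally uniformly, to the Airy ones
    (∀ k : ℕ, TendstoLocallyUniformly
      (fun (A : ℝ) (s : Fin k → ℝ) => ((kappa A : ℝ) : ℂ) ^ k *
        siteCorrelation ω (number a U α (fermiCutoff hΩ μ E) A) (fun i => edgeIndex A (s i)))
      (fun s => (((Matrix.of fun i j : Fin k => airyKernel (s i) (s j)).det : ℝ) : ℂ))
      atTop) ∧
    -- the rescaled occupation measure converges weakly, as a point process, to the Airy process
    (∃ P : ℝ → ProbabilityMeasure (Set ℤ),
      (∀ A, IsOccupationLaw ω (number a U α (fermiCutoff hΩ μ E) A) (P A)) ∧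
      ∀ Q : ProbabilityMeasure PointConfig, IsDeterminantal airyKernel Q →
        TendstoInDistribution (fun A => edgeConfig A) atTop (id : PointConfig → PointConfig)
          (fun A => (P A : Measure (Set ℤ))) (Q : Measure PointConfig)) ∧
    -- one-point function
    (∀ s : ℝ, Tendsto
      (fun A : ℝ => ((kappa A : ℝ) : ℂ) *
        ω (number a U α (fermiCutoff hΩ μ E) A (edgeIndex A s)))
      atTop (𝓝 ((airyKernel s s : ℝ) : ℂ))) ∧
    -- connected two-point function
    (∀ s t : ℝ, s ≠ t → Tendsto
      (fun A : ℝ => ((kappa A : ℝ) : ℂ) ^ 2 *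
        connected ω (number a U α (fermiCutoff hΩ μ E) A) (edgeIndex A s) (edgeIndex A t))
      atTop (𝓝 ((-(|airyKernel s t| ^ 2) : ℝ) : ℂ))) ∧
    -- dilution of the single-site occupations
    (∀ s : ℝ, Asymptotics.IsEquivalent atTop
        (fun A : ℝ => ω (number a U α (fermiCutoff hΩ μ E) A (edgeIndex A s)))
        (fun A : ℝ => (((kappa A)⁻¹ * airyKernel s s : ℝ) : ℂ)) ∧
      Tendsto (fun A : ℝ => ω (number a U α (fermiCutoff hΩ μ E) A (edgeIndex A s)))
        atTop (𝓝 0)) := by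
  have hdet : ∀ (A : ℝ) (k : ℕ) (ν : Fin k → ℤ),
      siteCorrelation ω (number a U α (fermiCutoff hΩ μ E) A) ν = (edgeDet A ν : ℂ) :=
    fun A k ν => siteCorrelation_eq_det ha hω hU hstep A ν
  have hone : ∀ s : ℝ, Tendsto (fun A : ℝ => ((kappa A : ℝ) : ℂ) *
      ω (number a U α (fermiCutoff hΩ μ E) A (edgeIndex A s))) atTop
        (𝓝 ((airyKernel s s : ℝ) : ℂ)) := fun s => by
    simp only [fun A : ℝ => expect_number (hdet A), ← Complex.ofReal_mul]
    exact (Complex.continuous_ofReal.tendsto _).comp (tendsto_kappa_mul_edgeKernel_edgeIndex s s)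
  have hκ : ∀ᶠ A : ℝ in atTop, ((kappa A : ℝ) : ℂ) ≠ 0 := by
    filter_upwards [eventually_gt_atTop 0] with A hA
    exact Complex.ofReal_ne_zero.mpr (kappa_pos hA).ne'
  have hinv : Tendsto (fun A : ℝ => ((kappa A : ℝ) : ℂ)⁻¹) atTop (𝓝 0) := by
    simpa [Function.comp_def] using
      (Complex.continuous_ofReal.tendsto 0).comp tendsto_kappa_atTop.inv_tendsto_atTop
  refine ⟨fun k => ?_, ?_, hone, fun s t hst => ?_, fun s => ⟨?_, ?_⟩⟩
  · have hlim : Continuous fun s : Fin k → ℝ =>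
        (((Matrix.of fun i j : Fin k => airyKernel (s i) (s j)).det : ℝ) : ℂ) := by
      refine Complex.continuous_ofReal.comp (Continuous.matrix_det ?_)
      refine continuous_pi fun i => continuous_pi fun j => ?_
      have hp : Continuous fun s : Fin k → ℝ => (s i, s j) := by fun_prop
      have h := continuous_airyKernel.comp hp
      simp only [Function.comp_def] at h
      exact h
    -- Locally uniform convergence is a joint limit in (A, s) at each point, which is what the
    -- filter form of the determinant limit provides, together with continuity of the limit.
    rw [tendstoLocallyUniformly_iff_forall_tendsto]
    intro s
    refine (((hlim.tendsto s).comp tendsto_snd).prodMk_nhds ?_).mono_right (nhds_le_uniformity _)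
    simp only [hdet, ← Complex.ofReal_pow, ← Complex.ofReal_mul]
    exact (Complex.continuous_ofReal.tendsto _).comp
      (tendsto_kappa_pow_mul_edgeDet tendsto_fst tendsto_snd)
  · choose P hP using fun A : ℝ => exists_isOccupationLaw hω
      (star_number a U α (fermiCutoff hΩ μ E) A)
      (number_mul_self ha hU α (fermiCutoff hΩ μ E) A)
      (number_commute ha hU α (fermiCutoff hΩ μ E) A)
    refine ⟨P, hP, fun Q hQ => tendstoInDistribution_edgeConfig (fun A k ν hν => ?_) hQ⟩
    have h := hdet A k ν
    rw [siteCorrelation, if_pos hν, hP A k ν] at h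
    exact_mod_cast h
  · have h := (Complex.continuous_ofReal.tendsto _).comp
      ((tendsto_kappa_mul_edgeKernel_edgeIndex s t).pow 2).neg
    rw [sq_abs]
    refine h.congr' ?_
    filter_upwards [eventually_edgeIndex_ne hst] with A hA
    rw [connected_eq (hdet A) hA, Function.comp_apply]
    push_cast
    ring
  -- Positivity of the Airy density permits the division that turns the scaled limit into an
  -- equivalence.
  · have hK : ((airyKernel s s : ℝ) : ℂ) ≠ 0 :=
      Complex.ofReal_ne_zero.mpr (airyKernel_self_pos s).ne'
    refine (Asymptotics.isEquivalent_iff_tendsto_one ?_).mpr ?_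
    · filter_upwards [hκ] with A hA
      push_cast
      exact mul_ne_zero (inv_ne_zero hA) hK
    · have h := (hone s).div_const ((airyKernel s s : ℝ) : ℂ)
      rw [div_self hK] at h
      refine h.congr fun A => ?_
      rw [Pi.div_apply]
      push_cast
      rw [mul_comm, ← div_eq_inv_mul, div_div_eq_mul_div]
  · have h := hinv.mul (hone s)
    rw [zero_mul] at h
    refine h.congr' ?_
    filter_upwards [hκ] with A hA
    rw [inv_mul_cancel_left₀ hA]
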